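/- Let $U,V$ be real Banach spaces, let $p\ge 2$ be real, $n=[p]$ its integer part, and $T>0$. *Tensor norm.* Let $T^n_a(V)=\bigoplus_{k=0}^n V^{\otimes_a k}$ be the truncated algebraic tensor algebra, equipped with a norm such that $\|\mathbf e\mathbf e'\|\le\|\mathbf e\|\,\|\mathbf e'\|$ for all $\mathbf e,\mathbf e'$ and $\|v\|=|v|$ for $v\in V$. Assume that the projections onto the summands $V^{\otimes_a k}$ are continuous, and that every bounded $k$-linear map from $V^k$ to a Banach space, $k\le n$, induces a bounded linear map on $V^{\otimes_a k}$ (equivalently, there is a constant $C$ such that the projective norm of the component of degree $k$ of $\mathbf e$ is at most $C\|\mathbf e\|$, for all $\mathbf e$ and $k\le n$). Let $T^n(V)=\bigoplus_{k=0}^n V^{\otimes k}$ be the completion and $\pi_k:T^n(V)\to V^{\otimes k}$ the projections. Let $\mathfrak g^n(V)$ be the closed Lie algebra generated by $V$ in $T^n(V)$ for the commutator bracket, and $\mathcal G^n(V)=\exp(\mathfrak g^n(V))$; $\log$ denotes the inverse of $\exp$, and both are polynomial maps. *Rough path.* Let $\mathbf X$ be a weak geometric Hölder $p$-rough path on $[0,T]$,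 that is, a path $\mathbf X:[0,T]\to\mathcal G^{n}(V)$ such that, with $\mathbf X_{ts}=\mathbf X_s^{-1}\mathbf X_t$, $$(\!(\mathbf X)\!)=\max_{1\le i\le n}\ \sup_{0\le s<t\le T}\frac{\|\pi_i\mathbf X_{ts}\|}{|t-s|^{i/p}}<\infty .$$ *Function spaces.* For a Banach space $W$, $\mathcal C^{n+1}(U,W)$ is the space of $(n+1)$-Lipschitz maps in the sense of Stein: maps of class $C^n$ that are bounded together with their derivatives up to order $n$, and whose $n$-th derivative is Lipschitz; its norm $\|\cdot\|_{n+1}$ is the smallest constant that bounds the map, these derivatives, and the Lipschitz constant of the $n$-th one. Write $\mathcal C^{n+1}(U)=\mathcal C^{n+1}(U,\mathbb R)$. *Differential operators.* Let $\mathrm F:V\to\mathcal C^{n+1}(U,U)$ be a continuous linear map. For $v\in V$ let $\mathrm F(v)$ also denote the operator $g\mapsto\big(x\mapsto D_xg(\mathrm F(v)(x))\big)$. Let $\mathrm F^\otimes$ be the extension to $T^n(V)$, by linearity and continuity, of $\mathrm F^\otimes(1)=\mathrm{Id}$ and $\mathrm F^\otimes(v_1\otimes\cdots\otimes v_k)=\mathrm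 F(v_1)\cdots\mathrm F(v_k)$ for $1\le k\le n$, acting on maps of class $C^n$ on $U$. **Proposition.** There is a constant $c>0$, depending on $U$, $V$, the tensor norm, $p$, $T$ and $\mathrm F$ but not on $\mathbf X$, such that the following holds for every rough path $\mathbf X$ as above and all $0\le s\le t\le T$. The differential equation $$\dot y_u=\big(\mathrm F^\otimes(\log\mathbf X_{ts})\mathrm{Id}\big)(y_u),\qquad 0\le u\le 1,$$ has a well-defined time $1$ map $\mu_{ts}:U\to U$ (from every initial point there is a solution on $[0,1]$, and all solutions with that initial point have the same endpoint), and for every $f\in\mathcal C^{n+1}(U)$ $$\big\|f\circ\mu_{ts}-\mathrm F^\otimes(\mathbf X_{ts})f\big\|_\infty\le c\,\big(1+(\!(\mathbf X)\!)^{n}\big)\,\|f\|_{n+1}\,|t-s|^{\frac{n+1}{p}} .$$ -/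

import Mathlib

open scoped TensorProduct

noncomputable section

/-! ### Stein's spaces `C^γ(U, W)` for an integer order `γ = n + 1` -/

section Stein

variable {U W : Type*} [NormedAddCommGroup U] [NormedSpace ℝ U]
  [NormedAddCommGroup W] [NormedSpace ℝ W]

/-- `f` is `(n+1)`-Lipschitz in the sense of Stein on the whole space `U`, with constant `M`:
`f` is `n` times continuously differentiable, `f` and its derivatives up to order `n` are bounded
by `M`, and the `n`-th derivative is `M`-Lipschitz.  (On a whole normed space, by Taylor's formula,
this is the same, with the same constant `M`, as the bounds `‖f^(j)‖ ≤ M` together with the bounds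
`M ‖y - x‖^(n+1-j)` on all the Taylor remainders of `f^(0) = f, …, f^(n)`.) -/
def IsSteinLip (n : ℕ) (M : ℝ) (f : U → W) : Prop :=
  ContDiff ℝ n f ∧ (∀ j ≤ n, ∀ x, ‖iteratedFDeriv ℝ j f x‖ ≤ M) ∧
    ∀ x y, ‖iteratedFDeriv ℝ n f x - iteratedFDeriv ℝ n f y‖ ≤ M * ‖x - y‖

theorem IsSteinLip.nonneg {n : ℕ} {M : ℝ} {f : U → W} (h : IsSteinLip n M f) : 0 ≤ M :=
  (norm_nonneg _).trans (h.2.1 0 (Nat.zero_le _) 0)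

theorem IsSteinLip.zero (n : ℕ) : IsSteinLip n 0 (0 : U → W) := by
  refine ⟨contDiff_const, ?_, ?_⟩ <;> simp

theorem IsSteinLip.add {n : ℕ} {M M' : ℝ} {f g : U → W} (hf : IsSteinLip n M f)
    (hg : IsSteinLip n M' g) : IsSteinLip n (M + M') (f + g) := by
  have key : ∀ j ≤ n, ∀ x, iteratedFDeriv ℝ j (f + g) x
      = iteratedFDeriv ℝ j f x + iteratedFDeriv ℝ j g x := by
    intro j hj x
    have hj' : (j : WithTop ℕ∞) ≤ n := by exact_mod_cast hj
    exact iteratedFDeriv_add_apply (hf.1.of_le hj').contDiffAt (hg.1.of_le hj').contDiffAt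
  refine ⟨hf.1.add hg.1, fun j hj x => ?_, fun x y => ?_⟩
  · rw [key j hj]
    exact (norm_add_le _ _).trans (add_le_add (hf.2.1 j hj x) (hg.2.1 j hj x))
  · rw [key n le_rfl, key n le_rfl, add_sub_add_comm, add_mul]
    exact (norm_add_le _ _).trans (add_le_add (hf.2.2 x y) (hg.2.2 x y))

theorem IsSteinLip.smul {n : ℕ} {M : ℝ} {f : U → W} (r : ℝ) (hf : IsSteinLip n M f) :
    IsSteinLip n (|r| * M) (r • f) := by
  have key : ∀ j ≤ n, ∀ x, iteratedFDeriv ℝ j (r • f) x = r • iteratedFDeriv ℝ j f x := by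
    intro j hj x
    have hj' : (j : WithTop ℕ∞) ≤ n := by exact_mod_cast hj
    exact iteratedFDeriv_const_smul_apply (hf.1.of_le hj').contDiffAt
  refine ⟨contDiff_const.smul hf.1, fun j hj x => ?_, fun x y => ?_⟩
  · rw [key j hj, norm_smul, Real.norm_eq_abs]
    exact mul_le_mul_of_nonneg_left (hf.2.1 j hj x) (abs_nonneg r)
  · rw [key n le_rfl, key n le_rfl, ← smul_sub, norm_smul, Real.norm_eq_abs, mul_assoc]
    exact mul_le_mul_of_nonneg_left (hf.2.2 x y) (abs_nonneg r)

/-- The subspace of the maps that are `(n+1)`-Lipschitz for some constant. -/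
def steinSubmodule (n : ℕ) (U W : Type*) [NormedAddCommGroup U] [NormedSpace ℝ U]
    [NormedAddCommGroup W] [NormedSpace ℝ W] : Submodule ℝ (U → W) where
  carrier := {f | ∃ M, IsSteinLip n M f}
  add_mem' := fun ⟨_, hf⟩ ⟨_, hg⟩ => ⟨_, hf.add hg⟩
  zero_mem' := ⟨0, IsSteinLip.zero n⟩
  smul_mem' := fun r _ ⟨_, hf⟩ => ⟨_, hf.smul r⟩

/-- The space `C^(n+1)(U, W)` of `(n+1)`-Lipschitz maps in the sense of Stein. -/
def SteinSpace (n : ℕ) (U W : Type*) [NormedAddCommGroup U] [NormedSpace ℝ U]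
    [NormedAddCommGroup W] [NormedSpace ℝ W] : Type _ := steinSubmodule n U W

variable {n : ℕ}

instance : AddCommGroup (SteinSpace n U W) :=
  inferInstanceAs (AddCommGroup (steinSubmodule n U W))

instance : Module ℝ (SteinSpace n U W) :=
  inferInstanceAs (Module ℝ (steinSubmodule n U W))

instance : CoeFun (SteinSpace n U W) (fun _ => U → W) := ⟨fun f => f.1⟩

/-- The natural norm of `C^(n+1)(U, W)`: the smallest constant `M`. -/
instance : Norm (SteinSpace n U W) := ⟨fun f => sInf {M | IsSteinLip n M f.1}⟩

namespace SteinSpace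

theorem norm_def (f : SteinSpace n U W) : ‖f‖ = sInf {M | IsSteinLip n M f.1} := rfl

theorem norm_le {f : SteinSpace n U W} {M : ℝ} (h : IsSteinLip n M f.1) : ‖f‖ ≤ M :=
  csInf_le ⟨0, fun _ hM => IsSteinLip.nonneg hM⟩ h

theorem isSteinLip_norm (f : SteinSpace n U W) : IsSteinLip n ‖f‖ f.1 := by
  have hne : {M | IsSteinLip n M f.1}.Nonempty := f.2
  obtain ⟨M₀, h₀⟩ := f.2
  refine ⟨h₀.1, fun j hj x => le_csInf hne fun M hM => hM.2.1 j hj x, fun x y => ?_⟩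
  rcases eq_or_ne x y with rfl | hxy
  · simp
  · have hpos : 0 < ‖x - y‖ := norm_pos_iff.2 (sub_ne_zero.2 hxy)
    rw [← div_le_iff₀ hpos]
    exact le_csInf hne fun M hM => (div_le_iff₀ hpos).2 (hM.2.2 x y)

theorem contDiff (f : SteinSpace n U W) : ContDiff ℝ n f.1 := (isSteinLip_norm f).1

end SteinSpace

theorem steinSpace_core : NormedSpace.Core ℝ (SteinSpace n U W) where
  norm_nonneg f := (SteinSpace.isSteinLip_norm f).nonneg
  norm_smul r f := by
    have hle : ∀ (r : ℝ) (f : SteinSpace n U W), ‖r • f‖ ≤ |r| * ‖f‖ := fun r f =>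
      SteinSpace.norm_le ((SteinSpace.isSteinLip_norm f).smul r)
    have hz : ‖(0 : SteinSpace n U W)‖ = 0 :=
      le_antisymm (SteinSpace.norm_le (IsSteinLip.zero n)) (SteinSpace.isSteinLip_norm _).nonneg
    refine le_antisymm (hle r f) ?_
    rcases eq_or_ne r 0 with rfl | hr
    · simp [hz]
    · have h := hle r⁻¹ (r • f)
      rw [inv_smul_smul₀ hr, abs_inv] at h
      rw [Real.norm_eq_abs]
      have hr' : 0 < |r| := abs_pos.2 hr
      calc |r| * ‖f‖ ≤ |r| * (|r|⁻¹ * ‖r • f‖) := mul_le_mul_of_nonneg_left h hr'.le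
        _ = ‖r • f‖ := by field_simp
  norm_triangle f g :=
    SteinSpace.norm_le ((SteinSpace.isSteinLip_norm f).add (SteinSpace.isSteinLip_norm g))
  norm_eq_zero_iff f := by
    constructor
    · intro h
      apply Subtype.ext
      funext x
      have h1 := (SteinSpace.isSteinLip_norm f).2.1 0 (Nat.zero_le _) x
      rw [norm_iteratedFDeriv_zero, h] at h1
      exact norm_le_zero_iff.1 h1
    · rintro rfl
      exact le_antisymm (SteinSpace.norm_le (IsSteinLip.zero n))
        (SteinSpace.isSteinLip_norm _).nonneg

instance : NormedAddCommGroup (SteinSpace n U W) := NormedAddCommGroup.ofCore steinSpace_core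

instance : NormedSpace ℝ (SteinSpace n U W) := NormedSpace.ofCore steinSpace_core

end Stein

/-! ### The truncated tensor algebra, tensor norms and completion -/

section Tensor

variable {V : Type*} [NormedAddCommGroup V] [NormedSpace ℝ V]

variable (V) in
/-- The degree `k` component `V^{⊗ₐ k}` of an element of the algebraic tensor algebra. -/
def tensorComponent (k : ℕ) : TensorAlgebra ℝ V →ₗ[ℝ] ⨂[ℝ]^k V :=
  (DirectSum.component ℝ ℕ (fun k => ⨂[ℝ]^k V) k).comp
    (TensorAlgebra.equivDirectSum (R := ℝ) (M := V)).toLinearMap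

variable (V) in
/-- The projection onto the elements of degree `k`, inside the algebraic tensor algebra. -/
def tensorProj (k : ℕ) : TensorAlgebra ℝ V →ₗ[ℝ] TensorAlgebra ℝ V :=
  (TensorPower.toTensorAlgebra (R := ℝ) (M := V) (n := k)).comp (tensorComponent V k)

variable (V) in
/-- An algebra norm on the truncated algebraic tensor algebra `T^n_a(V) = ⨁_{k ≤ n} V^{⊗ₐ k}`.
It is given as a submultiplicative seminorm on the whole tensor algebra which vanishes exactly on
the ideal of elements with no component of degree `≤ n`.  It extends the norm of `V`.

The last field says that the topology of the norm is fine enough for the constructions on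
`T^n_a(V)` to extend to the completion: the component of degree `k ≤ n` depends continuously on the
element, for the projective norm on `V^{⊗ₐ k}` (the norm on `⨂[ℝ]^k V` in Mathlib).  Equivalently,
the projections onto `V^{⊗ₐ k}` are continuous and every bounded `k`-linear map on `V^k` induces
a bounded linear map on `V^{⊗ₐ k}`. -/
structure TensorNorm (n : ℕ) where
  toSeminorm : Seminorm ℝ (TensorAlgebra ℝ V)
  map_mul_le : ∀ a b, toSeminorm (a * b) ≤ toSeminorm a * toSeminorm b
  map_ι : ∀ v : V, toSeminorm (TensorAlgebra.ι ℝ v) = ‖v‖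
  eq_zero_iff : ∀ a, toSeminorm a = 0 ↔ ∀ k ≤ n, tensorComponent V k a = 0
  exists_bound : ∃ C : ℝ, ∀ k ≤ n, ∀ a, ‖tensorComponent V k a‖ ≤ C * toSeminorm a

/-- The tensor algebra equipped with the given seminorm, whose associated normed algebra
is `T^n_a(V)`. -/
def AlgTensor {n : ℕ} (_q : TensorNorm V n) : Type _ := TensorAlgebra ℝ V

variable {n : ℕ} (q : TensorNorm V n)

instance : Ring (AlgTensor q) := inferInstanceAs (Ring (TensorAlgebra ℝ V))

instance : Algebra ℝ (AlgTensor q) := inferInstanceAs (Algebra ℝ (TensorAlgebra ℝ V))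

instance : SeminormedRing (AlgTensor q) where
  norm a := q.toSeminorm a
  dist a b := q.toSeminorm (-a + b)
  dist_self a := by
    rw [neg_add_cancel a]
    exact map_zero q.toSeminorm
  dist_comm a b := by
    have h : -(-a + b) = -b + a := by abel
    rw [← h]
    exact (map_neg_eq_map q.toSeminorm (-a + b : AlgTensor q)).symm
  dist_triangle a b c := by
    have h : -a + c = (-a + b) + (-b + c) := by abel
    rw [h]
    exact map_add_le_add q.toSeminorm (-a + b : AlgTensor q) (-b + c : AlgTensor q)
  dist_eq _ _ := rfl
  norm_mul_le a b := q.map_mul_le a b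

instance : NormedAlgebra ℝ (AlgTensor q) where
  norm_smul_le r a := (map_smul_eq_mul q.toSeminorm r a).le

/-- The Banach algebra `T^n(V)`: the (separated) completion of `T^n_a(V)`. -/
abbrev TensorBanach : Type _ := UniformSpace.Completion (AlgTensor q)

/-- The inclusion of `V` in `T^n(V)`. -/
def tensorIncl (v : V) : TensorBanach q :=
  UniformSpace.Completion.coe' (α := AlgTensor q) (TensorAlgebra.ι ℝ v)

/-- The projection `π_k` of `T^n(V)` onto its degree `k` component `V^{⊗ k}` (the completion of
`V^{⊗ₐ k}`, seen inside `T^n(V)`): the continuous extension of the algebraic projection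
(see `piProj_coe`). -/
def piProj (k : ℕ) : TensorBanach q → TensorBanach q :=
  UniformSpace.Completion.map (fun a : AlgTensor q => (tensorProj V k a : AlgTensor q))

variable {q}

/-- The exponential map on `T^n_0(V)`, a polynomial of degree `n`. -/
def tensorExp (e : TensorBanach q) : TensorBanach q :=
  ∑ k ∈ Finset.range (n + 1), ((k.factorial : ℝ)⁻¹) • e ^ k

/-- The logarithm map on `T^n_1(V)`, a polynomial of degree `n`. -/
def tensorLog (e : TensorBanach q) : TensorBanach q :=
  ∑ k ∈ Finset.Icc 1 n, ((-1 : ℝ) ^ (k + 1) / (k : ℝ)) • (e - 1) ^ k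

variable (q)

attribute [local instance] LieRing.ofAssociativeRing LieAlgebra.ofAssociativeAlgebra

/-- The closed Lie algebra `𝔤^n(V)` generated by `V` in `T^n(V)`, for the commutator bracket. -/
def lieElements : Set (TensorBanach q) :=
  closure (LieSubalgebra.lieSpan ℝ (TensorBanach q) (Set.range (tensorIncl q)) :
    Set (TensorBanach q))

/-- `𝒢^n(V) = exp (𝔤^n(V))`. -/
def groupElements : Set (TensorBanach q) := tensorExp '' lieElements q

variable {q}

/-! ### Weak geometric Hölder rough paths -/

/-- The increment `X_{ts} = X_s⁻¹ X_t`. -/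
def increment (X : ℝ → TensorBanach q) (t s : ℝ) : TensorBanach q := Ring.inverse (X s) * X t

/-- The quotients `‖π_i X_{ts}‖ / |t - s|^{i/p}`, for `0 ≤ s < t ≤ T`. -/
def holderQuotients (p T : ℝ) (X : ℝ → TensorBanach q) (i : ℕ) : Set ℝ :=
  {r | ∃ s t : ℝ, 0 ≤ s ∧ s < t ∧ t ≤ T ∧
    r = ‖piProj q i (increment X t s)‖ / |t - s| ^ ((i : ℝ) / p)}

/-- A weak geometric Hölder `p`-rough path on `[0, T]`; only the restriction of `X` to `[0, T]`
matters.  Here `q` is a tensor norm on `T^[p]_a(V)`, that is, `n = [p]`. -/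
structure IsWeakGeometricRoughPath (p T : ℝ) (X : ℝ → TensorBanach q) : Prop where
  mem_group : ∀ t ∈ Set.Icc 0 T, X t ∈ groupElements q
  bddAbove : ∀ i ∈ Finset.Icc 1 n, BddAbove (holderQuotients p T X i)

/-- The norm of a rough path: the maximum over `1 ≤ i ≤ n` of the suprema of the quotients
`‖π_i X_{ts}‖ / |t - s|^{i/p}`. -/
def roughNorm (p T : ℝ) (X : ℝ → TensorBanach q) : ℝ :=
  sSup (⋃ i ∈ Finset.Icc 1 n, holderQuotients p T X i)

end Tensor

/-! ### The differential operators `F^⊗` -/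

section DiffOp

variable {V U W : Type*} [NormedAddCommGroup V] [NormedSpace ℝ V]
  [NormedAddCommGroup U] [NormedSpace ℝ U] [NormedAddCommGroup W] [NormedSpace ℝ W]

variable (U W) in
/-- The `j` times continuously differentiable maps. -/
def ckSubmodule (j : ℕ) : Submodule ℝ (U → W) where
  carrier := {f | ContDiff ℝ j f}
  add_mem' {f g} (hf : ContDiff ℝ j f) (hg : ContDiff ℝ j g) := hf.add hg
  zero_mem' := (contDiff_const : ContDiff ℝ j (fun _ : U => (0 : W)))
  smul_mem' r f (hf : ContDiff ℝ j f) :=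
    ((contDiff_const : ContDiff ℝ j (fun _ : U => r)).smul hf : ContDiff ℝ j _)

variable {n : ℕ}

/-- The first order differential operator `g ↦ (x ↦ D_x g (F(v)(x)))` attached to the vector
field `F(v)`. -/
def fieldOp (F : V →L[ℝ] SteinSpace n U U) (v : V) (g : U → W) : U → W :=
  fun x => fderiv ℝ g x (F v x)

theorem contDiff_fieldOp (F : V →L[ℝ] SteinSpace n U U) (v : V) {i : ℕ} (hi : i < n) {g : U → W}
    (hg : ContDiff ℝ ((n - i : ℕ) : WithTop ℕ∞) g) :
    ContDiff ℝ ((n - (i + 1) : ℕ) : WithTop ℕ∞) (fieldOp F v g) := by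
  have h1 : ((n - (i + 1) : ℕ) : WithTop ℕ∞) + 1 ≤ ((n - i : ℕ) : WithTop ℕ∞) := by
    have : n - (i + 1) + 1 ≤ n - i := by omega
    exact_mod_cast this
  have h2 : ((n - (i + 1) : ℕ) : WithTop ℕ∞) ≤ (n : WithTop ℕ∞) := by
    have : n - (i + 1) ≤ n := by omega
    exact_mod_cast this
  exact (hg.fderiv_right h1).clm_apply ((F v).contDiff.of_le h2)

theorem differentiable_of_mem_ck {i : ℕ} (hi : i < n) (g : ckSubmodule U W (n - i)) :
    Differentiable ℝ g.1 := by
  have hg : ContDiff ℝ ((n - i : ℕ) : WithTop ℕ∞) g.1 := g.2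
  refine hg.differentiable ?_
  have : n - i ≠ 0 := by omega
  exact_mod_cast this

/-- The operators `F(v)`, acting on sequences `(g_i)` with `g_i` of class `C^{n-i}`, as degree one
operators: the term of index `i + 1` of the image is `F(v) g_i` for `i < n`, the others vanish. -/
def shiftOp (W : Type*) [NormedAddCommGroup W] [NormedSpace ℝ W]
    (F : V →L[ℝ] SteinSpace n U U) :
    V →ₗ[ℝ] Module.End ℝ (∀ i : ℕ, ckSubmodule U W (n - i)) where
  toFun v :=
    { toFun := fun g i => match i with
        | 0 => 0
        | i + 1 => if h : i < n then ⟨fieldOp F v (g i).1, contDiff_fieldOp F v h (g i).2⟩ else 0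
      map_add' := by
        intro g g'
        funext i
        rcases i with _ | i
        · simp
        · by_cases h : i < n
          · apply Subtype.ext
            funext x
            simp only [h, dite_true, Pi.add_apply, Submodule.coe_add, fieldOp]
            rw [fderiv_add (differentiable_of_mem_ck h (g i) x)
              (differentiable_of_mem_ck h (g' i) x)]
            rfl
          · simp [h]
      map_smul' := by
        intro r g
        funext i
        rcases i with _ | i
        · simp
        · by_cases h : i < n
          · apply Subtype.ext
            funext x
            simp only [h, dite_true, Pi.smul_apply, Submodule.coe_smul, fieldOp, RingHom.id_apply]
            rw [fderiv_const_smul (differentiable_of_mem_ck h (g i) x)]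
            rfl
          · simp [h] }
  map_add' v w := by
    apply LinearMap.ext
    intro g
    funext i
    rcases i with _ | i
    · simp
    · by_cases h : i < n
      · apply Subtype.ext
        funext x
        simp only [map_add, LinearMap.coe_mk, AddHom.coe_mk, h, dite_true, LinearMap.add_apply,
          Pi.add_apply, Submodule.coe_add, fieldOp]
        exact map_add (fderiv ℝ (g i).1 x) (F v x) (F w x)
      · simp [h]
  map_smul' r v := by
    apply LinearMap.ext
    intro g
    funext i
    rcases i with _ | i
    · simp
    · by_cases h : i < n
      · apply Subtype.ext
        funext x
        simp only [map_smul, LinearMap.coe_mk, AddHom.coe_mk, h, dite_true, LinearMap.smul_apply,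
          Pi.smul_apply, Submodule.coe_smul, fieldOp, RingHom.id_apply]
        exact map_smul (fderiv ℝ (g i).1 x) r (F v x)
      · simp [h]

/-- `F^⊗(a) f`, for `a` in the algebraic tensor algebra and `f` of class `C^n`: it is linear in
`a`, equals `F(v₁)(⋯(F(v_k) f))` for `a = v₁ ⊗ ⋯ ⊗ v_k` if `k ≤ n`, and `0` if `k > n`
(see `tensorOpAlg_prod`). -/
def tensorOpAlg (F : V →L[ℝ] SteinSpace n U U) (a : TensorAlgebra ℝ V) (f : U → W)
    (hf : ContDiff ℝ n f) : U → W :=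
  ∑ k ∈ Finset.range (n + 1),
    (TensorAlgebra.lift ℝ (shiftOp W F) a
      (Pi.single (M := fun i : ℕ => ckSubmodule U W (n - i)) 0 ⟨f, hf⟩) k).1

theorem shiftOp_zero (F : V →L[ℝ] SteinSpace n U U) (v : V)
    (g : ∀ i : ℕ, ckSubmodule U W (n - i)) : (shiftOp W F v g 0).1 = 0 := rfl

theorem shiftOp_succ (F : V →L[ℝ] SteinSpace n U U) (v : V)
    (g : ∀ i : ℕ, ckSubmodule U W (n - i)) (i : ℕ) :
    (shiftOp W F v g (i + 1)).1 = if i < n then fieldOp F v (g i).1 else 0 := by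
  by_cases h : i < n
  · simp [shiftOp, h]
  · simp [shiftOp, h]

theorem lift_shiftOp_prod (F : V →L[ℝ] SteinSpace n U U) (l : List V) (f : U → W)
    (hf : ContDiff ℝ n f) (k : ℕ) :
    (TensorAlgebra.lift ℝ (shiftOp W F) (l.map (TensorAlgebra.ι ℝ)).prod
      (Pi.single (M := fun i : ℕ => ckSubmodule U W (n - i)) 0 ⟨f, hf⟩) k).1 =
    if k = l.length ∧ k ≤ n then l.foldr (fieldOp F) f else 0 := by
  induction l generalizing k with
  | nil =>
    rcases k with _ | k
    · simp
    · simp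
  | cons v l ih =>
    rw [List.map_cons, List.prod_cons, map_mul, TensorAlgebra.lift_ι_apply, Module.End.mul_apply]
    rcases k with _ | k
    · rw [shiftOp_zero]
      simp
    · rw [shiftOp_succ, ih k]
      by_cases h : k < n
      · rw [if_pos h]
        by_cases hk : k = l.length
        · subst hk
          rw [if_pos ⟨rfl, h.le⟩, if_pos ⟨rfl, h⟩]
          rfl
        · have hk' : ¬ (k + 1 = (v :: l).length ∧ k + 1 ≤ n) := by
            rw [List.length_cons]
            omega
          rw [if_neg (fun h' => hk h'.1), if_neg hk']
          funext x
          simp [fieldOp, fderiv_zero]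
      · rw [if_neg h, if_neg (fun h' => h h'.2)]

theorem tensorOpAlg_prod (F : V →L[ℝ] SteinSpace n U U) (l : List V) (f : U → W)
    (hf : ContDiff ℝ n f) :
    tensorOpAlg F (l.map (TensorAlgebra.ι ℝ)).prod f hf =
      if l.length ≤ n then l.foldr (fieldOp F) f else 0 := by
  unfold tensorOpAlg
  simp only [lift_shiftOp_prod]
  by_cases h : l.length ≤ n
  · rw [if_pos h, Finset.sum_eq_single l.length]
    · simp [h]
    · intro b _ hb
      simp [hb]
    · intro hb
      exact absurd (Finset.mem_range.2 (Nat.lt_succ_of_le h)) hb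
  · rw [if_neg h]
    refine Finset.sum_eq_zero fun k _ => if_neg ?_
    rintro ⟨rfl, hk⟩
    exact h hk

/-- `F^⊗(e) f`, for `e` in the completed algebra `T^n(V)`: the extension of `a ↦ F^⊗(a) f (x)`,
which is linear and bounded on `T^n_a(V)`, by continuity (see `tensorOp_coe`). -/
def tensorOp {q : TensorNorm V n} (F : V →L[ℝ] SteinSpace n U U) (e : TensorBanach q)
    (f : U → W) (hf : ContDiff ℝ n f) : U → W :=
  fun x => UniformSpace.Completion.extension
    (fun a : AlgTensor q => tensorOpAlg F (a : TensorAlgebra ℝ V) f hf x) e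

/-- `μ` is the time 1 map of the autonomous differential equation `ẏ = A(y)`: every point `x` is
the initial condition of a solution on `[0, 1]` that ends at `μ x`. -/
def IsTimeOneMap (A : U → U) (μ : U → U) : Prop :=
  ∀ x, ∃ y : ℝ → U, y 0 = x ∧ y 1 = μ x ∧
    ∀ u ∈ Set.Icc (0 : ℝ) 1, HasDerivWithinAt y (A (y u)) (Set.Icc 0 1) u

end DiffOp

/-! ### The extensions `π_k` and `F^⊗` to the completion are the continuous ones -/

section Extension

variable {V U W : Type*} [NormedAddCommGroup V] [NormedSpace ℝ V]
  [NormedAddCommGroup U] [NormedSpace ℝ U] [NormedAddCommGroup W] [NormedSpace ℝ W] {n : ℕ}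

/-- `(v₁, …, v_k) ↦ F(v₁)(⋯(F(v_k) f))` is bounded at each point, with its derivatives up to
order `n - k`. -/
theorem foldr_fieldOp_bound (F : V →L[ℝ] SteinSpace n U U) {f : U → W} (hf : ContDiff ℝ n f)
    (x : U) (k : ℕ) : k ≤ n → ∀ j, j ≤ n - k → ∃ C : ℝ, ∀ l : List V, l.length = k →
      ContDiff ℝ ((n - k : ℕ) : WithTop ℕ∞) (l.foldr (fieldOp F) f) ∧
      ‖iteratedFDeriv ℝ j (l.foldr (fieldOp F) f) x‖ ≤ C * (l.map (‖·‖)).prod := by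
  induction k with
  | zero =>
    intro _ j _
    refine ⟨‖iteratedFDeriv ℝ j f x‖, fun l hl => ?_⟩
    obtain rfl := List.length_eq_zero_iff.1 hl
    simpa using hf
  | succ k ih =>
    intro hk j hj
    have ih' := ih (by omega)
    choose! C hC using ih'
    refine ⟨∑ i ∈ Finset.range (j + 1), (j.choose i : ℝ) * C (i + 1) * ‖F‖, fun l hl => ?_⟩
    obtain _ | ⟨v, l⟩ := l
    · simp at hl
    have hl' : l.length = k := by simpa using hl
    have hg := (hC 0 (Nat.zero_le _) l hl').1
    refine ⟨contDiff_fieldOp F v (by omega) hg, ?_⟩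
    set g := l.foldr (fieldOp F) f with hgdef
    have h1 : ((n - (k + 1) : ℕ) : WithTop ℕ∞) + 1 ≤ ((n - k : ℕ) : WithTop ℕ∞) := by
      have : n - (k + 1) + 1 ≤ n - k := by omega
      exact_mod_cast this
    have h2 : ((n - (k + 1) : ℕ) : WithTop ℕ∞) ≤ (n : WithTop ℕ∞) := by
      have : n - (k + 1) ≤ n := by omega
      exact_mod_cast this
    have hle := norm_iteratedFDeriv_clm_apply (hg.fderiv_right h1) ((F v).contDiff.of_le h2) x
      (n := j) (by exact_mod_cast hj)
    refine hle.trans ?_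
    rw [Finset.sum_mul]
    refine Finset.sum_le_sum fun i hi => ?_
    have hi' : i ≤ j := Nat.lt_succ_iff.1 (Finset.mem_range.1 hi)
    rw [norm_iteratedFDeriv_fderiv]
    have b1 := (hC (i + 1) (by omega) l hl').2
    have b2 : ‖iteratedFDeriv ℝ (j - i) (F v).1 x‖ ≤ ‖F‖ * ‖v‖ :=
      ((SteinSpace.isSteinLip_norm (F v)).2.1 (j - i) (by omega) x).trans (F.le_opNorm v)
    simp only [List.map_cons, List.prod_cons]
    calc (j.choose i : ℝ) * ‖iteratedFDeriv ℝ (i + 1) g x‖ * ‖iteratedFDeriv ℝ (j - i) (F v).1 x‖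
        ≤ (j.choose i : ℝ) * (C (i + 1) * (l.map (‖·‖)).prod) * (‖F‖ * ‖v‖) := by
          have b3 := (norm_nonneg _).trans b1
          gcongr
      _ = _ := by ring

/-- The linear map `a ↦ F^⊗(a) f (x)`. -/
def tensorOpLin (F : V →L[ℝ] SteinSpace n U U) (f : U → W) (hf : ContDiff ℝ n f) (x : U) :
    TensorAlgebra ℝ V →ₗ[ℝ] W where
  toFun a := tensorOpAlg F a f hf x
  map_add' a b := by
    simp [tensorOpAlg, Finset.sum_apply, Finset.sum_add_distrib]
  map_smul' r a := by
    simp [tensorOpAlg, Finset.sum_apply, Finset.smul_sum]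

theorem tensorOpLin_toTensorAlgebra (F : V →L[ℝ] SteinSpace n U U) (f : U → W)
    (hf : ContDiff ℝ n f) (x : U) (k : ℕ) : ∃ C, 0 ≤ C ∧ ∀ t : ⨂[ℝ]^k V,
      ‖tensorOpLin F f hf x (TensorPower.toTensorAlgebra t)‖ ≤ C * ‖t‖ := by
  let B : MultilinearMap ℝ (fun _ : Fin k => V) W :=
    (tensorOpLin F f hf x).compMultilinearMap (TensorAlgebra.tprod ℝ V k)
  have hB : ∀ m, B m = if k ≤ n then (List.ofFn m).foldr (fieldOp F) f x else 0 := by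
    intro m
    have := congrFun (tensorOpAlg_prod F (List.ofFn m) f hf) x
    simp only [List.length_ofFn, List.map_ofFn] at this
    have e : B m = tensorOpAlg F (List.ofFn (TensorAlgebra.ι ℝ ∘ m)).prod f hf x := by
      simp [B, tensorOpLin, TensorAlgebra.tprod_apply, Function.comp_def]
    rw [e, this]
    split_ifs <;> rfl
  obtain ⟨C, hC0, hC⟩ : ∃ C : ℝ, 0 ≤ C ∧ ∀ m, ‖B m‖ ≤ C * ∏ i, ‖m i‖ := by
    by_cases hk : k ≤ n
    · obtain ⟨C, hC⟩ := foldr_fieldOp_bound F hf x k hk 0 (Nat.zero_le _)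
      refine ⟨|C|, abs_nonneg _, fun m => ?_⟩
      rw [hB, if_pos hk]
      have := (hC (List.ofFn m) (by simp)).2
      rw [norm_iteratedFDeriv_zero] at this
      refine this.trans ?_
      rw [List.map_ofFn, List.prod_ofFn]
      exact mul_le_mul_of_nonneg_right (le_abs_self C)
        (Finset.prod_nonneg fun _ _ => norm_nonneg _)
    · exact ⟨0, le_rfl, fun m => by simp [hB, hk]⟩
  refine ⟨C, hC0, fun t => ?_⟩
  have h := PiTensorProduct.norm_eval_le_projectiveSeminorm (B.mkContinuous C hC) t
  have e : tensorOpLin F f hf x (TensorPower.toTensorAlgebra t)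
      = PiTensorProduct.lift (B.mkContinuous C hC).toMultilinearMap t := by
    have : (tensorOpLin F f hf x).comp (TensorPower.toTensorAlgebra (n := k))
        = PiTensorProduct.lift B := by
      apply PiTensorProduct.ext
      ext m
      simp [B]
    exact LinearMap.congr_fun this t
  rw [e]
  exact h.trans (mul_le_mul_of_nonneg_right (MultilinearMap.mkContinuous_norm_le _ hC0 _)
    (norm_nonneg _))

theorem tensorOpAlg_bound {q : TensorNorm V n} (F : V →L[ℝ] SteinSpace n U U) (f : U → W)
    (hf : ContDiff ℝ n f) (x : U) : ∃ C, ∀ a : AlgTensor q,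
      ‖tensorOpAlg F (a : TensorAlgebra ℝ V) f hf x‖ ≤ C * ‖a‖ := by
  choose C hC0 hC using tensorOpLin_toTensorAlgebra F f hf x
  obtain ⟨D, hD⟩ := q.exists_bound
  have htop : ∀ k, n < k → ∀ t : ⨂[ℝ]^k V,
      tensorOpLin F f hf x (TensorPower.toTensorAlgebra t) = 0 := by
    intro k hk t
    have : (tensorOpLin F f hf x).comp (TensorPower.toTensorAlgebra (n := k)) = 0 := by
      apply PiTensorProduct.ext
      ext m
      have := congrFun (tensorOpAlg_prod F (List.ofFn m) f hf) x
      simp only [List.length_ofFn, List.map_ofFn, if_neg (not_le.2 hk)] at this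
      simpa [tensorOpLin, TensorAlgebra.tprod_apply, Function.comp_def] using this
    exact LinearMap.congr_fun this t
  have hdec : ∀ b : DirectSum ℕ (fun k => ⨂[ℝ]^k V),
      tensorOpLin F f hf x (TensorAlgebra.ofDirectSum b) =
      ∑ k ∈ Finset.range (n + 1), tensorOpLin F f hf x (TensorPower.toTensorAlgebra (b k)) := by
    intro b
    induction b using DirectSum.induction_on with
    | zero => simp
    | of i t =>
      have e : TensorAlgebra.ofDirectSum (DirectSum.of (fun k => ⨂[ℝ]^k V) i t)
          = TensorPower.toTensorAlgebra t :=
        DirectSum.toAddMonoid_of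
          (fun _ ↦ LinearMap.toAddMonoidHom TensorPower.toTensorAlgebra) _ _
      rw [e]
      by_cases hi : i ≤ n
      · rw [Finset.sum_eq_single i]
        · rw [DirectSum.of_eq_same]
        · intro k _ hk
          rw [DirectSum.of_eq_of_ne _ _ _ hk]
          simp
        · intro h
          exact absurd (Finset.mem_range.2 (Nat.lt_succ_of_le hi)) h
      · rw [htop i (not_le.1 hi)]
        refine (Finset.sum_eq_zero fun k hk => ?_).symm
        have : k ≠ i := by
          have := Finset.mem_range.1 hk
          omega
        rw [DirectSum.of_eq_of_ne _ _ _ this]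
        simp
    | add b c hb hc => simp only [map_add, hb, hc, DirectSum.add_apply, Finset.sum_add_distrib]
  refine ⟨∑ k ∈ Finset.range (n + 1), C k * D, fun a => ?_⟩
  have h := (congrArg (tensorOpLin F f hf x)
    (TensorAlgebra.ofDirectSum_toDirectSum (R := ℝ) (M := V) a)).symm.trans
    (hdec (TensorAlgebra.toDirectSum (a : TensorAlgebra ℝ V)))
  change ‖tensorOpLin F f hf x a‖ ≤ _
  rw [h, Finset.sum_mul]
  refine (norm_sum_le _ _).trans (Finset.sum_le_sum fun k hk => ?_)
  refine (hC k _).trans ?_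
  rw [mul_assoc]
  exact mul_le_mul_of_nonneg_left (hD k (Nat.lt_succ_iff.1 (Finset.mem_range.1 hk)) a) (hC0 k)

theorem list_prod_ι_le (q : TensorNorm V n) (l : List V) :
    q.toSeminorm (l.map (TensorAlgebra.ι ℝ)).prod ≤ q.toSeminorm 1 * (l.map (‖·‖)).prod := by
  induction l with
  | nil => simp
  | cons v l ih =>
    simp only [List.map_cons, List.prod_cons]
    refine (q.map_mul_le _ _).trans ?_
    rw [q.map_ι]
    calc ‖v‖ * q.toSeminorm (l.map (TensorAlgebra.ι ℝ)).prod
        ≤ ‖v‖ * (q.toSeminorm 1 * (l.map (‖·‖)).prod) :=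
          mul_le_mul_of_nonneg_left ih (norm_nonneg v)
      _ = _ := by ring

/-- For `k ≤ n`, `π_k` is continuous and extends the algebraic projection. -/
theorem piProj_coe (q : TensorNorm V n) {k : ℕ} (hk : k ≤ n) :
    Continuous (piProj q k) ∧
    ∀ a : AlgTensor q, piProj q k (a : TensorBanach q)
      = UniformSpace.Completion.coe' (α := AlgTensor q) (tensorProj V k a) := by
  obtain ⟨D, hD⟩ := q.exists_bound
  let B : MultilinearMap ℝ (fun _ : Fin k => V) (AlgTensor q) := TensorAlgebra.tprod ℝ V k
  have hB : ∀ m, ‖B m‖ ≤ q.toSeminorm 1 * ∏ i, ‖m i‖ := by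
    intro m
    have h := list_prod_ι_le q (List.ofFn m)
    rw [List.map_ofFn, List.map_ofFn, List.prod_ofFn] at h
    have e : B m = (List.ofFn (TensorAlgebra.ι ℝ ∘ m)).prod := TensorAlgebra.tprod_apply ℝ V m
    rw [e]
    exact h
  have hq : 0 ≤ q.toSeminorm 1 := apply_nonneg _ _
  let L : AlgTensor q →ₗ[ℝ] AlgTensor q := tensorProj V k
  have hbound : ∀ a : AlgTensor q, ‖L a‖ ≤ q.toSeminorm 1 * D * ‖a‖ := by
    intro a
    have h := PiTensorProduct.norm_eval_le_projectiveSeminorm (B.mkContinuous _ hB)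
      (tensorComponent V k a)
    refine LE.le.trans (b := ‖B.mkContinuous _ hB‖ * ‖tensorComponent V k a‖) h ?_
    rw [mul_assoc]
    exact mul_le_mul (MultilinearMap.mkContinuous_norm_le _ hq _) (hD k hk a) (norm_nonneg _) hq
  have huc : UniformContinuous L := (L.mkContinuous _ hbound).uniformContinuous
  exact ⟨UniformSpace.Completion.continuous_map, fun a => UniformSpace.Completion.map_coe huc a⟩

/-- `e ↦ F^⊗(e) f (x)` is continuous and extends its algebraic version. -/
theorem tensorOp_coe [CompleteSpace W] {q : TensorNorm V n} (F : V →L[ℝ] SteinSpace n U U)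
    (f : U → W) (hf : ContDiff ℝ n f) (x : U) :
    Continuous (fun e : TensorBanach q => tensorOp F e f hf x) ∧
    ∀ a : AlgTensor q, tensorOp F (a : TensorBanach q) f hf x
      = tensorOpAlg F (a : TensorAlgebra ℝ V) f hf x := by
  obtain ⟨C, hC⟩ := tensorOpAlg_bound (q := q) F f hf x
  have huc : UniformContinuous
      (fun a : AlgTensor q => tensorOpAlg F (a : TensorAlgebra ℝ V) f hf x) := by
    let L : AlgTensor q →ₗ[ℝ] W := tensorOpLin F f hf x
    exact (L.mkContinuous C hC).uniformContinuous
  exact ⟨UniformSpace.Completion.continuous_extension,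
    fun a => UniformSpace.Completion.extension_coe huc a⟩
end Extension


end

/-! Write `Λ` for the logarithm of the increment `e = X_{ts}`. Suppose that `F^⊗(Λ)` acts as the
first order operator along the field `F^⊗(Λ) Id`. Then, along a solution `y`, the derivative of
`(F^⊗(Λ^k) f)(y_u)` is `(F^⊗(Λ^{k+1}) f)(y_u)` up to words of degree greater than `n`. Taylor's
formula gives `f(y_1) = ∑ (1/k!) F^⊗(Λ^k) f (y_0) + error = F^⊗(exp Λ) f (y_0) + error`. If the
component of degree `i` has size `h^i`, the error has size `h^{n+1}`. Four points need care.

First order action. The element `e` is a limit of products `exp a · exp b` with `a`, `b` in the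
algebraic Lie algebra. Modulo degree greater than `n` such a product is group-like, so its logarithm
is primitive. The convolution of the Dynkin operator `D` with the identity is the grading, hence a
primitive element of degree `k` satisfies `k a = D a` and is a combination of iterated brackets
(`smul_tensorProj_logTrunc`). Brackets act as vector fields because second derivatives are symmetric
(`ActsAsVectorField.commutator_ι`).

Regularity. Operators of degree `n` send `f` to a function that is only Lipschitz and cannot be
differentiated along `y`. The component of degree `n` is therefore frozen at `y_0`, which costs `h^n
‖y_u - y_0‖`, again of order `h^{n+1}` (`taylor_step`, `taylor_expansion`).

Power of the rough norm. From `‖π_i e‖ ≤ r ρ^i` alone, degree one would force `h = r ρ` and a factor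
`r^{n+1}`. For a group-like element the square of the degree one component is twice the symmetric
part of the degree two component (`exists_sq_le_of_isLieLike`). So `h` can be taken of order `max(1,
r)^{1/2} ρ`, and `(n+1)/2 ≤ n` leaves `1 + r^n` (`exists_error_le`).

Completion. All estimates are proved on the algebraic tensor algebra with uniform constants and for
approximate solutions with defect `δ`. The field `F^⊗(Λ) Id` is bounded and Lipschitz, so the flow
exists and is unique. Its solutions are approximate solutions for the approximating elements, with
`δ → 0` (`exists_flow_estimate`). -/

open scoped TensorProduct

noncomputable section

/-! ### Truncated exponential and logarithm -/

section TruncatedExpLog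

open Polynomial

variable {R S : Type*} [Ring R] [Algebra ℝ R] [Ring S] [Algebra ℝ S]

/-- The exponential series, truncated after the degree `n`. -/
def expTrunc (n : ℕ) (x : R) : R :=
  ∑ k ∈ Finset.range (n + 1), ((k.factorial : ℝ)⁻¹) • x ^ k

/-- The logarithm series at `1`, truncated after the degree `n`. -/
def logTrunc (n : ℕ) (e : R) : R :=
  ∑ k ∈ Finset.Icc 1 n, ((-1 : ℝ) ^ (k + 1) / (k : ℝ)) • (e - 1) ^ k

theorem map_expTrunc (g : R →ₐ[ℝ] S) (n : ℕ) (x : R) :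
    g (expTrunc n x) = expTrunc n (g x) := by
  simp [expTrunc, map_sum]

theorem map_logTrunc (g : R →ₐ[ℝ] S) (n : ℕ) (x : R) :
    g (logTrunc n x) = logTrunc n (g x) := by
  simp [logTrunc, map_sum]

theorem expTrunc_succ (n : ℕ) (x : R) :
    expTrunc (n + 1) x = expTrunc n x + (((n + 1).factorial : ℝ)⁻¹) • x ^ (n + 1) := by
  rw [expTrunc, Finset.sum_range_succ]
  rfl

theorem logTrunc_eq_sum_range (n : ℕ) (e : R) :
    logTrunc n e = ∑ k ∈ Finset.range n, ((-1 : ℝ) ^ k / ((k : ℝ) + 1)) • (e - 1) ^ (k + 1) := by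
  rw [logTrunc, ← Finset.Ico_add_one_right_eq_Icc, Finset.sum_Ico_eq_sum_range]
  refine Finset.sum_congr rfl fun k _ => ?_
  rw [add_comm 1 k]
  push_cast
  rw [pow_succ, pow_succ]
  ring_nf

theorem derivative_expTrunc (n : ℕ) (P : ℝ[X]) :
    derivative (expTrunc n P) =
      (expTrunc n P - ((n.factorial : ℝ)⁻¹) • P ^ n) * derivative P := by
  induction n with
  | zero => simp [expTrunc]
  | succ n ih =>
    rw [expTrunc_succ, derivative_add, ih, derivative_smul, derivative_pow]
    have h : (((n + 1).factorial : ℝ)⁻¹) * ((n : ℝ) + 1) = (n.factorial : ℝ)⁻¹ := by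
      rw [Nat.factorial_succ]
      push_cast
      have : (n.factorial : ℝ) ≠ 0 := by positivity
      have : (n : ℝ) + 1 ≠ 0 := by positivity
      field_simp
    simp only [smul_eq_C_mul, ← h, Nat.add_sub_cancel, C_mul]
    push_cast
    ring

/-- The derivative of the truncated logarithm is the geometric sum `∑_{k<n} (1 - E)^k` times `E'`,
and `E = 1 - (1 - E)` sums it. -/
theorem mul_derivative_logTrunc (n : ℕ) (E : ℝ[X]) :
    E * derivative (logTrunc n E) = (1 - (1 - E) ^ n) * derivative E := by
  have h : derivative (logTrunc n E) = (∑ k ∈ Finset.range n, (1 - E) ^ k) * derivative E := by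
    rw [logTrunc_eq_sum_range, derivative_sum, Finset.sum_mul]
    refine Finset.sum_congr rfl fun k _ => ?_
    rw [derivative_smul, derivative_pow]
    have h1 : (1 - E) ^ k = C ((-1 : ℝ) ^ k) * (E - 1) ^ k := by
      rw [C_pow, ← mul_pow]
      congr 1
      simp
    have h2 : C ((-1 : ℝ) ^ k) = C ((-1 : ℝ) ^ k / ((k : ℝ) + 1)) * ((k : ℝ[X]) + 1) := by
      have h3 : (k : ℝ) + 1 ≠ 0 := by positivity
      have h4 : ((k : ℝ[X]) + 1) = C ((k : ℝ) + 1) := by simp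
      rw [h4, ← C_mul, div_mul_cancel₀ _ h3]
    rw [h1, h2, smul_eq_C_mul]
    simp
    ring
  rw [h, ← mul_assoc]
  congr 1
  have := geom_sum_mul_neg (1 - E) n
  rw [sub_sub_cancel] at this
  rw [mul_comm, this]

theorem X_dvd_expTrunc_sub_one (n : ℕ) : (X : ℝ[X]) ∣ expTrunc n X - 1 := by
  rw [X_dvd_iff]
  induction n with
  | zero => simp [expTrunc]
  | succ n ih =>
    rw [expTrunc_succ]
    simp [coeff_X_pow] at ih ⊢
    exact ih

theorem X_pow_succ_dvd_of_derivative {n : ℕ} {P : ℝ[X]} (h0 : P.coeff 0 = 0)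
    (h : X ^ n ∣ derivative P) : X ^ (n + 1) ∣ P := by
  rw [X_pow_dvd_iff] at h ⊢
  rintro (_ | d) hd
  · exact h0
  · have := h d (by omega)
    rw [coeff_derivative] at this
    have h3 : (d : ℝ) + 1 ≠ 0 := by positivity
    exact (mul_eq_zero.1 this).resolve_right h3

/-- The constant term vanishes, so it suffices that `X^n` divides the derivative. After
multiplication by `E = expTrunc n X`, which is coprime to `X`, the derivative consists of terms with
a factor `X^n` or `(1 - E)^n`. -/
theorem X_pow_dvd_logTrunc_expTrunc (n : ℕ) :
    (X : ℝ[X]) ^ (n + 1) ∣ logTrunc n (expTrunc n X) - X := by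
  set E : ℝ[X] := expTrunc n X with hE
  have hX : (X : ℝ[X]) ∣ 1 - E := by
    rw [← dvd_neg, neg_sub]
    exact X_dvd_expTrunc_sub_one n
  apply X_pow_succ_dvd_of_derivative
  · rw [← X_dvd_iff, logTrunc_eq_sum_range]
    refine dvd_sub (Finset.dvd_sum fun k _ => ?_) dvd_rfl
    rw [smul_eq_C_mul]
    exact ((X_dvd_expTrunc_sub_one n).trans (dvd_pow_self _ (by omega))).mul_left _
  · have hc : IsCoprime ((X : ℝ[X]) ^ n) E := by
      apply IsCoprime.pow_left
      obtain ⟨g, hg⟩ := hX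
      exact ⟨g, 1, by rw [mul_comm g, ← hg]; ring⟩
    refine hc.dvd_of_dvd_mul_left ?_
    have h1 : E * derivative (logTrunc n E - X) =
        -(C ((n.factorial : ℝ)⁻¹) * X ^ n) - (1 - E) ^ n * derivative E := by
      rw [derivative_sub, mul_sub, mul_derivative_logTrunc]
      have h2 : derivative E = E - C ((n.factorial : ℝ)⁻¹) * X ^ n := by
        rw [hE, derivative_expTrunc, derivative_X, mul_one, smul_eq_C_mul]
      rw [sub_mul, h2, derivative_X]
      ring
    rw [h1]
    exact dvd_sub ((dvd_mul_left _ _).neg_right) ((pow_dvd_pow_of_dvd hX n).mul_right _)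

/-- The difference `P` vanishes at `0` and solves `(1 + X) P' = P` modulo `X^n`. Comparing
coefficients of degree `d` gives `(d + 1) P_{d+1} = 0` once `P_d = 0`. -/
theorem X_pow_dvd_expTrunc_logTrunc (n : ℕ) :
    (X : ℝ[X]) ^ (n + 1) ∣ expTrunc n (logTrunc n (1 + X)) - (1 + X) := by
  set L : ℝ[X] := logTrunc n (1 + X) with hL
  have hXL : (X : ℝ[X]) ∣ L := by
    rw [hL, logTrunc_eq_sum_range]
    refine Finset.dvd_sum fun k _ => ?_
    rw [smul_eq_C_mul, add_sub_cancel_left]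
    exact (dvd_pow_self _ (by omega)).mul_left _
  set P : ℝ[X] := expTrunc n L - (1 + X) with hP
  have h0 : P.coeff 0 = 0 := by
    rw [← X_dvd_iff, hP]
    have : expTrunc n L - 1 = (expTrunc n X - 1 : ℝ[X]).comp L := by
      have := map_expTrunc (aeval L : ℝ[X] →ₐ[ℝ] ℝ[X]) n X
      rw [aeval_X] at this
      rw [← this, sub_comp, one_comp]
      rfl
    rw [← sub_sub, this]
    obtain ⟨g, hg⟩ := X_dvd_expTrunc_sub_one n
    rw [hg, mul_comp, X_comp]
    exact dvd_sub (hXL.mul_right _) dvd_rfl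
  have hd : (X : ℝ[X]) ^ n ∣ (1 + X) * derivative P - P := by
    have h1 : (1 + X) * derivative L = 1 - (-X) ^ n := by
      rw [hL, mul_derivative_logTrunc]
      simp
    have h2 : (1 + X) * derivative P - P =
        -(expTrunc n L * (-X) ^ n) - C ((n.factorial : ℝ)⁻¹) * L ^ n * (1 - (-X) ^ n) := by
      have h3 : (1 + X) * derivative P = (expTrunc n L - C ((n.factorial : ℝ)⁻¹) * L ^ n) *
          ((1 + X) * derivative L) - (1 + X) := by
        rw [hP, derivative_sub, derivative_expTrunc, smul_eq_C_mul]
        simp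
        ring
      rw [h3, h1, hP]
      ring
    rw [h2]
    have h4 : (X : ℝ[X]) ^ n ∣ (-X) ^ n := pow_dvd_pow_of_dvd (dvd_neg.2 dvd_rfl) n
    exact dvd_sub ((h4.mul_left _).neg_right)
      (((pow_dvd_pow_of_dvd hXL n).mul_left _).mul_right _)
  rw [X_pow_dvd_iff] at hd ⊢
  intro d
  induction d with
  | zero => exact fun _ => h0
  | succ d ih =>
    intro hlt
    have h5 := hd d (by omega)
    have h6 := ih (by omega)
    rw [coeff_sub, add_mul, coeff_add, one_mul, h6, sub_zero, coeff_derivative] at h5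
    have h7 : (X * derivative P).coeff d = 0 := by
      rcases d with _ | d
      · simp
      · rw [coeff_X_mul, coeff_derivative, h6, zero_mul]
    rw [h7, add_zero] at h5
    have h3 : (d : ℝ) + 1 ≠ 0 := by positivity
    exact (mul_eq_zero.1 h5).resolve_right h3

/-- Evaluation of the polynomial divisibility at `x`; no commutativity of `R` is involved, since
only powers of one element occur. -/
theorem logTrunc_expTrunc {n : ℕ} {x : R} (hx : x ^ (n + 1) = 0) :
    logTrunc n (expTrunc n x) = x := by
  obtain ⟨g, hg⟩ := X_pow_dvd_logTrunc_expTrunc n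
  have := congrArg (aeval x) hg
  rw [map_sub, map_mul, map_pow, aeval_X, hx, zero_mul, map_logTrunc, map_expTrunc, aeval_X] at this
  exact sub_eq_zero.1 this

theorem expTrunc_logTrunc {n : ℕ} {e : R} (he : (e - 1) ^ (n + 1) = 0) :
    expTrunc n (logTrunc n e) = e := by
  obtain ⟨g, hg⟩ := X_pow_dvd_expTrunc_logTrunc n
  have := congrArg (aeval (e - 1)) hg
  rw [map_sub, map_mul, map_pow, aeval_X, he, zero_mul, map_expTrunc, map_logTrunc, map_add,
    aeval_X, map_one, add_sub_cancel] at this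
  exact sub_eq_zero.1 this

theorem expTrunc_add_of_commute {n : ℕ} {x y : R} (hxy : Commute x y) (hx : x ^ (n + 1) = 0)
    (hy : y ^ (n + 1) = 0) (hadd : (x + y) ^ (n + 1) = 0) :
    expTrunc n (x + y) = expTrunc n x * expTrunc n y := by
  -- `IsNilpotent.exp` is defined over `ℚ`; restriction of scalars makes its addition theorem
  -- available.
  let : Module ℚ R := Module.compHom R (algebraMap ℚ ℝ)
  have key : ∀ z : R, z ^ (n + 1) = 0 → IsNilpotent.exp z = expTrunc n z := by
    intro z hz
    rw [IsNilpotent.exp_eq_sum hz, expTrunc]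
    refine Finset.sum_congr rfl fun k _ => ?_
    change (algebraMap ℚ ℝ ((k.factorial : ℚ)⁻¹)) • z ^ k = _
    simp
  rw [← key _ hx, ← key _ hy, ← key _ hadd]
  exact IsNilpotent.exp_add_of_commute hxy ⟨_, hx⟩ ⟨_, hy⟩

theorem expTrunc_zero (n : ℕ) : expTrunc n (0 : R) = 1 := by
  rw [expTrunc, Finset.sum_range_succ', Finset.sum_eq_zero]
  · simp
  · intro k _
    simp

theorem logTrunc_one (n : ℕ) : logTrunc n (1 : R) = 0 := by
  rw [logTrunc_eq_sum_range]
  exact Finset.sum_eq_zero fun k _ => by simp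

/-- The logarithm turns the product of commuting unipotent elements into a sum. -/
theorem logTrunc_mul_of_commute {n : ℕ} {a b : R} {I : Submodule ℝ R}
    (hI : ∀ z ∈ I, z ^ (n + 1) = 0) (hmul : ∀ z ∈ I, ∀ w, w * z ∈ I) (hab : Commute a b)
    (ha : a - 1 ∈ I) (hb : b - 1 ∈ I) :
    logTrunc n (a * b) = logTrunc n a + logTrunc n b := by
  have hlog : ∀ e, e - 1 ∈ I → logTrunc n e ∈ I := by
    intro e he
    refine Submodule.sum_mem _ fun k hk => Submodule.smul_mem _ _ ?_
    obtain ⟨j, rfl⟩ : ∃ j, k = j + 1 := ⟨k - 1, by have := (Finset.mem_Icc.1 hk).1; omega⟩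
    rw [pow_succ]
    exact hmul _ he _
  have hcomm : Commute (logTrunc n a) (logTrunc n b) := by
    refine Commute.sum_left _ _ _ fun k _ => Commute.sum_right _ _ _ fun j _ => ?_
    refine (Commute.smul_left (Commute.smul_right ?_ _) _)
    exact ((hab.sub_left (Commute.one_left _)).sub_right
      ((Commute.one_right _).sub_left (Commute.one_right _))).pow_pow _ _
  have h1 := expTrunc_add_of_commute hcomm (hI _ (hlog a ha)) (hI _ (hlog b hb))
    (hI _ (I.add_mem (hlog a ha) (hlog b hb)))
  rw [expTrunc_logTrunc (hI _ ha), expTrunc_logTrunc (hI _ hb)] at h1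
  rw [← h1, logTrunc_expTrunc (hI _ (I.add_mem (hlog a ha) (hlog b hb)))]

end TruncatedExpLog


/-! ### Words in the tensor algebra -/

section Words

variable {V : Type*} [NormedAddCommGroup V] [NormedSpace ℝ V]

/-- The product `v₁ ⊗ ⋯ ⊗ v_k` in the tensor algebra. -/
def tensorWord (l : List V) : TensorAlgebra ℝ V := (l.map (TensorAlgebra.ι ℝ)).prod

@[simp] theorem tensorWord_nil : tensorWord ([] : List V) = 1 := rfl

theorem tensorWord_cons (v : V) (l : List V) :
    tensorWord (v :: l) = TensorAlgebra.ι ℝ v * tensorWord l := by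
  simp [tensorWord]

theorem tensorWord_append (l l' : List V) :
    tensorWord (l ++ l') = tensorWord l * tensorWord l' := by
  simp [tensorWord]

theorem span_range_tensorWord : Submodule.span ℝ (Set.range (tensorWord (V := V))) = ⊤ := by
  rw [eq_top_iff]
  rintro a -
  have h : a ∈ Algebra.adjoin ℝ (Set.range (TensorAlgebra.ι ℝ (M := V))) := by
    rw [TensorAlgebra.adjoin_range_ι]
    trivial
  rw [← Subalgebra.mem_toSubmodule, Algebra.adjoin_eq_span] at h
  refine Submodule.span_mono ?_ h
  intro b hb
  induction hb using Submonoid.closure_induction with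
  | mem x hx =>
    obtain ⟨v, rfl⟩ := hx
    exact ⟨[v], by simp [tensorWord]⟩
  | one => exact ⟨[], rfl⟩
  | mul x y _ _ hx hy =>
    obtain ⟨l, rfl⟩ := hx
    obtain ⟨l', rfl⟩ := hy
    exact ⟨l ++ l', tensorWord_append l l'⟩

theorem tensorWord_induction {C : TensorAlgebra ℝ V → Prop} (hword : ∀ l, C (tensorWord l))
    (hadd : ∀ a b, C a → C b → C (a + b)) (hsmul : ∀ (r : ℝ) a, C a → C (r • a))
    (a : TensorAlgebra ℝ V) : C a := by
  have h : a ∈ Submodule.span ℝ (Set.range (tensorWord (V := V))) := by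
    rw [span_range_tensorWord]
    trivial
  induction h using Submodule.span_induction with
  | mem x hx =>
    obtain ⟨l, rfl⟩ := hx
    exact hword l
  | zero => simpa using hsmul 0 _ (hword [])
  | add x y _ _ hx hy => exact hadd _ _ hx hy
  | smul r x _ hx => exact hsmul _ _ hx

theorem tensorWord_eq_tprod (l : List V) :
    tensorWord l = TensorAlgebra.tprod ℝ V l.length l.get := by
  rw [TensorAlgebra.tprod_apply, tensorWord]
  congr 1
  conv_lhs => rw [← List.ofFn_get l, List.map_ofFn]
  rfl

theorem tensorWord_ofFn {k : ℕ} (m : Fin k → V) :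
    tensorWord (List.ofFn m) = TensorPower.toTensorAlgebra (PiTensorProduct.tprod ℝ m) := by
  rw [TensorPower.toTensorAlgebra_tprod, TensorAlgebra.tprod_apply, tensorWord, List.map_ofFn]
  rfl

theorem tensorComponent_toTensorAlgebra (k : ℕ) (t : ⨂[ℝ]^k V) :
    tensorComponent V k (TensorPower.toTensorAlgebra t) = t := by
  have h : (tensorComponent V k).comp (TensorPower.toTensorAlgebra (n := k)) = LinearMap.id := by
    apply PiTensorProduct.ext
    ext m
    simp only [LinearMap.compMultilinearMap_apply, LinearMap.comp_apply, LinearMap.id_apply,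
      TensorPower.toTensorAlgebra_tprod, tensorComponent, TensorAlgebra.equivDirectSum,
      AlgEquiv.toLinearMap_apply, AlgEquiv.ofAlgHom_apply]
    rw [TensorAlgebra.toDirectSum_tensorPower_tprod]
    exact DirectSum.of_eq_same _ _
  exact LinearMap.congr_fun h t

theorem tensorComponent_tensorProj (k : ℕ) (a : TensorAlgebra ℝ V) :
    tensorComponent V k (tensorProj V k a) = tensorComponent V k a :=
  tensorComponent_toTensorAlgebra _ _

theorem tensorProj_tensorWord (k : ℕ) (l : List V) :
    tensorProj V k (tensorWord l) = if l.length = k then tensorWord l else 0 := by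
  split_ifs with h
  · subst h
    rw [← List.ofFn_get l, List.length_ofFn, tensorWord_ofFn, tensorProj, LinearMap.comp_apply,
      tensorComponent_toTensorAlgebra]
  · have : tensorComponent V k (tensorWord l) = 0 := by
      rw [tensorWord_eq_tprod]
      simp only [tensorComponent, TensorAlgebra.equivDirectSum, LinearMap.comp_apply,
        AlgEquiv.toLinearMap_apply, AlgEquiv.ofAlgHom_apply]
      rw [TensorAlgebra.toDirectSum_tensorPower_tprod]
      exact DirectSum.of_eq_of_ne _ _ _ (Ne.symm h)
    rw [tensorProj, LinearMap.comp_apply, this, map_zero]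

theorem tensorProj_mul (m : ℕ) (a b : TensorAlgebra ℝ V) :
    tensorProj V m (a * b) =
      ∑ ij ∈ Finset.HasAntidiagonal.antidiagonal m, tensorProj V ij.1 a * tensorProj V ij.2 b := by
  induction a using tensorWord_induction with
  | hadd a a' ha ha' => simp only [add_mul, map_add, ha, ha', Finset.sum_add_distrib]
  | hsmul r a ha => simp only [smul_mul_assoc, map_smul, ha, Finset.smul_sum]
  | hword l =>
    induction b using tensorWord_induction with
    | hadd a a' ha ha' => simp only [mul_add, map_add, ha, ha', Finset.sum_add_distrib]
    | hsmul r a ha => simp only [mul_smul_comm, map_smul, ha, Finset.smul_sum]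
    | hword l' =>
      simp only [← tensorWord_append, tensorProj_tensorWord, List.length_append]
      split_ifs with h
      · rw [Finset.sum_eq_single (l.length, l'.length)]
        · simp [tensorWord_append]
        · rintro ⟨i, j⟩ _ hne
          by_cases hi : l.length = i
          · have : l'.length ≠ j := fun hj => hne (by rw [hi, hj])
            simp [this]
          · simp [hi]
        · intro h'
          exact absurd (Finset.HasAntidiagonal.mem_antidiagonal.2 h) h'
      · refine (Finset.sum_eq_zero ?_).symm
        rintro ⟨i, j⟩ hij
        have := Finset.HasAntidiagonal.mem_antidiagonal.1 hij
        simp only at this ⊢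
        by_cases hi : l.length = i
        · have : l'.length ≠ j := by omega
          simp [this]
        · simp [hi]

theorem algebraMapInv_tensorWord (l : List V) :
    TensorAlgebra.algebraMapInv (tensorWord l) = if l = [] then (1 : ℝ) else 0 := by
  rcases l with _ | ⟨v, l⟩
  · simp
  · simp [tensorWord_cons, TensorAlgebra.algebraMapInv]

theorem tensorProj_zero_eq (a : TensorAlgebra ℝ V) :
    tensorProj V 0 a = algebraMap ℝ _ (TensorAlgebra.algebraMapInv a) := by
  induction a using tensorWord_induction with
  | hadd a b ha hb => simp [ha, hb]
  | hsmul r a ha => rw [map_smul, map_smul, ha, ← Algebra.linearMap_apply, ← map_smul]; rfl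
  | hword l =>
    rw [tensorProj_tensorWord, algebraMapInv_tensorWord]
    rcases l with _ | ⟨v, l⟩ <;> simp

/-- The elements of the tensor algebra of degree at least `m`. -/
def wordsOfLengthGE (V : Type*) [NormedAddCommGroup V] [NormedSpace ℝ V] (m : ℕ) :
    Submodule ℝ (TensorAlgebra ℝ V) :=
  Submodule.span ℝ (tensorWord '' {l | m ≤ l.length})

theorem tensorProj_eq_zero_of_mem {k m : ℕ} (h : k < m) {a : TensorAlgebra ℝ V}
    (ha : a ∈ wordsOfLengthGE V m) : tensorProj V k a = 0 := by
  have : wordsOfLengthGE V m ≤ LinearMap.ker (tensorProj V k) := by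
    rw [wordsOfLengthGE, Submodule.span_le]
    rintro _ ⟨l, hl, rfl⟩
    have hl' : m ≤ l.length := hl
    have : l.length ≠ k := by omega
    simp [tensorProj_tensorWord, this]
  exact this ha

theorem mul_mem_wordsOfLengthGE {i j : ℕ} {a b : TensorAlgebra ℝ V}
    (ha : a ∈ wordsOfLengthGE V i) (hb : b ∈ wordsOfLengthGE V j) :
    a * b ∈ wordsOfLengthGE V (i + j) := by
  have := Submodule.mul_mem_mul ha hb
  rw [wordsOfLengthGE, wordsOfLengthGE, Submodule.span_mul_span] at this
  refine Submodule.span_mono ?_ this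
  rintro _ ⟨_, ⟨l, hl, rfl⟩, _, ⟨l', hl', rfl⟩, rfl⟩
  refine ⟨l ++ l', ?_, tensorWord_append l l'⟩
  have h1 : i ≤ l.length := hl
  have h2 : j ≤ l'.length := hl'
  simp only [Set.mem_ofPred_eq, List.length_append]
  omega

theorem mem_wordsOfLengthGE_one {a : TensorAlgebra ℝ V}
    (ha : TensorAlgebra.algebraMapInv a = (0 : ℝ)) : a ∈ wordsOfLengthGE V 1 := by
  have h : ∀ a : TensorAlgebra ℝ V,
      a - algebraMap ℝ _ (TensorAlgebra.algebraMapInv a) ∈ wordsOfLengthGE V 1 := by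
    intro a
    induction a using tensorWord_induction with
    | hadd a b ha hb =>
      have := Submodule.add_mem _ ha hb
      rwa [sub_add_sub_comm, ← map_add, ← map_add] at this
    | hsmul r a ha =>
      have := Submodule.smul_mem _ r ha
      rwa [smul_sub, ← Algebra.linearMap_apply, ← map_smul, ← map_smul,
        Algebra.linearMap_apply] at this
    | hword l =>
      rcases l with _ | ⟨v, l⟩
      · simp
      · rw [algebraMapInv_tensorWord]
        simp only [reduceCtorEq, if_false, map_zero, sub_zero]
        exact Submodule.subset_span ⟨_, by simp, rfl⟩
  simpa [ha] using h a

theorem pow_mem_wordsOfLengthGE {a : TensorAlgebra ℝ V}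
    (ha : TensorAlgebra.algebraMapInv a = (0 : ℝ)) (k : ℕ) : a ^ k ∈ wordsOfLengthGE V k := by
  induction k with
  | zero => exact Submodule.subset_span ⟨[], by simp, by simp⟩
  | succ k ih =>
    rw [pow_succ]
    exact mul_mem_wordsOfLengthGE ih (mem_wordsOfLengthGE_one ha)

end Words


/-! ### Primitive elements and the Dynkin operator -/

section Primitive

variable {V : Type*} [NormedAddCommGroup V] [NormedSpace ℝ V]

variable (V) in
/-- The coproduct of the tensor algebra for which the vectors are primitive. -/
def tensorComul : TensorAlgebra ℝ V →ₐ[ℝ] TensorAlgebra ℝ V ⊗[ℝ] TensorAlgebra ℝ V :=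
  TensorAlgebra.lift ℝ
    (Algebra.TensorProduct.includeLeft.toLinearMap.comp (TensorAlgebra.ι ℝ) +
      Algebra.TensorProduct.includeRight.toLinearMap.comp (TensorAlgebra.ι ℝ))

theorem tensorComul_ι (v : V) : tensorComul V (TensorAlgebra.ι ℝ v) =
    TensorAlgebra.ι ℝ v ⊗ₜ 1 + 1 ⊗ₜ TensorAlgebra.ι ℝ v := by
  simp [tensorComul]

variable (V) in
/-- `(D a, ε a)` for the Dynkin operator `D` and the augmentation `ε`, as the orbit of `(0, 1)`. -/
def dynkinAction : TensorAlgebra ℝ V →ₐ[ℝ] Module.End ℝ (TensorAlgebra ℝ V × ℝ) :=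
  TensorAlgebra.lift ℝ
    { toFun := fun v =>
        { toFun := fun p => (TensorAlgebra.ι ℝ v * p.1 - p.1 * TensorAlgebra.ι ℝ v
            + p.2 • TensorAlgebra.ι ℝ v, 0)
          map_add' := fun p p' => by
            ext
            · simp [mul_add, add_mul, add_smul]; abel
            · simp
          map_smul' := fun r p => by
            ext
            · simp [mul_smul, smul_add, smul_sub]
            · simp }
      map_add' := fun v w => by
        apply LinearMap.ext
        intro p
        ext
        · simp [mul_add, add_mul]; abel
        · simp
      map_smul' := fun r v => by
        apply LinearMap.ext
        intro p
        ext
        · simp [smul_add, smul_sub, smul_comm p.2 r]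
        · simp }

variable (V) in
/-- The Dynkin operator `v₁ ⊗ ⋯ ⊗ v_k ↦ [v₁, [v₂, ⋯, v_k]]`. -/
def dynkin : TensorAlgebra ℝ V →ₗ[ℝ] TensorAlgebra ℝ V :=
  (LinearMap.fst ℝ _ _).comp ((LinearMap.applyₗ (0, (1 : ℝ))).comp (dynkinAction V).toLinearMap)

theorem dynkinAction_snd (a : TensorAlgebra ℝ V) :
    (dynkinAction V a (0, 1)).2 = TensorAlgebra.algebraMapInv a := by
  induction a using tensorWord_induction with
  | hadd a b ha hb => simp [ha, hb]
  | hsmul r a ha => simp [ha]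
  | hword l =>
    rw [algebraMapInv_tensorWord]
    rcases l with _ | ⟨v, l⟩
    · simp
    · simp [tensorWord_cons, dynkinAction]

theorem dynkin_one : dynkin V 1 = 0 := by simp [dynkin]

/-- The augmentation term is what gives `D v = v`: the bracket of `v` with `D 1 = 0` contributes
nothing. -/
theorem dynkin_ι_mul (v : V) (a : TensorAlgebra ℝ V) :
    dynkin V (TensorAlgebra.ι ℝ v * a) = TensorAlgebra.ι ℝ v * dynkin V a
      - dynkin V a * TensorAlgebra.ι ℝ v
      + (TensorAlgebra.algebraMapInv a : ℝ) • TensorAlgebra.ι ℝ v := by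
  rw [← dynkinAction_snd]
  simp [dynkin, dynkinAction]

theorem dynkin_ι (v : V) : dynkin V (TensorAlgebra.ι ℝ v) = TensorAlgebra.ι ℝ v := by
  have := dynkin_ι_mul v 1
  rw [mul_one, dynkin_one] at this
  simpa using this

theorem dynkin_tensorWord_cons_cons (v w : V) (l : List V) :
    dynkin V (tensorWord (v :: w :: l)) = TensorAlgebra.ι ℝ v * dynkin V (tensorWord (w :: l))
      - dynkin V (tensorWord (w :: l)) * TensorAlgebra.ι ℝ v := by
  rw [tensorWord_cons, dynkin_ι_mul, algebraMapInv_tensorWord]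
  simp

theorem tensorProj_dynkin_tensorWord (k : ℕ) (l : List V) :
    tensorProj V k (dynkin V (tensorWord l)) =
      if l.length = k then dynkin V (tensorWord l) else 0 := by
  have hι : ∀ (v : V) j, tensorProj V j (TensorAlgebra.ι ℝ v) =
      if 1 = j then TensorAlgebra.ι ℝ v else 0 := by
    intro v j
    simpa [tensorWord] using tensorProj_tensorWord j [v]
  induction l generalizing k with
  | nil => simp [dynkin_one]
  | cons v l ih =>
    rcases l with _ | ⟨w, l⟩
    · simpa [tensorWord, dynkin_ι] using hι v k
    · rw [dynkin_tensorWord_cons_cons]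
      set b := dynkin V (tensorWord (w :: l))
      rw [map_sub, tensorProj_mul, tensorProj_mul]
      simp only [ih, hι]
      rw [List.length_cons (a := v)]
      have e1 : ∀ m, (∑ x ∈ Finset.HasAntidiagonal.antidiagonal m,
          (if 1 = x.1 then TensorAlgebra.ι ℝ v else 0) *
            (if (w :: l).length = x.2 then b else 0)) =
          if (w :: l).length + 1 = m then TensorAlgebra.ι ℝ v * b else 0 := by
        intro m
        split_ifs with h
        · rw [Finset.sum_eq_single (1, (w :: l).length)]
          · simp
          · rintro ⟨i, j⟩ _ hne
            simp only [ite_mul, zero_mul, mul_ite, mul_zero]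
            split_ifs with h1 h2
            · exact absurd (Prod.ext h2.symm h1.symm) hne
            all_goals rfl
          · intro h'
            exact absurd (Finset.HasAntidiagonal.mem_antidiagonal.2 (by simp at h ⊢; omega)) h'
        · refine Finset.sum_eq_zero ?_
          rintro ⟨i, j⟩ hij
          have := Finset.HasAntidiagonal.mem_antidiagonal.1 hij
          simp only at this
          simp only [ite_mul, zero_mul, mul_ite, mul_zero]
          split_ifs with h1 h2
          · omega
          all_goals rfl
      have e2 : ∀ m, (∑ x ∈ Finset.HasAntidiagonal.antidiagonal m,
          (if (w :: l).length = x.1 then b else 0) *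
            (if 1 = x.2 then TensorAlgebra.ι ℝ v else 0)) =
          if (w :: l).length + 1 = m then b * TensorAlgebra.ι ℝ v else 0 := by
        intro m
        split_ifs with h
        · rw [Finset.sum_eq_single ((w :: l).length, 1)]
          · simp
          · rintro ⟨i, j⟩ _ hne
            simp only [ite_mul, zero_mul, mul_ite, mul_zero]
            split_ifs with h1 h2
            · exact absurd (Prod.ext h2.symm h1.symm) hne
            all_goals rfl
          · intro h'
            exact absurd (Finset.HasAntidiagonal.mem_antidiagonal.2 (by simp at h ⊢; omega)) h'
        · refine Finset.sum_eq_zero ?_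
          rintro ⟨i, j⟩ hij
          have := Finset.HasAntidiagonal.mem_antidiagonal.1 hij
          simp only at this
          simp only [ite_mul, zero_mul, mul_ite, mul_zero]
          split_ifs with h1 h2
          · omega
          all_goals rfl
      rw [e1, e2]
      split_ifs <;> simp

theorem tensorProj_dynkin (k : ℕ) (a : TensorAlgebra ℝ V) :
    tensorProj V k (dynkin V a) = dynkin V (tensorProj V k a) := by
  induction a using tensorWord_induction with
  | hadd a b ha hb => simp only [map_add, ha, hb]
  | hsmul r a ha => simp only [map_smul, ha]
  | hword l =>
    rw [tensorProj_dynkin_tensorWord, tensorProj_tensorWord]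
    split_ifs <;> simp

variable (V) in
/-- `(a, Y a)` for the grading operator `Y`, as the orbit of `(1, 0)`. -/
def gradingAction : TensorAlgebra ℝ V →ₐ[ℝ]
    Module.End ℝ (TensorAlgebra ℝ V × TensorAlgebra ℝ V) :=
  TensorAlgebra.lift ℝ
    { toFun := fun v =>
        { toFun := fun p => (TensorAlgebra.ι ℝ v * p.1, TensorAlgebra.ι ℝ v * (p.2 + p.1))
          map_add' := fun p p' => by ext <;> simp [mul_add]; abel
          map_smul' := fun r p => by ext <;> simp [mul_add] }
      map_add' := fun v w => by
        apply LinearMap.ext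
        intro p
        ext <;> simp [add_mul]
      map_smul' := fun r v => by
        apply LinearMap.ext
        intro p
        ext <;> simp }

/-- Each letter sends `(w, k w)` to `(v w, v (k w + w))`, so the second coordinate counts the
letters. -/
theorem gradingAction_tensorWord (l : List V) :
    gradingAction V (tensorWord l) (1, 0) = (tensorWord l, (l.length : ℝ) • tensorWord l) := by
  induction l with
  | nil => simp
  | cons v l ih =>
    rw [tensorWord_cons, map_mul, Module.End.mul_apply, ih]
    simp [gradingAction, mul_add, add_smul]

variable (V) in
/-- The grading operator, multiplication by `k` in degree `k`. -/
def tensorGrading : TensorAlgebra ℝ V →ₗ[ℝ] TensorAlgebra ℝ V :=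
  (LinearMap.snd ℝ _ _).comp ((LinearMap.applyₗ (1, 0)).comp (gradingAction V).toLinearMap)

theorem tensorGrading_tensorWord (l : List V) :
    tensorGrading V (tensorWord l) = (l.length : ℝ) • tensorWord l := by
  have := congrArg Prod.snd (gradingAction_tensorWord l)
  simpa [tensorGrading] using this

theorem tensorProj_tensorGrading (k : ℕ) (a : TensorAlgebra ℝ V) :
    tensorProj V k (tensorGrading V a) = (k : ℝ) • tensorProj V k a := by
  induction a using tensorWord_induction with
  | hadd a b ha hb => simp only [map_add, ha, hb, smul_add]
  | hsmul r a ha => simp only [map_smul, ha, smul_comm r]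
  | hword l =>
    rw [tensorGrading_tensorWord, map_smul, tensorProj_tensorWord]
    split_ifs with h
    · rw [h]
    · simp

variable (V) in
/-- The convolution of the Dynkin operator with the identity, before composition with the
coproduct. -/
def dynkinMul : TensorAlgebra ℝ V ⊗[ℝ] TensorAlgebra ℝ V →ₗ[ℝ] TensorAlgebra ℝ V :=
  (LinearMap.mul' ℝ _).comp (TensorProduct.map (dynkin V) LinearMap.id)

variable (V) in
/-- `a ⊗ b ↦ ε(a) b`. -/
def counitLeft : TensorAlgebra ℝ V ⊗[ℝ] TensorAlgebra ℝ V →ₗ[ℝ] TensorAlgebra ℝ V :=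
  TensorProduct.lift ((LinearMap.lsmul ℝ (TensorAlgebra ℝ V)).comp
    (TensorAlgebra.algebraMapInv (R := ℝ) (M := V)).toLinearMap)

theorem counitLeft_tensorComul (a : TensorAlgebra ℝ V) :
    counitLeft V (tensorComul V a) = a := by
  have key : ∀ (v : V) z, counitLeft V ((TensorAlgebra.ι ℝ v ⊗ₜ 1 + 1 ⊗ₜ TensorAlgebra.ι ℝ v) * z)
      = TensorAlgebra.ι ℝ v * counitLeft V z := by
    intro v z
    induction z using TensorProduct.induction_on with
    | zero => simp
    | tmul a b => simp [counitLeft, add_mul, TensorAlgebra.algebraMapInv]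
    | add x y hx hy => rw [mul_add, map_add, hx, hy, map_add, mul_add]
  induction a using tensorWord_induction with
  | hadd a b ha hb => simp only [map_add, ha, hb]
  | hsmul r a ha => simp only [map_smul, ha]
  | hword l =>
    induction l with
    | nil => simp [counitLeft, Algebra.TensorProduct.one_def]
    | cons v l ih => rw [tensorWord_cons, map_mul, tensorComul_ι, key, ih]

/-- This is the identity `D ⋆ id = Y` behind the Dynkin–Specht–Wever theorem. Multiplying `a ⊗ b` by
the coproduct of `v` produces `D(v a) b + D(a) v b`, in which the terms `D(a) v b` cancel. There
remains `v D(a) b + ε(a) v b`, that is, one more copy of the word for each letter. -/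
theorem dynkinMul_tensorComul (a : TensorAlgebra ℝ V) :
    dynkinMul V (tensorComul V a) = tensorGrading V a := by
  have key : ∀ (v : V) z, dynkinMul V ((TensorAlgebra.ι ℝ v ⊗ₜ 1 + 1 ⊗ₜ TensorAlgebra.ι ℝ v) * z)
      = TensorAlgebra.ι ℝ v * dynkinMul V z + TensorAlgebra.ι ℝ v * counitLeft V z := by
    intro v z
    induction z using TensorProduct.induction_on with
    | zero => simp
    | tmul a b =>
      simp [dynkinMul, counitLeft, add_mul, sub_mul, dynkin_ι_mul, mul_assoc]
      abel
    | add x y hx hy =>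
      rw [mul_add, map_add, hx, hy, map_add, mul_add, map_add, mul_add]
      abel
  induction a using tensorWord_induction with
  | hadd a b ha hb => simp only [map_add, ha, hb]
  | hsmul r a ha => simp only [map_smul, ha]
  | hword l =>
    induction l with
    | nil =>
      simp [dynkinMul, Algebra.TensorProduct.one_def, dynkin_one, tensorGrading]
    | cons v l ih =>
      rw [tensorGrading_tensorWord] at ih ⊢
      rw [tensorWord_cons, map_mul, tensorComul_ι, key, ih, counitLeft_tensorComul]
      simp [add_smul]

/-! ### Logarithms of group-like elements -/

variable (V) in
/-- The kernel of the augmentation of `T ⊗ T`. -/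
def augIdeal₂ : Ideal (TensorAlgebra ℝ V ⊗[ℝ] TensorAlgebra ℝ V) :=
  RingHom.ker (Algebra.TensorProduct.lift (TensorAlgebra.algebraMapInv (R := ℝ) (M := V))
    (TensorAlgebra.algebraMapInv (R := ℝ) (M := V)) (fun _ _ => Commute.all _ _))

instance : (augIdeal₂ V).IsTwoSided := by
  unfold augIdeal₂
  infer_instance

variable (V) in
/-- The elements of `T ⊗ T` of total degree at least `m`. -/
def wordsOfLengthGE₂ (m : ℕ) : Submodule ℝ (TensorAlgebra ℝ V ⊗[ℝ] TensorAlgebra ℝ V) :=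
  Submodule.span ℝ ((fun l : List V × List V => tensorWord l.1 ⊗ₜ tensorWord l.2) ''
    {l | m ≤ l.1.length + l.2.length})

theorem mul_mem_wordsOfLengthGE₂ {i j : ℕ} {a b : TensorAlgebra ℝ V ⊗[ℝ] TensorAlgebra ℝ V}
    (ha : a ∈ wordsOfLengthGE₂ V i) (hb : b ∈ wordsOfLengthGE₂ V j) :
    a * b ∈ wordsOfLengthGE₂ V (i + j) := by
  have := Submodule.mul_mem_mul ha hb
  rw [wordsOfLengthGE₂, wordsOfLengthGE₂, Submodule.span_mul_span] at this
  refine Submodule.span_mono ?_ this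
  rintro _ ⟨_, ⟨l, hl, rfl⟩, _, ⟨l', hl', rfl⟩, rfl⟩
  refine ⟨(l.1 ++ l'.1, l.2 ++ l'.2), ?_, ?_⟩
  · have h1 : i ≤ l.1.length + l.2.length := hl
    have h2 : j ≤ l'.1.length + l'.2.length := hl'
    simp only [Set.mem_ofPred_eq, List.length_append]
    omega
  · simp [tensorWord_append]

theorem tensorWord_tmul_induction
    {C : TensorAlgebra ℝ V ⊗[ℝ] TensorAlgebra ℝ V → Prop}
    (hword : ∀ l l', C (tensorWord l ⊗ₜ tensorWord l'))
    (hadd : ∀ a b, C a → C b → C (a + b)) (hsmul : ∀ (r : ℝ) a, C a → C (r • a))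
    (z : TensorAlgebra ℝ V ⊗[ℝ] TensorAlgebra ℝ V) : C z := by
  induction z using TensorProduct.induction_on with
  | zero => simpa using hsmul 0 _ (hword [] [])
  | add x y hx hy => exact hadd _ _ hx hy
  | tmul a b =>
    induction a using tensorWord_induction with
    | hadd a a' ha ha' => rw [TensorProduct.add_tmul]; exact hadd _ _ ha ha'
    | hsmul r a ha => rw [← TensorProduct.smul_tmul']; exact hsmul _ _ ha
    | hword l =>
      induction b using tensorWord_induction with
      | hadd a a' ha ha' => rw [TensorProduct.tmul_add]; exact hadd _ _ ha ha'
      | hsmul r a ha => rw [TensorProduct.tmul_smul]; exact hsmul _ _ ha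
      | hword l' => exact hword l l'

theorem mem_wordsOfLengthGE₂_one {z : TensorAlgebra ℝ V ⊗[ℝ] TensorAlgebra ℝ V}
    (hz : z ∈ augIdeal₂ V) : z ∈ wordsOfLengthGE₂ V 1 := by
  set g := Algebra.TensorProduct.lift (TensorAlgebra.algebraMapInv (R := ℝ) (M := V))
    (TensorAlgebra.algebraMapInv (R := ℝ) (M := V)) (fun _ _ => Commute.all _ _) with hg
  have h : ∀ z, z - algebraMap ℝ _ (g z) ∈ wordsOfLengthGE₂ V 1 := by
    intro z
    induction z using tensorWord_tmul_induction with
    | hadd a b ha hb =>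
      have := Submodule.add_mem _ ha hb
      rwa [sub_add_sub_comm, ← map_add, ← map_add] at this
    | hsmul r a ha =>
      have := Submodule.smul_mem _ r ha
      rwa [smul_sub, ← Algebra.linearMap_apply, ← map_smul, ← map_smul,
        Algebra.linearMap_apply] at this
    | hword l l' =>
      have e : g (tensorWord l ⊗ₜ tensorWord l') =
          (if l = [] then (1 : ℝ) else 0) * (if l' = [] then (1 : ℝ) else 0) := by
        simp [hg, algebraMapInv_tensorWord]
      rw [e]
      rcases l with _ | ⟨v, l⟩
      · rcases l' with _ | ⟨v, l'⟩
        · simp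
        · simp only [reduceCtorEq, if_false, mul_zero, map_zero, sub_zero]
          exact Submodule.subset_span ⟨([], v :: l'), by simp, rfl⟩
      · simp only [reduceCtorEq, if_false, zero_mul, map_zero, sub_zero]
        exact Submodule.subset_span ⟨(v :: l, l'), by simp; omega, rfl⟩
  have h0 : g z = 0 := hz
  simpa [h0] using h z

/-- An element of augmentation zero has total degree at least one, and degrees add under
multiplication. -/
theorem augIdeal₂_pow_le (m : ℕ) {z : TensorAlgebra ℝ V ⊗[ℝ] TensorAlgebra ℝ V}
    (hz : z ∈ augIdeal₂ V ^ m) : z ∈ wordsOfLengthGE₂ V m := by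
  induction m generalizing z with
  | zero =>
    clear hz
    induction z using tensorWord_tmul_induction with
    | hadd a b ha hb => exact Submodule.add_mem _ ha hb
    | hsmul r a ha => exact Submodule.smul_mem _ _ ha
    | hword l l' => exact Submodule.subset_span ⟨(l, l'), by simp, rfl⟩
  | succ m ih =>
    rw [Submodule.pow_succ] at hz
    refine Submodule.smul_induction_on hz ?_ fun x y hx hy => Submodule.add_mem _ hx hy
    intro a ha b hb
    exact mul_mem_wordsOfLengthGE₂ (ih ha) (mem_wordsOfLengthGE₂_one hb)

/-- The Dynkin operator and the multiplication both respect the degree, so errors of high degree in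
`T ⊗ T` are invisible in low degree. -/
theorem dynkinMul_mem {m : ℕ} {z : TensorAlgebra ℝ V ⊗[ℝ] TensorAlgebra ℝ V}
    (hz : z ∈ wordsOfLengthGE₂ V m) {k : ℕ} (hk : k < m) :
    tensorProj V k (dynkinMul V z) = 0 := by
  have : wordsOfLengthGE₂ V m ≤ LinearMap.ker ((tensorProj V k).comp (dynkinMul V)) := by
    rw [wordsOfLengthGE₂, Submodule.span_le]
    rintro _ ⟨l, hl, rfl⟩
    have hl' : m ≤ l.1.length + l.2.length := hl
    simp only [SetLike.mem_coe, LinearMap.mem_ker, LinearMap.comp_apply, dynkinMul,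
      TensorProduct.map_tmul, LinearMap.mul'_apply, LinearMap.id_apply, tensorProj_mul,
      tensorProj_dynkin, tensorProj_tensorWord]
    refine Finset.sum_eq_zero ?_
    rintro ⟨i, j⟩ hij
    have := Finset.HasAntidiagonal.mem_antidiagonal.1 hij
    simp only at this ⊢
    split_ifs
    · omega
    all_goals simp
  exact this hz

/-- The primitive elements of the tensor algebra. -/
def IsTensorPrimitive (a : TensorAlgebra ℝ V) : Prop :=
  tensorComul V a = a ⊗ₜ 1 + 1 ⊗ₜ a

theorem IsTensorPrimitive.algebraMapInv_eq_zero {a : TensorAlgebra ℝ V}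
    (h : IsTensorPrimitive a) : TensorAlgebra.algebraMapInv a = (0 : ℝ) := by
  have h1 := counitLeft_tensorComul a
  rw [h] at h1
  simp [counitLeft] at h1
  exact h1

theorem isTensorPrimitive_ι (v : V) : IsTensorPrimitive (TensorAlgebra.ι ℝ v) := tensorComul_ι v

theorem IsTensorPrimitive.add {a b : TensorAlgebra ℝ V} (ha : IsTensorPrimitive a)
    (hb : IsTensorPrimitive b) : IsTensorPrimitive (a + b) := by
  rw [IsTensorPrimitive, map_add, ha, hb, TensorProduct.add_tmul, TensorProduct.tmul_add]
  abel

theorem IsTensorPrimitive.smul (r : ℝ) {a : TensorAlgebra ℝ V} (ha : IsTensorPrimitive a) :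
    IsTensorPrimitive (r • a) := by
  rw [IsTensorPrimitive, map_smul, ha, smul_add, TensorProduct.smul_tmul', TensorProduct.tmul_smul]

theorem IsTensorPrimitive.commutator {a b : TensorAlgebra ℝ V} (ha : IsTensorPrimitive a)
    (hb : IsTensorPrimitive b) : IsTensorPrimitive (a * b - b * a) := by
  rw [IsTensorPrimitive, map_sub, map_mul, map_mul, ha, hb, TensorProduct.sub_tmul,
    TensorProduct.tmul_sub]
  simp only [mul_add, add_mul, Algebra.TensorProduct.tmul_mul_tmul, mul_one, one_mul]
  abel

/-- The components of low degree of the logarithm of a product of exponentials of primitive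
elements are eigenvectors of the Dynkin operator. -/
theorem smul_tensorProj_logTrunc {n : ℕ} {a b : TensorAlgebra ℝ V} (ha : IsTensorPrimitive a)
    (hb : IsTensorPrimitive b) {k : ℕ} (hk : k ≤ n) :
    (k : ℝ) • tensorProj V k (logTrunc n (expTrunc n a * expTrunc n b)) =
      dynkin V (tensorProj V k (logTrunc n (expTrunc n a * expTrunc n b))) := by
  set x := expTrunc n a * expTrunc n b with hx
  set L := logTrunc n x with hL
  -- Modulo `J` elements of augmentation zero are nilpotent, so the truncated exponential and
  -- logarithm satisfy their functional equations exactly. There exponentials of primitive elements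
  -- are group-like.
  let J : Ideal (TensorAlgebra ℝ V ⊗[ℝ] TensorAlgebra ℝ V) := augIdeal₂ V ^ (n + 1)
  let π : (TensorAlgebra ℝ V ⊗[ℝ] TensorAlgebra ℝ V) →ₐ[ℝ]
    (TensorAlgebra ℝ V ⊗[ℝ] TensorAlgebra ℝ V) ⧸ J := Ideal.Quotient.mkₐ ℝ J
  let iL : TensorAlgebra ℝ V →ₐ[ℝ] TensorAlgebra ℝ V ⊗[ℝ] TensorAlgebra ℝ V :=
    Algebra.TensorProduct.includeLeft
  let iR : TensorAlgebra ℝ V →ₐ[ℝ] TensorAlgebra ℝ V ⊗[ℝ] TensorAlgebra ℝ V :=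
    Algebra.TensorProduct.includeRight
  have hcomm : ∀ c d, Commute (iL c) (iR d) := by
    intro c d
    simp [Commute, SemiconjBy, iL, iR]
  have hnil : ∀ z ∈ augIdeal₂ V, π z ^ (n + 1) = 0 := by
    intro z hz
    rw [← map_pow]
    exact Ideal.Quotient.eq_zero_iff_mem.2 (Ideal.pow_mem_pow hz _)
  have hmemL : ∀ c : TensorAlgebra ℝ V, TensorAlgebra.algebraMapInv c = (0 : ℝ) →
      iL c ∈ augIdeal₂ V := by
    intro c hc
    rw [augIdeal₂, RingHom.mem_ker]
    simp [iL, hc]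
  have hmemR : ∀ c : TensorAlgebra ℝ V, TensorAlgebra.algebraMapInv c = (0 : ℝ) →
      iR c ∈ augIdeal₂ V := by
    intro c hc
    rw [augIdeal₂, RingHom.mem_ker]
    simp [iR, hc]
  have hexp : ∀ c, IsTensorPrimitive c → π (tensorComul V (expTrunc n c)) =
      π (iL (expTrunc n c)) * π (iR (expTrunc n c)) := by
    intro c hc
    have h0 := hc.algebraMapInv_eq_zero
    have hc' : tensorComul V c = iL c + iR c := hc
    rw [map_expTrunc, hc', map_expTrunc, map_add, expTrunc_add_of_commute ((hcomm c c).map π)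
      (hnil _ (hmemL c h0)) (hnil _ (hmemR c h0))]
    · simp only [map_expTrunc]
    · rw [← map_add]
      exact hnil _ (Ideal.add_mem _ (hmemL c h0) (hmemR c h0))
  -- Group-like elements are stable under products because the two tensor factors commute; the
  -- logarithm then turns `x ⊗ x` into `L ⊗ 1 + 1 ⊗ L`.
  have hxx : π (tensorComul V x) = π (iL x) * π (iR x) := by
    have h := ((hcomm (expTrunc n b) (expTrunc n a)).map π).eq
    rw [hx, map_mul, map_mul, hexp a ha, hexp b hb, map_mul, map_mul, map_mul, map_mul]
    simp only [mul_assoc]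
    rw [← mul_assoc (π (iR (expTrunc n a))), ← h]
    simp only [mul_assoc]
  have haug : ∀ c : TensorAlgebra ℝ V, TensorAlgebra.algebraMapInv c = (0 : ℝ) →
      TensorAlgebra.algebraMapInv (expTrunc n c) = (1 : ℝ) := by
    intro c hc
    rw [map_expTrunc, hc, expTrunc_zero]
  have hx1 : TensorAlgebra.algebraMapInv (x - 1) = (0 : ℝ) := by
    rw [map_sub, hx, map_mul, haug a ha.algebraMapInv_eq_zero, haug b hb.algebraMapInv_eq_zero]
    simp
  have hlog : π (tensorComul V L) = π (iL L) + π (iR L) := by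
    let I : Submodule ℝ ((TensorAlgebra ℝ V ⊗[ℝ] TensorAlgebra ℝ V) ⧸ J) :=
      ((augIdeal₂ V).restrictScalars ℝ).map π.toLinearMap
    have hI : ∀ z ∈ I, z ^ (n + 1) = 0 := by
      rintro _ ⟨z, hz, rfl⟩
      exact hnil z hz
    have hmul : ∀ z ∈ I, ∀ w, w * z ∈ I := by
      rintro _ ⟨z, hz, rfl⟩ w
      obtain ⟨w, rfl⟩ := Ideal.Quotient.mk_surjective w
      exact ⟨w * z, Ideal.mul_mem_left _ w hz, map_mul π w z⟩
    have h1 := logTrunc_mul_of_commute hI hmul ((hcomm x x).map π)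
      ⟨iL (x - 1), hmemL _ hx1, by simp⟩ ⟨iR (x - 1), hmemR _ hx1, by simp⟩
    rw [hL, map_logTrunc, map_logTrunc, hxx, h1]
    simp only [map_logTrunc]
  have hJ : tensorComul V L - (iL L + iR L) ∈ J := by
    rw [← map_add, ← sub_eq_zero, ← map_sub] at hlog
    exact Ideal.Quotient.eq_zero_iff_mem.1 hlog
  -- `L` is primitive up to `J`. Applying `D ⋆ id` gives `Y L` on one side and `D L` on the other,
  -- since `D 1 = 0`.
  have h2 := dynkinMul_mem (augIdeal₂_pow_le _ hJ) (Nat.lt_succ_of_le hk)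
  have h3 : dynkinMul V (iL L + iR L) = dynkin V L := by
    simp [dynkinMul, iL, iR, dynkin_one]
  rw [map_sub, h3, dynkinMul_tensorComul, map_sub, tensorProj_tensorGrading, tensorProj_dynkin] at h2
  exact sub_eq_zero.1 h2

end Primitive


/-! ### Calculus in Stein's spaces -/

section SteinCalculus

variable {U W E G : Type*} [NormedAddCommGroup U] [NormedSpace ℝ U]
  [NormedAddCommGroup W] [NormedSpace ℝ W] [NormedAddCommGroup E] [NormedSpace ℝ E]
  [NormedAddCommGroup G] [NormedSpace ℝ G]

theorem IsSteinLip.mono {n : ℕ} {M M' : ℝ} {f : U → W} (h : IsSteinLip n M f) (hM : M ≤ M') :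
    IsSteinLip n M' f :=
  ⟨h.1, fun j hj x => (h.2.1 j hj x).trans hM,
    fun x y => (h.2.2 x y).trans (mul_le_mul_of_nonneg_right hM (norm_nonneg _))⟩

theorem IsSteinLip.sum {ι : Type*} {n : ℕ} (s : Finset ι) {M : ι → ℝ} {f : ι → U → W}
    (h : ∀ i ∈ s, IsSteinLip n (M i) (f i)) : IsSteinLip n (∑ i ∈ s, M i) (∑ i ∈ s, f i) := by
  classical
  induction s using Finset.induction_on with
  | empty => simpa using IsSteinLip.zero n
  | insert a s ha ih =>
    rw [Finset.sum_insert ha, Finset.sum_insert ha]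
    exact (h a (Finset.mem_insert_self _ _)).add
      (ih fun i hi => h i (Finset.mem_insert_of_mem hi))

theorem IsSteinLip.norm_iteratedFDeriv_sub_le {n : ℕ} {M : ℝ} {f : U → W}
    (h : IsSteinLip n M f) {j : ℕ} (hj : j ≤ n) (x y : U) :
    ‖iteratedFDeriv ℝ j f x - iteratedFDeriv ℝ j f y‖ ≤ M * ‖x - y‖ := by
  rcases hj.eq_or_lt with rfl | hj
  · exact h.2.2 x y
  · have hd : Differentiable ℝ (iteratedFDeriv ℝ j f) :=
      h.1.differentiable_iteratedFDeriv (by exact_mod_cast hj)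
    refine Convex.norm_image_sub_le_of_norm_fderiv_le (𝕜 := ℝ) (s := Set.univ)
      (fun z _ => hd z) (fun z _ => ?_) convex_univ (Set.mem_univ y) (Set.mem_univ x)
    rw [norm_fderiv_iteratedFDeriv]
    exact h.2.1 (j + 1) hj z

theorem IsSteinLip.of_le {m n : ℕ} (hmn : m ≤ n) {M : ℝ} {f : U → W} (h : IsSteinLip n M f) :
    IsSteinLip m M f :=
  ⟨h.1.of_le (by exact_mod_cast hmn), fun j hj x => h.2.1 j (hj.trans hmn) x,
    fun x y => h.norm_iteratedFDeriv_sub_le hmn x y⟩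

theorem IsSteinLip.norm_le {n : ℕ} {M : ℝ} {f : U → W} (h : IsSteinLip n M f) (x : U) :
    ‖f x‖ ≤ M := by
  have := h.2.1 0 (Nat.zero_le _) x
  rwa [norm_iteratedFDeriv_zero] at this

theorem IsSteinLip.norm_sub_le {n : ℕ} {M : ℝ} {f : U → W} (h : IsSteinLip n M f) (x y : U) :
    ‖f x - f y‖ ≤ M * ‖x - y‖ := by
  have := h.norm_iteratedFDeriv_sub_le (Nat.zero_le _) x y
  rwa [iteratedFDeriv_zero_eq_comp, Function.comp_apply, Function.comp_apply, ← map_sub,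
    LinearIsometryEquiv.norm_map] at this

theorem IsSteinLip.norm_fderiv_le {n : ℕ} {M : ℝ} {f : U → W} (h : IsSteinLip (n + 1) M f)
    (x : U) : ‖fderiv ℝ f x‖ ≤ M := by
  have := h.2.1 1 (by omega) x
  rwa [← norm_iteratedFDeriv_one]

theorem IsSteinLip.fderiv {n : ℕ} {M : ℝ} {f : U → W} (h : IsSteinLip (n + 1) M f) :
    IsSteinLip n M (fderiv ℝ f) := by
  refine ⟨h.1.fderiv_right (by norm_cast), fun j hj x => ?_, fun x y => ?_⟩
  · rw [norm_iteratedFDeriv_fderiv]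
    exact h.2.1 (j + 1) (by omega) x
  · have e := (continuousMultilinearCurryRightEquiv' ℝ n U W).symm.dist_map
      (iteratedFDeriv ℝ n (_root_.fderiv ℝ f) x) (iteratedFDeriv ℝ n (_root_.fderiv ℝ f) y)
    rw [dist_eq_norm, dist_eq_norm] at e
    refine (le_of_eq ?_).trans (h.2.2 x y)
    rw [iteratedFDeriv_succ_eq_comp_right, iteratedFDeriv_succ_eq_comp_right]
    exact e.symm

theorem IsSteinLip.norm_iteratedFDeriv_sub_comp_add_le {n : ℕ} {M : ℝ} {f : U → W}
    (h : IsSteinLip n M f) {x y c : U} (hc : x + c = y) {i : ℕ} (hi : i ≤ n) :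
    ‖iteratedFDeriv ℝ i (fun z => f z - f (z + c)) x‖ ≤ M * ‖x - y‖ := by
  have hf : ContDiff ℝ i f := h.1.of_le (by exact_mod_cast hi)
  have htf : ContDiff ℝ i (fun z => f (z + c)) := hf.comp (contDiff_id.add contDiff_const)
  have e := iteratedFDeriv_sub_apply (x := x) hf.contDiffAt htf.contDiffAt
  rw [iteratedFDeriv_comp_add_right, hc] at e
  have e3 : (fun z => f z - f (z + c)) = f - fun z => f (z + c) := rfl
  rw [e3, e]
  exact h.norm_iteratedFDeriv_sub_le hi x y

theorem norm_iteratedFDeriv_clm_apply_le {n j : ℕ} (hj : j ≤ n) {f : U → E →L[ℝ] G} {g : U → E}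
    {M N : ℝ} (hf : ContDiff ℝ n f) (hg : ContDiff ℝ n g) (hM : 0 ≤ M) (x : U)
    (hfM : ∀ i ≤ j, ‖iteratedFDeriv ℝ i f x‖ ≤ M) (hgN : ∀ i ≤ j, ‖iteratedFDeriv ℝ i g x‖ ≤ N) :
    ‖iteratedFDeriv ℝ j (fun y => f y (g y)) x‖ ≤ 2 ^ j * (M * N) := by
  refine (norm_iteratedFDeriv_clm_apply hf hg x (by exact_mod_cast hj)).trans ?_
  have h2 : (2 : ℝ) ^ j = ∑ i ∈ Finset.range (j + 1), (j.choose i : ℝ) := by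
    exact_mod_cast (Nat.sum_range_choose j).symm
  rw [h2, Finset.sum_mul]
  refine Finset.sum_le_sum fun i hi => ?_
  have hi' : i ≤ j := Nat.lt_succ_iff.1 (Finset.mem_range.1 hi)
  rw [mul_assoc]
  exact mul_le_mul_of_nonneg_left
    (mul_le_mul (hfM i hi') (hgN _ (Nat.sub_le _ _)) (norm_nonneg _) hM) (Nat.cast_nonneg _)

/-- Leibniz' formula bounds the derivatives. For the Lipschitz bound of the last one, no derivative
of order `n + 1` is available: the increment is written as the derivative at `x` of `f g - τf τg =
(f - τf) g + τf (g - τg)`, with `τ` the translation by `y - x`. -/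
theorem IsSteinLip.clm_apply {n : ℕ} {M N : ℝ} {f : U → E →L[ℝ] G} {g : U → E}
    (hf : IsSteinLip n M f) (hg : IsSteinLip n N g) :
    IsSteinLip n (2 ^ (n + 1) * (M * N)) (fun x => f x (g x)) := by
  have hM := hf.nonneg
  have hN := hg.nonneg
  refine ⟨hf.1.clm_apply hg.1, fun j hj x => ?_, fun x y => ?_⟩
  · refine (norm_iteratedFDeriv_clm_apply_le hj hf.1 hg.1 hM x
      (fun i hi => hf.2.1 i (hi.trans hj) x) (fun i hi => hg.2.1 i (hi.trans hj) x)).trans ?_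
    have : (2 : ℝ) ^ j ≤ 2 ^ (n + 1) := pow_le_pow_right₀ (by norm_num) (by omega)
    gcongr
  · set c := y - x with hc
    have hxc : x + c = y := by simp [hc]
    have htf : ContDiff ℝ n (fun z => f (z + c)) := hf.1.comp (contDiff_id.add contDiff_const)
    have htg : ContDiff ℝ n (fun z => g (z + c)) := hg.1.comp (contDiff_id.add contDiff_const)
    have hsplit : iteratedFDeriv ℝ n (fun z => f z (g z)) x
        - iteratedFDeriv ℝ n (fun z => f z (g z)) y =
        iteratedFDeriv ℝ n (fun z => (f z - f (z + c)) (g z)) x +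
        iteratedFDeriv ℝ n (fun z => f (z + c) (g z - g (z + c))) x := by
      have h1 := iteratedFDeriv_comp_add_right (𝕜 := ℝ) (f := fun z => f z (g z)) n c x
      rw [hxc] at h1
      rw [← h1, ← iteratedFDeriv_add_apply ((hf.1.sub htf).clm_apply hg.1).contDiffAt
        (htf.clm_apply (hg.1.sub htg)).contDiffAt, ← iteratedFDeriv_sub_apply
        (hf.1.clm_apply hg.1).contDiffAt (htf.clm_apply htg).contDiffAt]
      congr 1
      funext z
      simp
    have b1 : ‖iteratedFDeriv ℝ n (fun z => (f z - f (z + c)) (g z)) x‖ ≤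
        2 ^ n * (M * ‖x - y‖ * N) :=
      norm_iteratedFDeriv_clm_apply_le le_rfl (hf.1.sub htf) hg.1 (by positivity) x
        (fun i hi => hf.norm_iteratedFDeriv_sub_comp_add_le hxc hi) (fun i hi => hg.2.1 i hi x)
    have b2 : ‖iteratedFDeriv ℝ n (fun z => f (z + c) (g z - g (z + c))) x‖ ≤
        2 ^ n * (M * (N * ‖x - y‖)) :=
      norm_iteratedFDeriv_clm_apply_le le_rfl htf (hg.1.sub htg) hM x
        (fun i hi => by
          rw [iteratedFDeriv_comp_add_right]
          exact hf.2.1 i hi _) (fun i hi => hg.norm_iteratedFDeriv_sub_comp_add_le hxc hi)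
    rw [hsplit]
    refine (norm_add_le _ _).trans ((add_le_add b1 b2).trans (le_of_eq ?_))
    ring

end SteinCalculus

/-! ### Bounds for the differential operators -/

section OperatorBounds

variable {V U W : Type*} [NormedAddCommGroup V] [NormedSpace ℝ V]
  [NormedAddCommGroup U] [NormedSpace ℝ U] [NormedAddCommGroup W] [NormedSpace ℝ W] {n : ℕ}

theorem IsSteinLip.apply_fieldOp (F : V →L[ℝ] SteinSpace n U U) (v : V) {m : ℕ} (hm : m + 1 ≤ n) {M : ℝ}
    {g : U → W} (hg : IsSteinLip (m + 1) M g) :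
    IsSteinLip m (2 ^ (n + 1) * ‖F‖ * ‖v‖ * M) (fieldOp F v g) := by
  have h1 : IsSteinLip m (‖F‖ * ‖v‖) (F v).1 :=
    ((SteinSpace.isSteinLip_norm (F v)).mono (F.le_opNorm v)).of_le (by omega)
  refine (hg.fderiv.clm_apply h1).mono ?_
  have h2 : (2 : ℝ) ^ (m + 1) ≤ 2 ^ (n + 1) := pow_le_pow_right₀ (by norm_num) (by omega)
  have := hg.nonneg
  calc (2 : ℝ) ^ (m + 1) * (M * (‖F‖ * ‖v‖)) ≤ 2 ^ (n + 1) * (M * (‖F‖ * ‖v‖)) := by gcongr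
    _ = _ := by ring

/-- Each field costs one order of regularity and a factor `2^(n+1) ‖F‖ ‖v‖`. -/
theorem IsSteinLip.foldr_fieldOp (F : V →L[ℝ] SteinSpace n U U) {m : ℕ} (hm : m ≤ n) {M : ℝ}
    {f : U → W} (hf : IsSteinLip m M f) (l : List V) (hl : l.length ≤ m) :
    IsSteinLip (m - l.length)
      ((2 ^ (n + 1) * ‖F‖) ^ l.length * (l.map (‖·‖)).prod * M) (l.foldr (fieldOp F) f) := by
  induction l with
  | nil => simpa using hf
  | cons v l ih =>
    rw [List.length_cons] at hl
    have h1 := ih (by omega)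
    have h2 : m - l.length = m - (v :: l).length + 1 := by
      rw [List.length_cons]
      omega
    rw [h2] at h1
    refine (h1.apply_fieldOp F v (by rw [List.length_cons]; omega)).mono (le_of_eq ?_)
    simp only [List.length_cons, List.map_cons, List.prod_cons]
    ring

theorem fieldOp_id (F : V →L[ℝ] SteinSpace n U U) (v : V) : fieldOp F v id = F v := by
  funext x
  simp [fieldOp]

/-- The linear map `a ↦ F^⊗(a) f`. -/
def tensorOpMap (F : V →L[ℝ] SteinSpace n U U) (f : U → W) (hf : ContDiff ℝ n f) :
    TensorAlgebra ℝ V →ₗ[ℝ] (U → W) where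
  toFun a := tensorOpAlg F a f hf
  map_add' a b := by
    funext x
    exact map_add (tensorOpLin F f hf x) a b
  map_smul' r a := by
    funext x
    exact map_smul (tensorOpLin F f hf x) r a

theorem tensorOpMap_tensorWord (F : V →L[ℝ] SteinSpace n U U) (f : U → W) (hf : ContDiff ℝ n f)
    (l : List V) : tensorOpMap F f hf (tensorWord l) =
      if l.length ≤ n then l.foldr (fieldOp F) f else 0 :=
  tensorOpAlg_prod F l f hf

theorem tensorOpMap_one (F : V →L[ℝ] SteinSpace n U U) (f : U → W) (hf : ContDiff ℝ n f) :
    tensorOpMap F f hf 1 = f := by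
  simpa using tensorOpMap_tensorWord F f hf []

theorem tensorOpMap_eq_sum (F : V →L[ℝ] SteinSpace n U U) (f : U → W) (hf : ContDiff ℝ n f)
    (a : TensorAlgebra ℝ V) : tensorOpMap F f hf a =
      ∑ k ∈ Finset.range (n + 1), tensorOpMap F f hf (tensorProj V k a) := by
  induction a using tensorWord_induction with
  | hadd a b ha hb =>
    simp only [map_add, Finset.sum_add_distrib]
    rw [← ha, ← hb]
  | hsmul r a ha =>
    simp only [map_smul, ← Finset.smul_sum]
    rw [← ha]
  | hword l =>
    simp only [tensorProj_tensorWord]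
    by_cases h : l.length ≤ n
    · rw [Finset.sum_eq_single l.length]
      · simp
      · intro b _ hb
        simp [hb.symm]
      · intro h'
        exact absurd (Finset.mem_range.2 (Nat.lt_succ_of_le h)) h'
    · rw [tensorOpMap_tensorWord, if_neg h]
      refine (Finset.sum_eq_zero fun k hk => ?_).symm
      have := Finset.mem_range.1 hk
      rw [if_neg (by omega), map_zero]

/-- A linear map on a tensor power with values in the maps from `U` to `W`, bounded on pure tensors
for a Stein norm, is bounded for the projective norm. -/
theorem isSteinLip_of_pure {k r : ℕ} {C : ℝ} (hC : 0 ≤ C) (g : (⨂[ℝ]^k V) →ₗ[ℝ] (U → W))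
    (hg : ∀ m : Fin k → V, IsSteinLip r (C * ∏ i, ‖m i‖) (g (PiTensorProduct.tprod ℝ m)))
    (t : ⨂[ℝ]^k V) : IsSteinLip r (C * ‖t‖) (g t) := by
  let B : MultilinearMap ℝ (fun _ : Fin k => V) (SteinSpace r U W) :=
    (g.compMultilinearMap (PiTensorProduct.tprod ℝ)).codRestrict (steinSubmodule r U W)
      (fun m => ⟨_, hg m⟩)
  have hB : ∀ m, ‖B m‖ ≤ C * ∏ i, ‖m i‖ := fun m => SteinSpace.norm_le (hg m)
  have h := PiTensorProduct.norm_eval_le_projectiveSeminorm (B.mkContinuous C hB) t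
  have e : (PiTensorProduct.lift (B.mkContinuous C hB).toMultilinearMap t).1 = g t := by
    let S : SteinSpace r U W →ₗ[ℝ] (U → W) := (steinSubmodule r U W).subtype
    have : S.comp (PiTensorProduct.lift (B.mkContinuous C hB).toMultilinearMap) = g := by
      apply PiTensorProduct.ext
      ext1 m
      simp only [LinearMap.compMultilinearMap_apply, LinearMap.comp_apply,
        PiTensorProduct.lift.tprod]
      rfl
    exact LinearMap.congr_fun this t
  rw [← e]
  exact (SteinSpace.isSteinLip_norm _).mono
    (h.trans (mul_le_mul_of_nonneg_right (MultilinearMap.mkContinuous_norm_le _ hC _)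
      (norm_nonneg _)))

theorem prod_map_norm_ofFn {X : Type*} [NormedAddCommGroup X] {k : ℕ} (m : Fin k → X) :
    ((List.ofFn m).map (‖·‖)).prod = ∏ i, ‖m i‖ := by
  rw [List.map_ofFn, List.prod_ofFn]
  rfl

/-- In each degree `k ≤ n` the projective norm is controlled by the tensor norm of the homogeneous
component alone. This lets bounds on pure tensors be read in terms of the `‖π_k‖`. -/
theorem TensorNorm.exists_bound_tensorProj (q : TensorNorm V n) :
    ∃ D : ℝ, 0 ≤ D ∧ ∀ k ≤ n, ∀ a, ‖tensorComponent V k a‖ ≤ D * q.toSeminorm (tensorProj V k a) ∧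
      q.toSeminorm (tensorProj V k a) ≤ D * q.toSeminorm a := by
  obtain ⟨C, hC⟩ := q.exists_bound
  have hq : 0 ≤ q.toSeminorm 1 := apply_nonneg _ _
  have hbound : ∀ (k : ℕ) (t : ⨂[ℝ]^k V),
      q.toSeminorm (TensorPower.toTensorAlgebra t) ≤ q.toSeminorm 1 * ‖t‖ := by
    intro k t
    let B : MultilinearMap ℝ (fun _ : Fin k => V) (AlgTensor q) := TensorAlgebra.tprod ℝ V k
    have hB : ∀ m, ‖B m‖ ≤ q.toSeminorm 1 * ∏ i, ‖m i‖ := by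
      intro m
      have h := list_prod_ι_le q (List.ofFn m)
      rw [prod_map_norm_ofFn, List.map_ofFn] at h
      have e : B m = (List.ofFn (TensorAlgebra.ι ℝ ∘ m)).prod := TensorAlgebra.tprod_apply ℝ V m
      rw [e]
      exact h
    have h := PiTensorProduct.norm_eval_le_projectiveSeminorm (B.mkContinuous _ hB) t
    exact h.trans (mul_le_mul_of_nonneg_right (MultilinearMap.mkContinuous_norm_le _ hq _)
      (norm_nonneg _))
  refine ⟨max |C| (q.toSeminorm 1 * |C|), le_max_of_le_left (abs_nonneg _), fun k hk a => ⟨?_, ?_⟩⟩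
  · rw [← tensorComponent_tensorProj]
    refine (hC k hk _).trans (mul_le_mul_of_nonneg_right ?_ (apply_nonneg _ _))
    exact (le_abs_self C).trans (le_max_left _ _)
  · refine (hbound k (tensorComponent V k a)).trans ?_
    refine (mul_le_mul_of_nonneg_left (hC k hk a) hq).trans ?_
    rw [← mul_assoc]
    refine mul_le_mul_of_nonneg_right ?_ (apply_nonneg _ _)
    exact (mul_le_mul_of_nonneg_left (le_abs_self C) hq).trans (le_max_right _ _)

/-- The identity is unbounded, hence not in Stein's space, and needs its own clause: in degree at
least one the last letter replaces `Id` by `F(v)`, which is a Stein map. -/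
theorem exists_isSteinLip_tensorOpMap (q : TensorNorm V n) (F : V →L[ℝ] SteinSpace n U U) :
    ∃ C : ℝ, 0 ≤ C ∧ ∀ k ≤ n, ∀ (a : TensorAlgebra ℝ V),
      (∀ (f : U → W) (hf : ContDiff ℝ n f) (M : ℝ), IsSteinLip n M f → IsSteinLip (n - k)
        (C * q.toSeminorm (tensorProj V k a) * M) (tensorOpMap F f hf (tensorProj V k a))) ∧
      (1 ≤ k → IsSteinLip 0 (C * q.toSeminorm (tensorProj V k a))
        (tensorOpMap F id contDiff_id (tensorProj V k a))) := by
  obtain ⟨D, hD0, hD⟩ := q.exists_bound_tensorProj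
  set K : ℝ := 1 + 2 ^ (n + 1) * ‖F‖ with hK
  have hK1 : 1 ≤ K := by
    rw [hK]
    have : 0 ≤ 2 ^ (n + 1) * ‖F‖ := by positivity
    linarith
  have hK' : ∀ j ≤ n, (2 ^ (n + 1) * ‖F‖) ^ j ≤ K ^ n := fun j hj =>
    (pow_le_pow_left₀ (by positivity) (by rw [hK]; linarith) j).trans (pow_le_pow_right₀ hK1 hj)
  refine ⟨K ^ n * (1 + ‖F‖) * D, by positivity, fun k hk a => ⟨fun f hf M hM => ?_, fun hk1 => ?_⟩⟩
  · have hM0 := hM.nonneg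
    have h := isSteinLip_of_pure (k := k) (r := n - k) (C := K ^ n * M) (by positivity)
      ((tensorOpMap F f hf).comp (TensorPower.toTensorAlgebra (n := k))) (fun m => ?_)
      (tensorComponent V k a)
    · refine h.mono ?_
      have h1 := (hD k hk a).1
      have h0 : 0 ≤ q.toSeminorm (tensorProj V k a) := apply_nonneg _ _
      calc K ^ n * M * ‖tensorComponent V k a‖
          ≤ K ^ n * M * (D * q.toSeminorm (tensorProj V k a)) := by gcongr
        _ = K ^ n * 1 * D * q.toSeminorm (tensorProj V k a) * M := by ring
        _ ≤ K ^ n * (1 + ‖F‖) * D * q.toSeminorm (tensorProj V k a) * M := by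
            have : 1 ≤ 1 + ‖F‖ := by linarith [norm_nonneg F]
            gcongr
    · rw [LinearMap.comp_apply, ← tensorWord_ofFn, tensorOpMap_tensorWord, List.length_ofFn,
        if_pos hk]
      have h := hM.foldr_fieldOp F le_rfl (List.ofFn m) (by simpa using hk)
      rw [List.length_ofFn, prod_map_norm_ofFn] at h
      refine h.mono ?_
      have h0 : 0 ≤ ∏ i, ‖m i‖ := Finset.prod_nonneg fun _ _ => norm_nonneg _
      calc (2 ^ (n + 1) * ‖F‖) ^ k * (∏ i, ‖m i‖) * M ≤ K ^ n * (∏ i, ‖m i‖) * M := by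
            have := hK' k hk
            gcongr
        _ = _ := by ring
  · have h := isSteinLip_of_pure (k := k) (r := 0) (C := K ^ n * ‖F‖) (by positivity)
      ((tensorOpMap F id contDiff_id).comp (TensorPower.toTensorAlgebra (n := k))) (fun m => ?_)
      (tensorComponent V k a)
    · refine h.mono ?_
      have h1 := (hD k hk a).1
      have h0 : 0 ≤ q.toSeminorm (tensorProj V k a) := apply_nonneg _ _
      calc K ^ n * ‖F‖ * ‖tensorComponent V k a‖
          ≤ K ^ n * ‖F‖ * (D * q.toSeminorm (tensorProj V k a)) := by gcongr
        _ ≤ K ^ n * (1 + ‖F‖) * (D * q.toSeminorm (tensorProj V k a)) := by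
            have : ‖F‖ ≤ 1 + ‖F‖ := by linarith
            gcongr
        _ = _ := by ring
    · rw [LinearMap.comp_apply, ← tensorWord_ofFn, tensorOpMap_tensorWord, List.length_ofFn,
        if_pos hk]
      rw [← prod_map_norm_ofFn m]
      have hlen : (List.ofFn m).length = k := List.length_ofFn
      generalize List.ofFn m = l at hlen ⊢
      -- The last letter is the one applied directly to `Id`; the other `k - 1 < n` letters act on
      -- `F v` and leave a regularity of order at least `0`.
      obtain ⟨l, v, rfl⟩ : ∃ l' v, l = l' ++ [v] := by
        refine ⟨l.dropLast, l.getLast ?_, (List.dropLast_append_getLast _).symm⟩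
        rintro rfl
        simp at hlen
        omega
      rw [List.length_append, List.length_singleton] at hlen
      rw [List.foldr_append, List.foldr_cons, List.foldr_nil, fieldOp_id]
      have h := (((SteinSpace.isSteinLip_norm (F v)).mono (F.le_opNorm v)).foldr_fieldOp F le_rfl l
        (by omega)).of_le (Nat.zero_le _)
      refine h.mono ?_
      have h0 : 0 ≤ (l.map (‖·‖)).prod := List.prod_nonneg (by simp)
      have := hK' l.length (by omega)
      simp only [List.map_append, List.prod_append, List.map_cons, List.map_nil, List.prod_cons,
        List.prod_nil, mul_one]
      calc (2 ^ (n + 1) * ‖F‖) ^ l.length * (l.map (‖·‖)).prod * (‖F‖ * ‖v‖)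
          ≤ K ^ n * (l.map (‖·‖)).prod * (‖F‖ * ‖v‖) := by gcongr
        _ = _ := by ring

/-- `F^⊗(a) Id` is bounded and Lipschitz if `a` has no component of degree `0`. -/
theorem exists_isSteinLip_tensorOpMap_id (q : TensorNorm V n) (F : V →L[ℝ] SteinSpace n U U) :
    ∃ C : ℝ, 0 ≤ C ∧ ∀ a : TensorAlgebra ℝ V, tensorProj V 0 a = 0 →
      IsSteinLip 0 (C * q.toSeminorm a) (tensorOpMap F id contDiff_id a) := by
  obtain ⟨C, hC0, hC⟩ := exists_isSteinLip_tensorOpMap (W := U) q F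
  obtain ⟨D, hD0, hD⟩ := q.exists_bound_tensorProj
  refine ⟨∑ k ∈ Finset.range n, C * D, by positivity, fun a ha => ?_⟩
  rw [tensorOpMap_eq_sum, Finset.sum_range_succ', ha, map_zero, add_zero, Finset.sum_mul]
  refine IsSteinLip.sum _ fun k hk => ?_
  have hk' := Finset.mem_range.1 hk
  refine ((hC (k + 1) (by omega) a).2 (by omega)).mono ?_
  rw [mul_assoc]
  exact mul_le_mul_of_nonneg_left (hD (k + 1) (by omega) a).2 hC0

end OperatorBounds


/-! ### Lie elements act as vector fields -/

section VectorField

variable {V U W : Type*} [NormedAddCommGroup V] [NormedSpace ℝ V]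
  [NormedAddCommGroup U] [NormedSpace ℝ U] [NormedAddCommGroup W] [NormedSpace ℝ W] {n : ℕ}

variable (V) in
/-- The homogeneous elements of degree `k` of the tensor algebra. -/
def wordsOfLength (k : ℕ) : Submodule ℝ (TensorAlgebra ℝ V) :=
  Submodule.span ℝ (tensorWord '' {l | l.length = k})

theorem tensorWord_mem_wordsOfLength (l : List V) : tensorWord l ∈ wordsOfLength V l.length :=
  Submodule.subset_span ⟨l, rfl, rfl⟩

theorem ι_mem_wordsOfLength (v : V) : TensorAlgebra.ι ℝ v ∈ wordsOfLength V 1 := by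
  simpa [tensorWord] using tensorWord_mem_wordsOfLength [v]

theorem mul_mem_wordsOfLength {i j : ℕ} {a b : TensorAlgebra ℝ V}
    (ha : a ∈ wordsOfLength V i) (hb : b ∈ wordsOfLength V j) :
    a * b ∈ wordsOfLength V (i + j) := by
  have := Submodule.mul_mem_mul ha hb
  rw [wordsOfLength, wordsOfLength, Submodule.span_mul_span] at this
  refine Submodule.span_mono ?_ this
  rintro _ ⟨_, ⟨l, hl, rfl⟩, _, ⟨l', hl', rfl⟩, rfl⟩
  refine ⟨l ++ l', ?_, tensorWord_append l l'⟩
  have h1 : l.length = i := hl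
  have h2 : l'.length = j := hl'
  simp [h1, h2]

theorem tensorProj_mem_wordsOfLength (k : ℕ) (a : TensorAlgebra ℝ V) :
    tensorProj V k a ∈ wordsOfLength V k := by
  induction a using tensorWord_induction with
  | hadd a b ha hb => rw [map_add]; exact Submodule.add_mem _ ha hb
  | hsmul r a ha => rw [map_smul]; exact Submodule.smul_mem _ _ ha
  | hword l =>
    rw [tensorProj_tensorWord]
    split_ifs with h
    · rw [← h]
      exact tensorWord_mem_wordsOfLength l
    · exact Submodule.zero_mem _

theorem dynkin_tensorWord_mem (l : List V) :
    dynkin V (tensorWord l) ∈ wordsOfLength V l.length := by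
  have := tensorProj_mem_wordsOfLength l.length (dynkin V (tensorWord l))
  rwa [tensorProj_dynkin_tensorWord, if_pos rfl] at this

theorem contDiff_tensorOpMap (F : V →L[ℝ] SteinSpace n U U) (f : U → W) (hf : ContDiff ℝ n f)
    {k : ℕ} (hk : k ≤ n) {a : TensorAlgebra ℝ V} (ha : a ∈ wordsOfLength V k) :
    ContDiff ℝ ((n - k : ℕ) : WithTop ℕ∞) (tensorOpMap F f hf a) := by
  induction ha using Submodule.span_induction with
  | mem x hx =>
    obtain ⟨l, hl, rfl⟩ := hx
    have hl' : l.length = k := hl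
    rw [tensorOpMap_tensorWord, if_pos (by omega)]
    obtain ⟨C, hC⟩ := foldr_fieldOp_bound F hf 0 k hk 0 (Nat.zero_le _)
    exact (hC l hl').1
  | zero => rw [map_zero]; exact contDiff_const
  | add x y _ _ hx hy => rw [map_add]; exact hx.add hy
  | smul r x _ hx => rw [map_smul]; exact contDiff_const.smul hx

theorem differentiable_tensorOpMap (F : V →L[ℝ] SteinSpace n U U) (f : U → W)
    (hf : ContDiff ℝ n f) {k : ℕ} (hk : k < n) {a : TensorAlgebra ℝ V}
    (ha : a ∈ wordsOfLength V k) : Differentiable ℝ (tensorOpMap F f hf a) :=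
  differentiable_of_mem_ck hk ⟨_, contDiff_tensorOpMap F f hf hk.le ha⟩

theorem tensorOpMap_ι_mul (F : V →L[ℝ] SteinSpace n U U) (f : U → W) (hf : ContDiff ℝ n f)
    (v : V) {k : ℕ} (hk : k < n) {a : TensorAlgebra ℝ V} (ha : a ∈ wordsOfLength V k) :
    tensorOpMap F f hf (TensorAlgebra.ι ℝ v * a) = fieldOp F v (tensorOpMap F f hf a) := by
  induction ha using Submodule.span_induction with
  | mem x hx =>
    obtain ⟨l, hl, rfl⟩ := hx
    have hl' : l.length = k := hl
    rw [← tensorWord_cons, tensorOpMap_tensorWord, tensorOpMap_tensorWord, List.length_cons,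
      if_pos (by omega), if_pos (by omega)]
    rfl
  | zero =>
    funext x
    simp [fieldOp]
  | add x y hx hy hx' hy' =>
    have h1 := differentiable_tensorOpMap F f hf hk hx
    have h2 := differentiable_tensorOpMap F f hf hk hy
    rw [mul_add, map_add, hx', hy', map_add]
    funext z
    simp only [fieldOp, Pi.add_apply]
    rw [fderiv_add (h1 z) (h2 z)]
    rfl
  | smul r x hx hx' =>
    have h1 := differentiable_tensorOpMap F f hf hk hx
    rw [mul_smul_comm, map_smul, hx', map_smul]
    funext z
    simp only [fieldOp, Pi.smul_apply]
    rw [fderiv_const_smul (h1 z)]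
    rfl

/-- `F^⊗(a)` acts as the vector field `F^⊗(a) Id` on the images of `f` under the operators of
degree `i`, if `a` is homogeneous of degree `j` and `i + j ≤ n`. -/
def ActsAsVectorField (F : V →L[ℝ] SteinSpace n U U) (f : U → W) (hf : ContDiff ℝ n f) (j : ℕ)
    (a : TensorAlgebra ℝ V) : Prop :=
  ∀ i, i + j ≤ n → ∀ w ∈ wordsOfLength V i, ∀ x, tensorOpMap F f hf (a * w) x =
    fderiv ℝ (tensorOpMap F f hf w) x (tensorOpMap F id contDiff_id a x)

theorem tensorOpMap_id_ι (F : V →L[ℝ] SteinSpace n U U) (v : V) (hn : 1 ≤ n) :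
    tensorOpMap F id contDiff_id (TensorAlgebra.ι ℝ v) = F v := by
  have := tensorOpMap_tensorWord F (id : U → U) contDiff_id [v]
  simpa [tensorWord, hn, fieldOp_id] using this

theorem actsAsVectorField_ι (F : V →L[ℝ] SteinSpace n U U) (f : U → W) (hf : ContDiff ℝ n f)
    (v : V) : ActsAsVectorField F f hf 1 (TensorAlgebra.ι ℝ v) := by
  intro i hi w hw x
  rw [tensorOpMap_ι_mul F f hf v (by omega) hw, tensorOpMap_id_ι F v (by omega)]
  rfl

/-- The bracket of two first order operators is first order, along the bracket of the fields. With
`1 ≤ j` and `i + j + 1 ≤ n`, the function `G` is of class `C^2` and the fields are differentiable.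
The hypothesis on `Id` identifies the field of the commutator. -/
theorem ActsAsVectorField.commutator_ι {F : V →L[ℝ] SteinSpace n U U} {f : U → W}
    {hf : ContDiff ℝ n f} {j : ℕ} (hj : 1 ≤ j) {b : TensorAlgebra ℝ V}
    (hb : b ∈ wordsOfLength V j)
    (hid : ActsAsVectorField F id contDiff_id j b) (h : ActsAsVectorField F f hf j b) (v : V) :
    ActsAsVectorField F f hf (j + 1) (TensorAlgebra.ι ℝ v * b - b * TensorAlgebra.ι ℝ v) := by
  intro i hi w hw x
  set G := tensorOpMap F f hf w with hG
  set B := tensorOpMap F id contDiff_id b with hB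
  have hGc : ContDiff ℝ 2 G :=
    (contDiff_tensorOpMap F f hf (by omega) hw).of_le (by
      have : 2 ≤ n - i := by omega
      exact_mod_cast this)
  have hG' : Differentiable ℝ (fderiv ℝ G) :=
    (hGc.fderiv_right (m := 1) (by norm_num)).differentiable (by norm_num)
  have hBd : Differentiable ℝ B := differentiable_tensorOpMap F id contDiff_id (by omega) hb
  have hFd : Differentiable ℝ (F v).1 := (F v).contDiff.differentiable (by
    have : n ≠ 0 := by omega
    exact_mod_cast this)
  have e1 : tensorOpMap F f hf (TensorAlgebra.ι ℝ v * (b * w)) x =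
      fderiv ℝ (fderiv ℝ G) x (F v x) (B x) + fderiv ℝ G x (fderiv ℝ B x (F v x)) := by
    rw [tensorOpMap_ι_mul F f hf v (k := j + i) (by omega) (mul_mem_wordsOfLength hb hw)]
    have h1 : tensorOpMap F f hf (b * w) = fun y => fderiv ℝ G y (B y) :=
      funext fun y => h i (by omega) w hw y
    have h2 := ((hG' x).hasFDerivAt.clm_apply (hBd x).hasFDerivAt).fderiv
    rw [h1, fieldOp, h2]
    simp [add_comm]
  have e2 : tensorOpMap F f hf (b * (TensorAlgebra.ι ℝ v * w)) x =
      fderiv ℝ (fderiv ℝ G) x (B x) (F v x) + fderiv ℝ G x (fderiv ℝ (F v).1 x (B x)) := by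
    rw [h (1 + i) (by omega) _ (mul_mem_wordsOfLength (ι_mem_wordsOfLength v) hw) x,
      tensorOpMap_ι_mul F f hf v (by omega) hw]
    have h2 := ((hG' x).hasFDerivAt.clm_apply (hFd x).hasFDerivAt).fderiv
    have h1 : fieldOp F v G = fun y => fderiv ℝ G y ((F v).1 y) := rfl
    rw [h1, h2]
    simp only [add_apply, ContinuousLinearMap.comp_apply,
      ContinuousLinearMap.flip_apply]
    exact add_comm _ _
  have e3 : tensorOpMap F id contDiff_id
      (TensorAlgebra.ι ℝ v * b - b * TensorAlgebra.ι ℝ v) x =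
      fderiv ℝ B x (F v x) - fderiv ℝ (F v).1 x (B x) := by
    have h1 := hid 1 (by omega) _ (ι_mem_wordsOfLength v) x
    rw [map_sub, Pi.sub_apply, h1, tensorOpMap_ι_mul F id contDiff_id v (by omega) hb,
      tensorOpMap_id_ι F v (by omega)]
    rfl
  -- The second order parts of the two products agree, and only first derivatives of `G` survive in
  -- the difference.
  have hsymm : fderiv ℝ (fderiv ℝ G) x (F v x) (B x) = fderiv ℝ (fderiv ℝ G) x (B x) (F v x) :=
    (hGc.contDiffAt.isSymmSndFDerivAt (by simp)) (F v x) (B x)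
  rw [sub_mul, mul_assoc, mul_assoc, map_sub, Pi.sub_apply, e1, e2, e3, hsymm, map_sub]
  abel

/-- Induction on the iterated bracket. The case `f = Id` is settled beforehand, because each step
for `f` uses it. -/
theorem actsAsVectorField_dynkin_tensorWord (F : V →L[ℝ] SteinSpace n U U) (f : U → W)
    (hf : ContDiff ℝ n f) (l : List V) (hl : l ≠ []) :
    ActsAsVectorField F f hf l.length (dynkin V (tensorWord l)) := by
  have step : ∀ (v w : V) (l : List V),
      ActsAsVectorField F id contDiff_id (w :: l).length (dynkin V (tensorWord (w :: l))) →
      ActsAsVectorField F f hf (w :: l).length (dynkin V (tensorWord (w :: l))) →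
      ActsAsVectorField F f hf (v :: w :: l).length (dynkin V (tensorWord (v :: w :: l))) := by
    intro v w l h1 h2
    rw [dynkin_tensorWord_cons_cons]
    exact ActsAsVectorField.commutator_ι (by simp) (dynkin_tensorWord_mem _) h1 h2 v
  have hid : ∀ l : List V, l ≠ [] →
      ActsAsVectorField F (id : U → U) contDiff_id l.length (dynkin V (tensorWord l)) := by
    intro l hl
    induction l with
    | nil => exact absurd rfl hl
    | cons v l ih =>
      rcases l with _ | ⟨w, l⟩
      · have := actsAsVectorField_ι F (id : U → U) contDiff_id v
        simpa [tensorWord, dynkin_ι] using this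
      · rw [dynkin_tensorWord_cons_cons]
        exact ActsAsVectorField.commutator_ι (by simp) (dynkin_tensorWord_mem _)
          (ih (by simp)) (ih (by simp)) v
  induction l with
  | nil => exact absurd rfl hl
  | cons v l ih =>
    rcases l with _ | ⟨w, l⟩
    · have := actsAsVectorField_ι F f hf v
      simpa [tensorWord, dynkin_ι] using this
    · exact step v w l (hid _ (by simp)) (ih (by simp))

/-- Such an element is `k⁻¹ D a`, a combination of iterated brackets of letters, and the property is
linear in `a`. -/
theorem actsAsVectorField_of_dynkin (F : V →L[ℝ] SteinSpace n U U) (f : U → W)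
    (hf : ContDiff ℝ n f) {k : ℕ} (hk : 1 ≤ k) {a : TensorAlgebra ℝ V}
    (ha : a ∈ wordsOfLength V k) (hd : (k : ℝ) • a = dynkin V a) :
    ActsAsVectorField F f hf k a := by
  have key : ActsAsVectorField F f hf k (dynkin V a) := by
    clear hd
    induction ha using Submodule.span_induction with
    | mem x hx =>
      obtain ⟨l, hl, rfl⟩ := hx
      have hl' : l.length = k := hl
      subst hl'
      exact actsAsVectorField_dynkin_tensorWord F f hf l (by rintro rfl; simp at hk)
    | zero =>
      intro i hi w hw x
      simp
    | add x y _ _ hx hy =>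
      intro i hi w hw z
      simp only [map_add, add_mul, Pi.add_apply]
      rw [hx i hi w hw z, hy i hi w hw z]
    | smul r x _ hx =>
      intro i hi w hw z
      simp only [map_smul, smul_mul_assoc, Pi.smul_apply]
      rw [hx i hi w hw z]
  have hk0 : (k : ℝ) ≠ 0 := by
    have : k ≠ 0 := by omega
    exact_mod_cast this
  intro i hi w hw x
  have h := key i hi w hw x
  rw [← hd] at h
  simp only [map_smul, smul_mul_assoc, Pi.smul_apply] at h
  exact smul_right_injective _ hk0 h

end VectorField


/-! ### The Taylor expansion along the flow -/

section Expansion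

variable {V U W : Type*} [NormedAddCommGroup V] [NormedSpace ℝ V]
  [NormedAddCommGroup U] [NormedSpace ℝ U] [NormedAddCommGroup W] [NormedSpace ℝ W] {n : ℕ}

theorem tensorOpMap_eq_zero (F : V →L[ℝ] SteinSpace n U U) (f : U → W) (hf : ContDiff ℝ n f)
    {a : TensorAlgebra ℝ V} (ha : a ∈ wordsOfLengthGE V (n + 1)) : tensorOpMap F f hf a = 0 := by
  rw [tensorOpMap_eq_sum]
  refine Finset.sum_eq_zero fun k hk => ?_
  rw [tensorProj_eq_zero_of_mem (Finset.mem_range.1 hk) ha, map_zero]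

theorem wordsOfLength_le {k m : ℕ} (h : m ≤ k) : wordsOfLength V k ≤ wordsOfLengthGE V m := by
  refine Submodule.span_mono (Set.image_mono fun l hl => ?_)
  have hl' : l.length = k := hl
  change m ≤ l.length
  omega

theorem tensorOpMap_mul_eq_sum (F : V →L[ℝ] SteinSpace n U U) (f : U → W) (hf : ContDiff ℝ n f)
    (a b : TensorAlgebra ℝ V) : tensorOpMap F f hf (a * b) =
      ∑ j ∈ Finset.range (n + 1), ∑ i ∈ Finset.range (n + 1),
        tensorOpMap F f hf (tensorProj V j a * tensorProj V i b) := by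
  induction a using tensorWord_induction with
  | hadd a a' ha ha' => simp only [add_mul, map_add, Finset.sum_add_distrib, ha, ha']
  | hsmul r a ha => simp only [smul_mul_assoc, map_smul, ← Finset.smul_sum, ha]
  | hword l =>
    induction b using tensorWord_induction with
    | hadd a a' ha ha' => simp only [mul_add, map_add, Finset.sum_add_distrib, ha, ha']
    | hsmul r a ha => simp only [mul_smul_comm, map_smul, ← Finset.smul_sum, ha]
    | hword l' =>
      simp only [tensorProj_tensorWord]
      by_cases h : l.length ≤ n ∧ l'.length ≤ n
      · rw [Finset.sum_eq_single l.length, Finset.sum_eq_single l'.length]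
        · simp
        · intro i _ hi
          simp [hi.symm]
        · intro h'
          exact absurd (Finset.mem_range.2 (Nat.lt_succ_of_le h.2)) h'
        · intro j _ hj
          simp [hj.symm]
        · intro h'
          exact absurd (Finset.mem_range.2 (Nat.lt_succ_of_le h.1)) h'
      · rw [← tensorWord_append, tensorOpMap_tensorWord, List.length_append,
          if_neg (by omega)]
        refine (Finset.sum_eq_zero fun j hj => Finset.sum_eq_zero fun i hi => ?_).symm
        have := Finset.mem_range.1 hi
        have := Finset.mem_range.1 hj
        by_cases h1 : l.length = j
        · rw [if_neg (c := l'.length = i) (by omega), mul_zero, map_zero]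
        · rw [if_neg h1, zero_mul, map_zero]

/-- The homogeneous components of `a` of degree `i ≤ n` are bounded by `c h^i`. -/
def HasWeight (q : TensorNorm V n) (h c : ℝ) (a : TensorAlgebra ℝ V) : Prop :=
  ∀ i ≤ n, q.toSeminorm (tensorProj V i a) ≤ c * h ^ i

/-- One differentiation along the curve, at the point `y` with velocity `z`, replaces `a` by `L a`.
On both sides the degree `n` component is evaluated at the fixed point `x₀`, since it is only
Lipschitz; its derivative does not appear on the left. It is used with `a = L^k`. -/
theorem taylor_step {q : TensorNorm V n} (F : V →L[ℝ] SteinSpace n U U) {C₀ : ℝ} (hC₀ : 0 ≤ C₀)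
    (hC : ∀ k ≤ n, ∀ (a : TensorAlgebra ℝ V),
      (∀ (f : U → W) (hf : ContDiff ℝ n f) (M : ℝ), IsSteinLip n M f → IsSteinLip (n - k)
        (C₀ * q.toSeminorm (tensorProj V k a) * M) (tensorOpMap F f hf (tensorProj V k a))) ∧
      (1 ≤ k → IsSteinLip 0 (C₀ * q.toSeminorm (tensorProj V k a))
        (tensorOpMap F id contDiff_id (tensorProj V k a))))
    {f : U → W} {hf : ContDiff ℝ n f} {M : ℝ} (hM : IsSteinLip n M f)
    {h B δ : ℝ} (hh : 0 ≤ h) (hh1 : h ≤ 1) (hB : 0 ≤ B) {L a : TensorAlgebra ℝ V}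
    (hL0 : tensorProj V 0 L = 0)
    (hL : ∀ j, 1 ≤ j → j ≤ n → ActsAsVectorField F f hf j (tensorProj V j L))
    (hLw : HasWeight q h B L) (haw : HasWeight q h B a) (hLaw : HasWeight q h B (L * a))
    (x₀ y z : U) (hz : ‖z - tensorOpMap F id contDiff_id L y‖ ≤ δ) :
    ‖fderiv ℝ (∑ i ∈ Finset.range n, tensorOpMap F f hf (tensorProj V i a)) y z
      - ((∑ i ∈ Finset.range n, tensorOpMap F f hf (tensorProj V i (L * a))) y
        + tensorOpMap F f hf (tensorProj V n (L * a)) x₀)‖ ≤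
      M * ((n * (n + 1)) * (C₀ * B) ^ 2 * h ^ (n + 1) + n * (C₀ * B) * δ
        + C₀ * B * h ^ n * ‖y - x₀‖) := by
  have hM0 := hM.nonneg
  have hδ : 0 ≤ δ := (norm_nonneg _).trans hz
  set A := tensorOpMap F id contDiff_id L y with hA
  have hg : ∀ i < n, IsSteinLip (n - i) (C₀ * B * h ^ i * M)
      (tensorOpMap F f hf (tensorProj V i a)) := fun i hi =>
    ((hC i hi.le a).1 f hf M hM).mono (by
      have := haw i hi.le
      rw [mul_assoc C₀ B]
      gcongr)
  have hgd : ∀ i < n, ∀ x, ‖fderiv ℝ (tensorOpMap F f hf (tensorProj V i a)) x‖ ≤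
      C₀ * B * h ^ i * M := by
    intro i hi x
    have h1 := hg i hi
    obtain ⟨m, hm⟩ : ∃ m, n - i = m + 1 := ⟨n - i - 1, by omega⟩
    rw [hm] at h1
    exact h1.norm_fderiv_le x
  have hdiff : ∀ i < n, Differentiable ℝ (tensorOpMap F f hf (tensorProj V i a)) := fun i hi =>
    differentiable_tensorOpMap F f hf hi (tensorProj_mem_wordsOfLength i a)
  have hfd : ∀ w, fderiv ℝ (∑ i ∈ Finset.range n, tensorOpMap F f hf (tensorProj V i a)) y w =
      ∑ i ∈ Finset.range n, fderiv ℝ (tensorOpMap F f hf (tensorProj V i a)) y w := by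
    intro w
    rw [fderiv_sum fun i hi => hdiff i (Finset.mem_range.1 hi) y, sum_apply]
  have hj : ∀ j, 1 ≤ j → j ≤ n →
      ‖tensorOpMap F id contDiff_id (tensorProj V j L) y‖ ≤ C₀ * B * h ^ j := by
    intro j hj1 hjn
    refine (((hC j hjn L).2 hj1).norm_le y).trans ?_
    rw [mul_assoc C₀ B]
    exact mul_le_mul_of_nonneg_left (hLw j hjn) hC₀
  have hAsum : A = ∑ j ∈ Finset.range (n + 1), tensorOpMap F id contDiff_id (tensorProj V j L) y := by
    rw [hA, tensorOpMap_eq_sum, Finset.sum_apply]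
  have hS : tensorOpMap F f hf (L * a) y =
      ∑ j ∈ Finset.range (n + 1), ∑ i ∈ Finset.range n,
        tensorOpMap F f hf (tensorProj V j L * tensorProj V i a) y := by
    rw [tensorOpMap_mul_eq_sum, Finset.sum_apply]
    refine Finset.sum_congr rfl fun j _ => ?_
    rw [Finset.sum_apply, Finset.sum_range_succ]
    have : tensorOpMap F f hf (tensorProj V j L * tensorProj V n a) = 0 := by
      rcases j with _ | j
      · rw [hL0, zero_mul, map_zero]
      · exact tensorOpMap_eq_zero F f hf (wordsOfLength_le (by omega)
          (mul_mem_wordsOfLength (tensorProj_mem_wordsOfLength (j + 1) L)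
            (tensorProj_mem_wordsOfLength n a)))
    rw [this]
    simp
  -- For `i + j ≤ n` the two terms are equal, by the vector field property. For `i + j > n` the
  -- operator term vanishes by truncation, and the derivative is of size `h^(i+j) ≤ h^(n+1)` as `h ≤
  -- 1`.
  have hts : ∀ j ≤ n, ∀ i < n,
      ‖fderiv ℝ (tensorOpMap F f hf (tensorProj V i a)) y
          (tensorOpMap F id contDiff_id (tensorProj V j L) y)
        - tensorOpMap F f hf (tensorProj V j L * tensorProj V i a) y‖ ≤
      M * ((C₀ * B) ^ 2 * h ^ (n + 1)) := by
    intro j hjn i hin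
    have hpos : 0 ≤ M * ((C₀ * B) ^ 2 * h ^ (n + 1)) := by positivity
    rcases Nat.eq_zero_or_pos j with rfl | hj0
    · rw [hL0]
      simpa using hpos
    · by_cases hij : i + j ≤ n
      · rw [hL j hj0 hjn i hij _ (tensorProj_mem_wordsOfLength i a) y, sub_self, norm_zero]
        exact hpos
      · rw [tensorOpMap_eq_zero F f hf (wordsOfLength_le (by omega)
          (mul_mem_wordsOfLength (tensorProj_mem_wordsOfLength j L)
            (tensorProj_mem_wordsOfLength i a))), Pi.zero_apply, sub_zero]
        refine (ContinuousLinearMap.le_opNorm _ _).trans ?_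
        have h2 : h ^ (i + j) ≤ h ^ (n + 1) := pow_le_pow_of_le_one hh hh1 (by omega)
        calc _ ≤ (C₀ * B * h ^ i * M) * (C₀ * B * h ^ j) :=
              mul_le_mul (hgd i hin y) (hj j hj0 hjn) (norm_nonneg _) (by positivity)
          _ = M * ((C₀ * B) ^ 2 * h ^ (i + j)) := by rw [pow_add]; ring
          _ ≤ _ := by gcongr
  -- Three errors: the products of degree above `n`, the defect `z - A` of the velocity, and the
  -- freezing of the degree `n` component at `x₀`.
  have hsplit : fderiv ℝ (∑ i ∈ Finset.range n, tensorOpMap F f hf (tensorProj V i a)) y z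
      - ((∑ i ∈ Finset.range n, tensorOpMap F f hf (tensorProj V i (L * a))) y
        + tensorOpMap F f hf (tensorProj V n (L * a)) x₀) =
      (∑ j ∈ Finset.range (n + 1), ∑ i ∈ Finset.range n,
        (fderiv ℝ (tensorOpMap F f hf (tensorProj V i a)) y
          (tensorOpMap F id contDiff_id (tensorProj V j L) y)
        - tensorOpMap F f hf (tensorProj V j L * tensorProj V i a) y))
      + ∑ i ∈ Finset.range n, fderiv ℝ (tensorOpMap F f hf (tensorProj V i a)) y (z - A)
      + (tensorOpMap F f hf (tensorProj V n (L * a)) y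
        - tensorOpMap F f hf (tensorProj V n (L * a)) x₀) := by
    have e1 : (∑ i ∈ Finset.range n, tensorOpMap F f hf (tensorProj V i (L * a))) y =
        tensorOpMap F f hf (L * a) y - tensorOpMap F f hf (tensorProj V n (L * a)) y := by
      rw [tensorOpMap_eq_sum F f hf (L * a), Finset.sum_range_succ, Pi.add_apply,
        add_sub_cancel_right]
    have e2 : ∑ j ∈ Finset.range (n + 1), ∑ i ∈ Finset.range n,
        fderiv ℝ (tensorOpMap F f hf (tensorProj V i a)) y
          (tensorOpMap F id contDiff_id (tensorProj V j L) y) =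
        ∑ i ∈ Finset.range n, fderiv ℝ (tensorOpMap F f hf (tensorProj V i a)) y A := by
      rw [Finset.sum_comm]
      refine Finset.sum_congr rfl fun i _ => ?_
      rw [hAsum, map_sum]
    simp only [Finset.sum_sub_distrib, map_sub]
    rw [hfd, e1, hS, e2]
    abel
  have b1 : ‖∑ j ∈ Finset.range (n + 1), ∑ i ∈ Finset.range n,
        (fderiv ℝ (tensorOpMap F f hf (tensorProj V i a)) y
          (tensorOpMap F id contDiff_id (tensorProj V j L) y)
        - tensorOpMap F f hf (tensorProj V j L * tensorProj V i a) y)‖ ≤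
      M * ((n * (n + 1)) * (C₀ * B) ^ 2 * h ^ (n + 1)) := by
    refine (norm_sum_le_of_le _ fun j hj' => norm_sum_le_of_le _ fun i hi =>
      hts j (Nat.lt_succ_iff.1 (Finset.mem_range.1 hj')) i (Finset.mem_range.1 hi)).trans ?_
    simp only [Finset.sum_const, Finset.card_range, nsmul_eq_mul]
    push_cast
    exact le_of_eq (by ring)
  have b2 : ‖∑ i ∈ Finset.range n, fderiv ℝ (tensorOpMap F f hf (tensorProj V i a)) y (z - A)‖ ≤
      M * (n * (C₀ * B) * δ) := by
    have : ∀ i ∈ Finset.range n,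
        ‖fderiv ℝ (tensorOpMap F f hf (tensorProj V i a)) y (z - A)‖ ≤ C₀ * B * M * δ := by
      intro i hi
      refine (ContinuousLinearMap.le_opNorm _ _).trans ?_
      refine mul_le_mul ((hgd i (Finset.mem_range.1 hi) y).trans ?_) hz (norm_nonneg _)
        (by positivity)
      have : h ^ i ≤ 1 := pow_le_one₀ hh hh1
      calc C₀ * B * h ^ i * M ≤ C₀ * B * 1 * M := by gcongr
        _ = _ := by ring
    refine (norm_sum_le_of_le _ this).trans ?_
    simp only [Finset.sum_const, Finset.card_range, nsmul_eq_mul]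
    exact le_of_eq (by ring)
  have b3 : ‖tensorOpMap F f hf (tensorProj V n (L * a)) y
        - tensorOpMap F f hf (tensorProj V n (L * a)) x₀‖ ≤
      M * (C₀ * B * h ^ n * ‖y - x₀‖) := by
    refine (((hC n le_rfl (L * a)).1 f hf M hM).norm_sub_le y x₀).trans ?_
    have := hLaw n le_rfl
    calc C₀ * q.toSeminorm (tensorProj V n (L * a)) * M * ‖y - x₀‖
        ≤ C₀ * (B * h ^ n) * M * ‖y - x₀‖ := by gcongr
      _ = _ := by ring
  rw [hsplit]
  refine (norm_add₃_le).trans ((add_le_add (add_le_add b1 b2) b3).trans (le_of_eq (by ring)))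

theorem hasDerivAt_taylorCoeff (k : ℕ) (u : ℝ) :
    HasDerivAt (fun u : ℝ => (1 - u) ^ k / (k.factorial : ℝ))
      (-(k * (1 - u) ^ (k - 1)) / (k.factorial : ℝ)) u := by
  have h := (((hasDerivAt_id u).const_sub 1).pow k).div_const (k.factorial : ℝ)
  refine h.congr_deriv ?_
  simp

/-- The Taylor expansion of `f` along an approximate solution of `ẏ = F^⊗(L) Id (y)`. -/
theorem taylor_expansion (q : TensorNorm V n) (hn : 1 ≤ n) (F : V →L[ℝ] SteinSpace n U U) (B : ℝ)
    (hB : 0 ≤ B) :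
    ∃ C : ℝ, 0 ≤ C ∧ ∀ (f : U → W) (hf : ContDiff ℝ n f) (M : ℝ), IsSteinLip n M f →
      ∀ (L : TensorAlgebra ℝ V) (h δ : ℝ), 0 ≤ h → h ≤ 1 → tensorProj V 0 L = 0 →
      (∀ j, 1 ≤ j → j ≤ n → ActsAsVectorField F f hf j (tensorProj V j L)) →
      (∀ k ≤ n + 1, HasWeight q h B (L ^ k)) →
      ∀ y z : ℝ → U,
        (∀ u ∈ Set.Icc (0 : ℝ) 1, HasDerivWithinAt y (z u) (Set.Icc 0 1) u) →
        (∀ u ∈ Set.Icc (0 : ℝ) 1, ‖z u - tensorOpMap F id contDiff_id L (y u)‖ ≤ δ) →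
        ‖f (y 1) - tensorOpMap F f hf (expTrunc n L) (y 0)‖ ≤ C * M * (h ^ (n + 1) + δ) := by
  obtain ⟨C₀, hC₀, hC⟩ := exists_isSteinLip_tensorOpMap (W := W) q F
  set K := C₀ * B with hK
  have hK0 : 0 ≤ K := by positivity
  refine ⟨(n + 1) * ((n * (n + 2)) * K ^ 2 + (n + 1) * K), by positivity, ?_⟩
  intro f hf M hM L h δ hh hh1 hL0 hL hLw y z hy hz
  have hM0 := hM.nonneg
  have hδ : 0 ≤ δ := (norm_nonneg _).trans (hz 0 (by simp))
  have hL1 : HasWeight q h B L := by simpa using hLw 1 (by omega)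
  have hLaug : TensorAlgebra.algebraMapInv L = (0 : ℝ) := by
    rw [tensorProj_zero_eq] at hL0
    exact (TensorAlgebra.algebraMap_eq_zero_iff V _).1 hL0
  -- `L` has no component of degree `0`, so the field has size `h`, and `y` stays at distance of
  -- order `h + δ` from `y 0`. This makes the freezing error of order `h^(n+1)`.
  have hzb : ∀ u ∈ Set.Icc (0 : ℝ) 1, ‖z u‖ ≤ n * K * h + δ := by
    intro u hu
    have h1 : ‖tensorOpMap F id contDiff_id L (y u)‖ ≤ n * K * h := by
      rw [tensorOpMap_eq_sum, Finset.sum_apply, Finset.sum_range_succ', hL0, map_zero,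
        Pi.zero_apply, add_zero]
      have : ∀ k ∈ Finset.range n,
          ‖tensorOpMap F id contDiff_id (tensorProj V (k + 1) L) (y u)‖ ≤ K * h := by
        intro k hk
        have hk' := Finset.mem_range.1 hk
        refine (((hC (k + 1) (by omega) L).2 (by omega)).norm_le _).trans ?_
        rw [hK, mul_assoc]
        refine mul_le_mul_of_nonneg_left ((hL1 (k + 1) (by omega)).trans ?_) hC₀
        refine mul_le_mul_of_nonneg_left ?_ hB
        exact pow_le_of_le_one hh hh1 (by omega)
      refine (norm_sum_le_of_le _ this).trans ?_
      simp only [Finset.sum_const, Finset.card_range, nsmul_eq_mul]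
      exact le_of_eq (by ring)
    have h2 := norm_add_le (z u - tensorOpMap F id contDiff_id L (y u))
      (tensorOpMap F id contDiff_id L (y u))
    rw [sub_add_cancel] at h2
    linarith [hz u hu]
  have hyb : ∀ u ∈ Set.Icc (0 : ℝ) 1, ‖y u - y 0‖ ≤ n * K * h + δ := by
    intro u hu
    have := norm_image_sub_le_of_norm_deriv_le_segment' hy
      (fun x hx => hzb x (Set.Ico_subset_Icc_self hx)) u hu
    refine this.trans ?_
    have h0 : 0 ≤ n * K * h + δ := by positivity
    calc _ ≤ (n * K * h + δ) * 1 := mul_le_mul_of_nonneg_left (by linarith [hu.2]) h0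
      _ = _ := mul_one _
  -- `G k` collects the degrees below `n`, which give differentiable functions; `r k` is the degree
  -- `n` part frozen at `y 0`.
  let G : ℕ → U → W := fun k => ∑ i ∈ Finset.range n, tensorOpMap F f hf (tensorProj V i (L ^ k))
  let r : ℕ → W := fun k => tensorOpMap F f hf (tensorProj V n (L ^ k)) (y 0)
  have hGd : ∀ k, Differentiable ℝ (G k) := fun k =>
    Differentiable.sum fun i hi => differentiable_tensorOpMap F f hf (Finset.mem_range.1 hi)
      (tensorProj_mem_wordsOfLength i _)
  -- Taylor interpolation between `ψ 0`, the exponential series at `y 0`, and `ψ 1 = f (y 1)`. In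
  -- its derivative the terms telescope and only the errors of `taylor_step` remain.
  let ψ : ℝ → W := fun u =>
    ∑ k ∈ Finset.range (n + 1), ((1 - u) ^ k / (k.factorial : ℝ)) • (G k (y u) + r k)
  let ψ' : ℝ → W := fun u => ∑ k ∈ Finset.range (n + 1),
    ((1 - u) ^ k / (k.factorial : ℝ)) • (fderiv ℝ (G k) (y u) (z u) - (G (k + 1) (y u) + r (k + 1)))
  -- The telescoping stops here: `L^(n+1)` has no component of degree at most `n`.
  have hlast : ∀ x, G (n + 1) x + r (n + 1) = 0 := by
    intro x
    have h0 : ∀ i ≤ n, tensorOpMap F f hf (tensorProj V i (L ^ (n + 1))) = 0 := by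
      intro i hi
      rw [tensorProj_eq_zero_of_mem (Nat.lt_succ_of_le hi) (pow_mem_wordsOfLengthGE hLaug _),
        map_zero]
    have h1 : G (n + 1) = 0 := Finset.sum_eq_zero fun i hi => h0 i (Finset.mem_range.1 hi).le
    have h2 : r (n + 1) = 0 := by
      simp only [r]
      rw [h0 n le_rfl]
      rfl
    rw [h1, h2]
    simp
  have hψ : ∀ u ∈ Set.Icc (0 : ℝ) 1, HasDerivWithinAt ψ (ψ' u) (Set.Icc 0 1) u := by
    intro u hu
    have hterm : ∀ k ∈ Finset.range (n + 1), HasDerivWithinAt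
        (fun u => ((1 - u) ^ k / (k.factorial : ℝ)) • (G k (y u) + r k))
        (((1 - u) ^ k / (k.factorial : ℝ)) • (fderiv ℝ (G k) (y u) (z u)) +
          (-(k * (1 - u) ^ (k - 1)) / (k.factorial : ℝ)) • (G k (y u) + r k))
        (Set.Icc 0 1) u := by
      intro k _
      exact (hasDerivAt_taylorCoeff k u).hasDerivWithinAt.smul
        (((hGd k (y u)).hasFDerivAt.comp_hasDerivWithinAt u (hy u hu)).add_const (r k))
    have hs := HasDerivWithinAt.fun_sum hterm
    refine hs.congr_deriv ?_
    simp only [ψ', smul_sub, Finset.sum_add_distrib, Finset.sum_sub_distrib]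
    have e : ∑ k ∈ Finset.range (n + 1),
        (-(k * (1 - u) ^ (k - 1)) / (k.factorial : ℝ)) • (G k (y u) + r k) =
        -∑ k ∈ Finset.range (n + 1),
          ((1 - u) ^ k / (k.factorial : ℝ)) • (G (k + 1) (y u) + r (k + 1)) := by
      rw [Finset.sum_range_succ', Finset.sum_range_succ _ n, hlast, smul_zero, add_zero,
        ← Finset.sum_neg_distrib]
      simp only [Nat.cast_zero, zero_mul, neg_zero, zero_div, zero_smul, add_zero,
        Nat.add_sub_cancel]
      refine Finset.sum_congr rfl fun k _ => ?_
      rw [← neg_smul, Nat.factorial_succ]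
      congr 1
      push_cast
      have h1 : (k : ℝ) + 1 ≠ 0 := by positivity
      have h2 : (k.factorial : ℝ) ≠ 0 := by positivity
      field_simp
    rw [e]
    exact (sub_eq_add_neg _ _).symm
  have hbound : ∀ u ∈ Set.Ico (0 : ℝ) 1, ‖ψ' u‖ ≤
      (n + 1) * ((n * (n + 2)) * K ^ 2 + (n + 1) * K) * M * (h ^ (n + 1) + δ) := by
    intro u hu
    have hu' := Set.Ico_subset_Icc_self hu
    have hterm : ∀ k ∈ Finset.range (n + 1), ‖((1 - u) ^ k / (k.factorial : ℝ)) •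
        (fderiv ℝ (G k) (y u) (z u) - (G (k + 1) (y u) + r (k + 1)))‖ ≤
        ((n * (n + 2)) * K ^ 2 + (n + 1) * K) * M * (h ^ (n + 1) + δ) := by
      intro k hk
      have hk' := Finset.mem_range.1 hk
      have hstep := taylor_step F hC₀ hC (hf := hf) hM hh hh1 hB hL0 hL hL1
        (hLw k (by omega)) (by rw [← pow_succ']; exact hLw (k + 1) (by omega)) (y 0) (y u) (z u)
        (hz u hu')
      rw [← pow_succ'] at hstep
      have hc1 : ‖(1 - u) ^ k / (k.factorial : ℝ)‖ ≤ 1 := by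
        have hf1 : (1 : ℝ) ≤ k.factorial := by exact_mod_cast k.factorial_pos
        rw [norm_div, norm_pow, Real.norm_eq_abs, Real.norm_eq_abs, abs_of_nonneg (by linarith [hu.2]),
          abs_of_nonneg (by linarith)]
        exact (div_le_one (by linarith)).2
          ((pow_le_one₀ (by linarith [hu.2]) (by linarith [hu.1])).trans hf1)
      rw [norm_smul]
      refine (mul_le_mul hc1 hstep (norm_nonneg _) zero_le_one).trans ?_
      rw [one_mul]
      have hy1 := hyb u hu'
      have hhn : h ^ n ≤ 1 := pow_le_one₀ hh hh1
      have e1 : K * h ^ n * ‖y u - y 0‖ ≤ n * K ^ 2 * h ^ (n + 1) + K * δ := by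
        calc K * h ^ n * ‖y u - y 0‖ ≤ K * h ^ n * (n * K * h + δ) := by gcongr
          _ = n * K ^ 2 * h ^ (n + 1) + K * h ^ n * δ := by rw [pow_succ]; ring
          _ ≤ n * K ^ 2 * h ^ (n + 1) + K * 1 * δ := by gcongr
          _ = _ := by ring
      have h1 : 0 ≤ h ^ (n + 1) := by positivity
      calc M * ((n * (n + 1)) * K ^ 2 * h ^ (n + 1) + n * K * δ + K * h ^ n * ‖y u - y 0‖)
          ≤ M * ((n * (n + 1)) * K ^ 2 * h ^ (n + 1) + n * K * δ
            + (n * K ^ 2 * h ^ (n + 1) + K * δ)) := by gcongr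
        _ = M * ((n * (n + 2)) * K ^ 2 * h ^ (n + 1) + (n + 1) * K * δ) := by ring
        _ ≤ M * (((n * (n + 2)) * K ^ 2 * h ^ (n + 1) + (n + 1) * K * δ)
            + ((n * (n + 2)) * K ^ 2 * δ + (n + 1) * K * h ^ (n + 1))) := by
            refine mul_le_mul_of_nonneg_left (le_add_of_nonneg_right ?_) hM0
            positivity
        _ = _ := by ring
    refine (norm_sum_le_of_le _ hterm).trans ?_
    simp only [Finset.sum_const, Finset.card_range, nsmul_eq_mul]
    push_cast
    exact le_of_eq (by ring)
  have hfinal := norm_image_sub_le_of_norm_deriv_le_segment_01' hψ hbound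
  have e1 : ψ 1 = f (y 1) := by
    simp only [ψ]
    rw [Finset.sum_range_succ', Finset.sum_eq_zero]
    · have h0 : ∀ k, tensorProj V k (1 : TensorAlgebra ℝ V) = if 0 = k then 1 else 0 := by
        intro k
        simpa using tensorProj_tensorWord k ([] : List V)
      simp only [G, r, pow_zero, h0, Finset.sum_apply]
      rw [Finset.sum_eq_single 0]
      -- As `n ≥ 1`, the unit has no degree `n` component, so `r 0 = 0` and `f` itself is not
      -- frozen.
      · have : ¬ (0 = n) := by omega
        simp [this, tensorOpMap_one]
      · intro i _ hi
        simp [hi.symm]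
      · intro h'
        exact absurd (Finset.mem_range.2 (by omega)) h'
    · intro k _
      simp
  have e0 : ψ 0 = tensorOpMap F f hf (expTrunc n L) (y 0) := by
    simp only [ψ, expTrunc, map_sum, map_smul, Finset.sum_apply, Pi.smul_apply]
    refine Finset.sum_congr rfl fun k _ => ?_
    rw [tensorOpMap_eq_sum F f hf (L ^ k), Finset.sum_range_succ]
    simp [G, r]
  rw [e1, e0] at hfinal
  exact hfinal

end Expansion


/-! ### The estimate for the products of exponentials of Lie elements -/

section Weights

variable {V : Type*} [NormedAddCommGroup V] [NormedSpace ℝ V] {n : ℕ} {q : TensorNorm V n}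

theorem HasWeight.mono {h c c' : ℝ} {a : TensorAlgebra ℝ V} (ha : HasWeight q h c a) (hh : 0 ≤ h)
    (hc : c ≤ c') : HasWeight q h c' a :=
  fun i hi => (ha i hi).trans (mul_le_mul_of_nonneg_right hc (pow_nonneg hh i))

theorem HasWeight.smul {h c : ℝ} {a : TensorAlgebra ℝ V} (ha : HasWeight q h c a) (r : ℝ) :
    HasWeight q h (|r| * c) (r • a) := by
  intro i hi
  rw [map_smul, map_smul_eq_mul, mul_assoc, Real.norm_eq_abs]
  exact mul_le_mul_of_nonneg_left (ha i hi) (abs_nonneg r)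

theorem HasWeight.sum {ι : Type*} {s : Finset ι} {h : ℝ} {c : ι → ℝ} {a : ι → TensorAlgebra ℝ V}
    (ha : ∀ j ∈ s, HasWeight q h (c j) (a j)) : HasWeight q h (∑ j ∈ s, c j) (∑ j ∈ s, a j) := by
  intro i hi
  rw [map_sum, Finset.sum_mul]
  exact (Finset.le_sum_of_subadditive q.toSeminorm (map_zero _).le (map_add_le_add _) s _).trans (Finset.sum_le_sum fun j hj => ha j hj i hi)

/-- In degree `m ≤ n` there are `m + 1 ≤ n + 1` pairs of degrees to sum over. -/
theorem HasWeight.mul {h c c' : ℝ} (hh : 0 ≤ h) (hc : 0 ≤ c) (hc' : 0 ≤ c')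
    {a b : TensorAlgebra ℝ V} (ha : HasWeight q h c a) (hb : HasWeight q h c' b) :
    HasWeight q h ((n + 1) * (c * c')) (a * b) := by
  intro m hm
  rw [tensorProj_mul]
  have h1 : ∀ ij ∈ Finset.HasAntidiagonal.antidiagonal m,
      q.toSeminorm (tensorProj V ij.1 a * tensorProj V ij.2 b) ≤ c * c' * h ^ m := by
    rintro ⟨i, j⟩ hij
    have e : i + j = m := Finset.HasAntidiagonal.mem_antidiagonal.1 hij
    refine (q.map_mul_le _ _).trans ((mul_le_mul (ha i (by omega)) (hb j (by omega))
      (apply_nonneg _ _) (by positivity)).trans (le_of_eq ?_))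
    rw [← e, pow_add]
    ring
  refine (Finset.le_sum_of_subadditive q.toSeminorm (map_zero _).le
    (map_add_le_add _) _ _).trans ((Finset.sum_le_sum h1).trans ?_)
  rw [Finset.sum_const, Finset.Nat.card_antidiagonal, nsmul_eq_mul, mul_assoc]
  have h2 : ((m + 1 : ℕ) : ℝ) ≤ (n : ℝ) + 1 := by exact_mod_cast Nat.succ_le_succ hm
  rw [mul_assoc, ← mul_assoc c]
  exact mul_le_mul_of_nonneg_right h2 (by positivity)

theorem tensorProj_one (k : ℕ) : tensorProj V k 1 = if 0 = k then 1 else 0 := by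
  simpa using tensorProj_tensorWord k ([] : List V)

theorem hasWeight_one {h : ℝ} (hh : 0 ≤ h) : HasWeight q h (q.toSeminorm 1) 1 := by
  intro i hi
  have h0 : 0 ≤ q.toSeminorm 1 := apply_nonneg _ _
  rw [tensorProj_one]
  split_ifs with h'
  · subst h'
    simp
  · rw [map_zero]
    positivity

theorem HasWeight.pow {h c : ℝ} (hh : 0 ≤ h) (hc : 0 ≤ c) {a : TensorAlgebra ℝ V}
    (ha : HasWeight q h c a) (k : ℕ) :
    HasWeight q h (q.toSeminorm 1 * ((n + 1) * c) ^ k) (a ^ k) := by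
  have h0 : 0 ≤ q.toSeminorm 1 := apply_nonneg _ _
  induction k with
  | zero => simpa using hasWeight_one hh
  | succ k ih =>
    rw [pow_succ a]
    refine (HasWeight.mul hh (by positivity) hc ih ha).mono hh (le_of_eq ?_)
    ring

/-- The logarithm and its powers are polynomials in `x - 1`, and weights behave well under sums and
products. Hence `B` does not depend on `h` or `x`. -/
theorem exists_hasWeight_logTrunc_pow (q : TensorNorm V n) : ∃ B : ℝ, 0 ≤ B ∧
    ∀ (x : TensorAlgebra ℝ V) (h : ℝ), 0 ≤ h → tensorProj V 0 x = 1 →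
      (∀ i, 1 ≤ i → i ≤ n → q.toSeminorm (tensorProj V i x) ≤ h ^ i) →
      ∀ k ≤ n + 1, HasWeight q h B (logTrunc n x ^ k) := by
  have h0 : 0 ≤ q.toSeminorm 1 := apply_nonneg _ _
  set BL : ℝ := ∑ k ∈ Finset.Icc 1 n,
    |((-1 : ℝ) ^ (k + 1) / (k : ℝ))| * (q.toSeminorm 1 * ((n + 1) * 1) ^ k) with hBL
  have hBL0 : 0 ≤ BL := Finset.sum_nonneg fun k _ => by positivity
  refine ⟨∑ k ∈ Finset.range (n + 2), q.toSeminorm 1 * ((n + 1) * BL) ^ k,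
    Finset.sum_nonneg fun k _ => by positivity, fun x h hh hx0 hx k hk => ?_⟩
  have hx1 : HasWeight q h 1 (x - 1) := by
    intro i hi
    rw [map_sub, tensorProj_one]
    split_ifs with h'
    · subst h'
      rw [hx0, sub_self, map_zero]
      positivity
    · rw [sub_zero, one_mul]
      exact hx i (by omega) hi
  have hlog : HasWeight q h BL (logTrunc n x) :=
    HasWeight.sum fun k _ => (hx1.pow hh zero_le_one k).smul _
  refine (hlog.pow hh hBL0 k).mono hh ?_
  exact Finset.single_le_sum (f := fun k => q.toSeminorm 1 * ((n + 1) * BL) ^ k)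
    (fun i _ => by positivity) (Finset.mem_range.2 (by omega))

end Weights

/-! ### Abelianization of Lie elements and the degree one component. -/

section LieLike

open Polynomial

variable {V : Type*} [NormedAddCommGroup V] [NormedSpace ℝ V] {n : ℕ}

/-- The morphism to a commutative algebra given by `v ↦ φ(v) X`. -/
def tensorPoly (φ : V →ₗ[ℝ] ℝ) : TensorAlgebra ℝ V →ₐ[ℝ] ℝ[X] :=
  TensorAlgebra.lift ℝ (φ.smulRight (X : ℝ[X]))

theorem tensorPoly_ι (φ : V →ₗ[ℝ] ℝ) (v : V) :
    tensorPoly φ (TensorAlgebra.ι ℝ v) = φ v • (X : ℝ[X]) := by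
  simp [tensorPoly]

theorem tensorPoly_tensorWord (φ : V →ₗ[ℝ] ℝ) (l : List V) :
    tensorPoly φ (tensorWord l) = (l.map φ).prod • (X : ℝ[X]) ^ l.length := by
  induction l with
  | nil => simp
  | cons v l ih =>
    rw [tensorWord_cons, map_mul, ih, tensorPoly_ι, List.map_cons, List.prod_cons,
      List.length_cons, pow_succ', smul_mul_smul_comm]

theorem coeff_tensorPoly (φ : V →ₗ[ℝ] ℝ) (k : ℕ) (a : TensorAlgebra ℝ V) :
    (tensorPoly φ a).coeff k = (tensorPoly φ (tensorProj V k a)).coeff k := by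
  induction a using tensorWord_induction with
  | hadd a b ha hb => simp only [map_add, coeff_add, ha, hb]
  | hsmul r a ha => simp only [map_smul, coeff_smul, ha]
  | hword l =>
    rw [tensorProj_tensorWord]
    split_ifs with h
    · rfl
    · rw [tensorPoly_tensorWord]
      simp [coeff_X_pow, Ne.symm h]

/-- On degree `k` the coefficient is induced by the form `∏ φ(v_i)`, of norm at most one, hence is
bounded by the projective norm. -/
theorem abs_coeff_tensorPoly_le (φ : V →L[ℝ] ℝ) (hφ : ‖φ‖ ≤ 1) (k : ℕ) (a : TensorAlgebra ℝ V) :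
    |(tensorPoly (φ : V →ₗ[ℝ] ℝ) a).coeff k| ≤ ‖tensorComponent V k a‖ := by
  let g : TensorAlgebra ℝ V →ₗ[ℝ] ℝ :=
    (lcoeff ℝ k).comp (tensorPoly (φ : V →ₗ[ℝ] ℝ)).toLinearMap
  let B : MultilinearMap ℝ (fun _ : Fin k => V) ℝ := g.compMultilinearMap (TensorAlgebra.tprod ℝ V k)
  have hB : ∀ m, ‖B m‖ ≤ 1 * ∏ i, ‖m i‖ := by
    intro m
    have e : B m = ∏ i, φ (m i) := by
      have h1 : TensorAlgebra.tprod ℝ V k m = tensorWord (List.ofFn m) := by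
        rw [tensorWord_ofFn, TensorPower.toTensorAlgebra_tprod]
      simp only [B, g, LinearMap.compMultilinearMap_apply, LinearMap.comp_apply,
        AlgHom.toLinearMap_apply, lcoeff_apply]
      rw [h1, tensorPoly_tensorWord, List.length_ofFn, List.map_ofFn, List.prod_ofFn]
      simp
    rw [e, norm_prod, one_mul]
    refine Finset.prod_le_prod (fun _ _ => norm_nonneg _) fun i _ => ?_
    exact (φ.le_of_opNorm_le hφ (m i)).trans (by rw [one_mul])
  have h := PiTensorProduct.norm_eval_le_projectiveSeminorm (B.mkContinuous 1 hB)
    (tensorComponent V k a)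
  have e : PiTensorProduct.lift (B.mkContinuous 1 hB).toMultilinearMap (tensorComponent V k a) =
      g (tensorProj V k a) := by
    have : PiTensorProduct.lift (B.mkContinuous 1 hB).toMultilinearMap =
        g.comp (TensorPower.toTensorAlgebra (n := k)) := by
      apply PiTensorProduct.ext
      ext m
      simp [B]
    exact LinearMap.congr_fun this _
  rw [e] at h
  rw [coeff_tensorPoly]
  refine h.trans ?_
  calc _ ≤ 1 * ‖tensorComponent V k a‖ := mul_le_mul_of_nonneg_right
        (MultilinearMap.mkContinuous_norm_le _ zero_le_one _) (norm_nonneg _)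
    _ = _ := one_mul _

/-- The two properties of the elements of the Lie algebra generated by `V` on which the estimates
rest: they are primitive, and homogeneous of degree one in the commutative quotients. -/
def IsLieLike (a : TensorAlgebra ℝ V) : Prop :=
  IsTensorPrimitive a ∧ ∀ φ : V →ₗ[ℝ] ℝ, ∃ s : ℝ, tensorPoly φ a = s • (X : ℝ[X])

theorem isLieLike_ι (v : V) : IsLieLike (TensorAlgebra.ι ℝ v) :=
  ⟨isTensorPrimitive_ι v, fun φ => ⟨φ v, tensorPoly_ι φ v⟩⟩

theorem IsLieLike.add {a b : TensorAlgebra ℝ V} (ha : IsLieLike a) (hb : IsLieLike b) :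
    IsLieLike (a + b) := by
  refine ⟨ha.1.add hb.1, fun φ => ?_⟩
  obtain ⟨s, hs⟩ := ha.2 φ
  obtain ⟨t, ht⟩ := hb.2 φ
  exact ⟨s + t, by rw [map_add, hs, ht, add_smul]⟩

theorem IsLieLike.smul (r : ℝ) {a : TensorAlgebra ℝ V} (ha : IsLieLike a) :
    IsLieLike (r • a) := by
  refine ⟨ha.1.smul r, fun φ => ?_⟩
  obtain ⟨s, hs⟩ := ha.2 φ
  exact ⟨r * s, by rw [map_smul, hs, smul_smul]⟩

theorem IsLieLike.neg {a : TensorAlgebra ℝ V} (ha : IsLieLike a) : IsLieLike (-a) := by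
  simpa using ha.smul (-1)

theorem IsLieLike.commutator {a b : TensorAlgebra ℝ V} (ha : IsLieLike a) (hb : IsLieLike b) :
    IsLieLike (a * b - b * a) := by
  refine ⟨ha.1.commutator hb.1, fun φ => ⟨0, ?_⟩⟩
  rw [map_sub, map_mul, map_mul, mul_comm, sub_self, zero_smul]

theorem coeff_expTrunc_smul_X {n k : ℕ} (hk : k ≤ n) (s : ℝ) :
    (expTrunc n (s • (X : ℝ[X]))).coeff k = (k.factorial : ℝ)⁻¹ * s ^ k := by
  rw [expTrunc, finsetSum_coeff, Finset.sum_eq_single k]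
  · simp [_root_.smul_pow]
  · intro j _ hj
    simp [_root_.smul_pow, coeff_X_pow, hj.symm]
  · intro h
    exact absurd (Finset.mem_range.2 (Nat.lt_succ_of_le hk)) h

/-- The component of degree one of a group-like element is controlled by the component of degree
two, of which its square is twice the symmetric part. -/
theorem exists_sq_le_of_isLieLike (hn : 2 ≤ n) (q : TensorNorm V n) : ∃ C : ℝ, 0 ≤ C ∧
    ∀ a b : TensorAlgebra ℝ V, IsLieLike a → IsLieLike b →
      q.toSeminorm (tensorProj V 1 (expTrunc n a * expTrunc n b)) ^ 2 ≤
        C * q.toSeminorm (tensorProj V 2 (expTrunc n a * expTrunc n b)) := by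
  obtain ⟨D, hD0, hD⟩ := q.exists_bound_tensorProj
  refine ⟨2 * D, by positivity, fun a b ha hb => ?_⟩
  set x := expTrunc n a * expTrunc n b with hx
  obtain ⟨v, hv⟩ : ∃ v, tensorProj V 1 x = TensorAlgebra.ι ℝ v := by
    have : wordsOfLength V 1 ≤ LinearMap.range (TensorAlgebra.ι ℝ (M := V)) := by
      rw [wordsOfLength, Submodule.span_le]
      rintro _ ⟨l, hl, rfl⟩
      obtain ⟨v, rfl⟩ := List.length_eq_one_iff.1 hl
      exact ⟨v, by simp [tensorWord]⟩
    obtain ⟨v, hv⟩ := this (tensorProj_mem_wordsOfLength 1 x)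
    exact ⟨v, hv.symm⟩
  -- A norming functional of `v` maps `x` to `exp(s X) exp(t X)`, whose coefficients in degrees one
  -- and two are `s + t` and `(s + t)^2 / 2`, with `s + t = ‖v‖`.
  obtain ⟨φ, hφ, hφv⟩ := exists_dual_vector'' ℝ v
  obtain ⟨s, hs⟩ := ha.2 φ
  obtain ⟨t, ht⟩ := hb.2 φ
  have hpoly : tensorPoly (φ : V →ₗ[ℝ] ℝ) x =
      expTrunc n (s • (X : ℝ[X])) * expTrunc n (t • (X : ℝ[X])) := by
    rw [hx, map_mul, map_expTrunc, map_expTrunc, hs, ht]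
  have h1 : (tensorPoly (φ : V →ₗ[ℝ] ℝ) x).coeff 1 = s + t := by
    rw [hpoly, coeff_mul, Finset.Nat.sum_antidiagonal_eq_sum_range_succ_mk, Finset.sum_range_succ,
      Finset.sum_range_succ, Finset.sum_range_zero]
    simp only [Nat.sub_zero, Nat.sub_self, zero_add]
    rw [coeff_expTrunc_smul_X (by omega), coeff_expTrunc_smul_X (by omega),
      coeff_expTrunc_smul_X (by omega), coeff_expTrunc_smul_X (by omega)]
    simp
    ring
  have h2 : (tensorPoly (φ : V →ₗ[ℝ] ℝ) x).coeff 2 = (s + t) ^ 2 / 2 := by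
    rw [hpoly, coeff_mul, Finset.Nat.sum_antidiagonal_eq_sum_range_succ_mk, Finset.sum_range_succ,
      Finset.sum_range_succ, Finset.sum_range_succ, Finset.sum_range_zero]
    simp only [Nat.sub_zero, Nat.sub_self, zero_add, Nat.reduceSub]
    rw [coeff_expTrunc_smul_X (by omega), coeff_expTrunc_smul_X (by omega),
      coeff_expTrunc_smul_X (by omega), coeff_expTrunc_smul_X (by omega),
      coeff_expTrunc_smul_X (by omega), coeff_expTrunc_smul_X (by omega)]
    simp
    ring
  have h3 : s + t = ‖v‖ := by
    rw [← h1, coeff_tensorPoly, hv, tensorPoly_ι]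
    simpa using hφv
  have h4 := abs_coeff_tensorPoly_le φ hφ 2 x
  rw [h2, h3, abs_of_nonneg (by positivity)] at h4
  have h5 := (hD 2 hn x).1
  rw [hv, q.map_ι]
  nlinarith

end LieLike

/-! ### Error estimates for algebraic group-like elements. -/

section AlgebraicEstimate

variable {V U W : Type*} [NormedAddCommGroup V] [NormedSpace ℝ V]
  [NormedAddCommGroup U] [NormedSpace ℝ U] [NormedAddCommGroup W] [NormedSpace ℝ W] {n : ℕ}

/-- In the full tensor algebra `x - 1` need not be nilpotent, so `exp` and `log` are inverse only up
to a multiple of `(x - 1)^(n+1)`, which `F^⊗` kills. -/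
theorem expTrunc_logTrunc_sub_mem {x : TensorAlgebra ℝ V}
    (hx : TensorAlgebra.algebraMapInv x = (1 : ℝ)) :
    expTrunc n (logTrunc n x) - x ∈ wordsOfLengthGE V (n + 1) := by
  obtain ⟨g, hg⟩ := X_pow_dvd_expTrunc_logTrunc n
  have h := congrArg (Polynomial.aeval (x - 1)) hg
  rw [map_sub, map_mul, map_pow, Polynomial.aeval_X, map_expTrunc, map_logTrunc, map_add,
    Polynomial.aeval_X, map_one, add_sub_cancel] at h
  rw [h]
  have htop : ∀ a : TensorAlgebra ℝ V, a ∈ wordsOfLengthGE V 0 := by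
    intro a
    induction a using tensorWord_induction with
    | hadd a b ha hb => exact Submodule.add_mem _ ha hb
    | hsmul r a ha => exact Submodule.smul_mem _ _ ha
    | hword l => exact Submodule.subset_span ⟨l, by simp, rfl⟩
  have := mul_mem_wordsOfLengthGE (pow_mem_wordsOfLengthGE (a := x - 1) (by rw [map_sub, hx]; simp)
    (n + 1)) (htop (Polynomial.aeval (x - 1) g))
  simpa using this

theorem algebraMapInv_expTrunc_mul {a b : TensorAlgebra ℝ V} (ha : IsTensorPrimitive a)
    (hb : IsTensorPrimitive b) :
    TensorAlgebra.algebraMapInv (expTrunc n a * expTrunc n b) = (1 : ℝ) := by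
  rw [map_mul, map_expTrunc, map_expTrunc, ha.algebraMapInv_eq_zero, hb.algebraMapInv_eq_zero,
    expTrunc_zero, one_mul]

theorem tensorProj_zero_logTrunc {x : TensorAlgebra ℝ V}
    (hx : TensorAlgebra.algebraMapInv x = (1 : ℝ)) : tensorProj V 0 (logTrunc n x) = 0 := by
  rw [tensorProj_zero_eq, map_logTrunc, hx, logTrunc_one, map_zero]

/-- The error is of order `n + 1` in the homogeneous size `h` of the group-like element. -/
theorem exists_error_le_pow (q : TensorNorm V n) (hn : 1 ≤ n) (F : V →L[ℝ] SteinSpace n U U) :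
    ∃ C : ℝ, 0 ≤ C ∧ ∀ (f : U → W) (hf : ContDiff ℝ n f) (M : ℝ), IsSteinLip n M f →
      ∀ a b : TensorAlgebra ℝ V, IsTensorPrimitive a → IsTensorPrimitive b →
      ∀ h : ℝ, 0 ≤ h → (∀ i, 1 ≤ i → i ≤ n →
        q.toSeminorm (tensorProj V i (expTrunc n a * expTrunc n b)) ≤ h ^ i) →
      ∀ (y z : ℝ → U) (δ : ℝ),
        (∀ u ∈ Set.Icc (0 : ℝ) 1, HasDerivWithinAt y (z u) (Set.Icc 0 1) u) →
        (∀ u ∈ Set.Icc (0 : ℝ) 1, ‖z u - tensorOpMap F id contDiff_id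
          (logTrunc n (expTrunc n a * expTrunc n b)) (y u)‖ ≤ δ) →
        ‖f (y 1) - tensorOpMap F f hf (expTrunc n a * expTrunc n b) (y 0)‖ ≤
          C * M * (h ^ (n + 1) + δ) := by
  obtain ⟨B, hB0, hB⟩ := exists_hasWeight_logTrunc_pow q
  obtain ⟨C₁, hC₁0, hC₁⟩ := taylor_expansion (W := W) q hn F B hB0
  obtain ⟨C₀, hC₀0, hC₀⟩ := exists_isSteinLip_tensorOpMap (W := W) q F
  have hq1 : 0 ≤ q.toSeminorm 1 := apply_nonneg _ _
  refine ⟨C₁ + (1 + C₀ * (n + q.toSeminorm 1)), by positivity, ?_⟩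
  intro f hf M hM a b ha hb h hh hx y z δ hy hz
  set x := expTrunc n a * expTrunc n b with hxdef
  have hM0 := hM.nonneg
  have hδ : 0 ≤ δ := (norm_nonneg _).trans (hz 0 (by simp))
  have haug : TensorAlgebra.algebraMapInv x = (1 : ℝ) := algebraMapInv_expTrunc_mul ha hb
  have hx0 : tensorProj V 0 x = 1 := by rw [tensorProj_zero_eq, haug, map_one]
  have hpos : 0 ≤ h ^ (n + 1) + δ := by positivity
  -- For `h ≤ 1` the Taylor expansion applies. For `h ≥ 1` there is nothing to compare: both terms
  -- are bounded by a constant times `M h^(n+1)`.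
  rcases le_total h 1 with hh1 | hh1
  · have h1 := hC₁ f hf M hM (logTrunc n x) h δ hh hh1 (tensorProj_zero_logTrunc haug)
      (fun j hj hjn => actsAsVectorField_of_dynkin F f hf hj (tensorProj_mem_wordsOfLength j _)
        (smul_tensorProj_logTrunc ha hb hjn)) (hB x h hh hx0 hx) y z hy hz
    have h2 : tensorOpMap F f hf (expTrunc n (logTrunc n x)) = tensorOpMap F f hf x := by
      rw [← sub_eq_zero, ← map_sub]
      exact tensorOpMap_eq_zero F f hf (expTrunc_logTrunc_sub_mem haug)
    rw [h2] at h1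
    refine h1.trans ?_
    have : C₁ ≤ C₁ + (1 + C₀ * (n + q.toSeminorm 1)) := le_add_of_nonneg_right (by positivity)
    gcongr
  · have hpow : 1 ≤ h ^ (n + 1) := one_le_pow₀ hh1
    have h1 : ‖tensorOpMap F f hf x (y 0)‖ ≤ C₀ * (n + q.toSeminorm 1) * M * h ^ (n + 1) := by
      rw [tensorOpMap_eq_sum, Finset.sum_apply, Finset.sum_range_succ']
      have hk : ∀ k ∈ Finset.range n,
          ‖tensorOpMap F f hf (tensorProj V (k + 1) x) (y 0)‖ ≤ C₀ * h ^ (n + 1) * M := by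
        intro k hk
        have hk' := Finset.mem_range.1 hk
        refine (((hC₀ (k + 1) (by omega) x).1 f hf M hM).norm_le _).trans ?_
        have h3 := hx (k + 1) (by omega) (by omega)
        have h4 : h ^ (k + 1) ≤ h ^ (n + 1) := pow_le_pow_right₀ hh1 (by omega)
        have := h3.trans h4
        gcongr
      have h0 : ‖tensorOpMap F f hf (tensorProj V 0 x) (y 0)‖ ≤
          C₀ * q.toSeminorm 1 * M * h ^ (n + 1) := by
        refine (((hC₀ 0 (by omega) x).1 f hf M hM).norm_le _).trans ?_
        rw [hx0]
        exact le_mul_of_one_le_right (by positivity) hpow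
      refine (norm_add_le _ _).trans ((add_le_add (norm_sum_le_of_le _ hk) h0).trans (le_of_eq ?_))
      simp only [Finset.sum_const, Finset.card_range, nsmul_eq_mul]
      ring
    calc ‖f (y 1) - tensorOpMap F f hf x (y 0)‖
        ≤ M * h ^ (n + 1) + C₀ * (n + q.toSeminorm 1) * M * h ^ (n + 1) :=
          (norm_sub_le _ _).trans
            (add_le_add ((hM.norm_le _).trans (le_mul_of_one_le_right hM0 hpow)) h1)
      _ = (0 + (1 + C₀ * (n + q.toSeminorm 1))) * M * (h ^ (n + 1) + 0) := by ring
      _ ≤ _ := by gcongr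

/-- The error in terms of the inhomogeneous size of the group-like element. -/
theorem exists_error_le (q : TensorNorm V n) (hn : 2 ≤ n) (F : V →L[ℝ] SteinSpace n U U) :
    ∃ C : ℝ, 0 ≤ C ∧ ∀ (f : U → W) (hf : ContDiff ℝ n f) (M : ℝ), IsSteinLip n M f →
      ∀ a b : TensorAlgebra ℝ V, IsLieLike a → IsLieLike b →
      ∀ r ρ : ℝ, 0 ≤ r → 0 ≤ ρ → (∀ i, 1 ≤ i → i ≤ n →
        q.toSeminorm (tensorProj V i (expTrunc n a * expTrunc n b)) ≤ r * ρ ^ i) →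
      ∀ (y z : ℝ → U) (δ : ℝ),
        (∀ u ∈ Set.Icc (0 : ℝ) 1, HasDerivWithinAt y (z u) (Set.Icc 0 1) u) →
        (∀ u ∈ Set.Icc (0 : ℝ) 1, ‖z u - tensorOpMap F id contDiff_id
          (logTrunc n (expTrunc n a * expTrunc n b)) (y u)‖ ≤ δ) →
        ‖f (y 1) - tensorOpMap F f hf (expTrunc n a * expTrunc n b) (y 0)‖ ≤
          C * M * ((1 + r ^ n) * ρ ^ (n + 1) + δ) := by
  obtain ⟨C₁, hC₁0, hC₁⟩ := exists_error_le_pow (W := W) q (by omega) F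
  obtain ⟨C₂, hC₂0, hC₂⟩ := exists_sq_le_of_isLieLike hn q
  set K := 1 + C₂ with hK
  have hK1 : 1 ≤ K := by rw [hK]; linarith
  have hKn : 1 ≤ K ^ n := one_le_pow₀ hK1
  refine ⟨C₁ * K ^ n, by positivity, ?_⟩
  intro f hf M hM a b ha hb r ρ hr hρ hx y z δ hy hz
  have hM0 := hM.nonneg
  have hδ : 0 ≤ δ := (norm_nonneg _).trans (hz 0 (by simp))
  set R := max 1 r with hR
  have hR1 : 1 ≤ R := le_max_left _ _
  have hrR : r ≤ R := le_max_right _ _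
  have hKR : 1 ≤ K * R := one_le_mul_of_one_le_of_one_le hK1 hR1
  -- `σ ρ` serves as homogeneous size. In degree one the square is bounded through degree two by `C₂
  -- r ρ^2 ≤ (σ ρ)^2`; in degree `i ≥ 2`, `r ≤ σ^2 ≤ σ^i`.
  set σ := Real.sqrt (K * R) with hσ
  have hσ1 : 1 ≤ σ := Real.one_le_sqrt.2 hKR
  have hσ2 : σ ^ 2 = K * R := Real.sq_sqrt (by linarith)
  have hRσ : R ≤ σ ^ 2 := by
    rw [hσ2]
    exact le_mul_of_one_le_left (by linarith) hK1
  have hweight : ∀ i, 1 ≤ i → i ≤ n →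
      q.toSeminorm (tensorProj V i (expTrunc n a * expTrunc n b)) ≤ (σ * ρ) ^ i := by
    intro i hi hin
    rcases hi.eq_or_lt with rfl | hi2
    · rw [pow_one]
      refine abs_le_of_sq_le_sq' ?_ (by positivity) |>.2
      calc _ ≤ C₂ * q.toSeminorm (tensorProj V 2 (expTrunc n a * expTrunc n b)) := hC₂ a b ha hb
        _ ≤ C₂ * (r * ρ ^ 2) := mul_le_mul_of_nonneg_left (hx 2 (by norm_num) hn) hC₂0
        _ ≤ K * (R * ρ ^ 2) := by
            have : C₂ ≤ K := by rw [hK]; linarith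
            gcongr
        _ = (σ * ρ) ^ 2 := by rw [mul_pow, hσ2]; ring
    · refine (hx i hi hin).trans ?_
      rw [mul_pow]
      refine mul_le_mul_of_nonneg_right ?_ (by positivity)
      exact hrR.trans (hRσ.trans (pow_le_pow_right₀ hσ1 hi2))
  have h1 := hC₁ f hf M hM a b ha.1 hb.1 (σ * ρ) (by positivity) hweight y z δ hy hz
  refine h1.trans ?_
  -- The square root pays off here: `n + 1 ≤ 2 n` gives `σ^(n+1) ≤ (K R)^n`.
  have h2 : σ ^ (n + 1) ≤ K ^ n * (1 + r ^ n) := by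
    calc σ ^ (n + 1) ≤ σ ^ (2 * n) := pow_le_pow_right₀ hσ1 (by omega)
      _ = K ^ n * R ^ n := by rw [pow_mul, hσ2, mul_pow]
      _ ≤ K ^ n * (1 + r ^ n) := by
          refine mul_le_mul_of_nonneg_left ?_ (by positivity)
          rcases le_total r 1 with h | h
          · rw [hR, max_eq_left h, one_pow]
            exact le_add_of_nonneg_right (by positivity)
          · rw [hR, max_eq_right h]
            exact le_add_of_nonneg_left zero_le_one
  calc C₁ * M * ((σ * ρ) ^ (n + 1) + δ) = C₁ * M * (σ ^ (n + 1) * ρ ^ (n + 1) + 1 * δ) := by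
        rw [mul_pow, one_mul]
    _ ≤ C₁ * M * ((K ^ n * (1 + r ^ n)) * ρ ^ (n + 1) + K ^ n * δ) := by gcongr
    _ = _ := by ring

end AlgebraicEstimate


/-! ### Time one maps -/

section Flow

open scoped NNReal

variable {U : Type*} [NormedAddCommGroup U] [NormedSpace ℝ U]

theorem IsTimeOneMap.unique {A : U → U} {K : ℝ≥0} (hl : LipschitzWith K A) {μ ν : U → U}
    (hμ : IsTimeOneMap A μ) (hν : IsTimeOneMap A ν) : ν = μ := by
  funext x
  obtain ⟨y, hy0, hy1, hy⟩ := hμ x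
  obtain ⟨w, hw0, hw1, hw⟩ := hν x
  have hcont : ∀ y : ℝ → U,
      (∀ u ∈ Set.Icc (0 : ℝ) 1, HasDerivWithinAt y (A (y u)) (Set.Icc 0 1) u) →
      ContinuousOn y (Set.Icc 0 1) := fun y hy u hu => (hy u hu).continuousWithinAt
  have hder : ∀ y : ℝ → U,
      (∀ u ∈ Set.Icc (0 : ℝ) 1, HasDerivWithinAt y (A (y u)) (Set.Icc 0 1) u) →
      ∀ u ∈ Set.Ico (0 : ℝ) 1, HasDerivWithinAt y (A (y u)) (Set.Ici u) u := fun y hy u hu =>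
    (hy u (Set.Ico_subset_Icc_self hu)).mono_of_mem_nhdsWithin (Icc_mem_nhdsGE_of_mem hu)
  have h := ODE_solution_unique_of_mem_Icc_right (v := fun _ => A) (s := fun _ => Set.univ)
    (K := K) (fun _ _ => hl.lipschitzOnWith) (hcont y hy) (hder y hy) (fun _ _ => Set.mem_univ _)
    (hcont w hw) (hder w hw) (fun _ _ => Set.mem_univ _) (by rw [hy0, hw0])
  have h1 := h (x := 1) (by simp)
  rw [← hy1, ← hw1]
  exact h1.symm

theorem exists_isTimeOneMap [CompleteSpace U] {A : U → U} {K : ℝ≥0} (hb : ∀ x, ‖A x‖ ≤ K)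
    (hl : LipschitzWith K A) : ∃ μ : U → U, IsTimeOneMap A μ := by
  have key : ∀ x : U, ∃ y : ℝ → U, y 0 = x ∧
      ∀ u ∈ Set.Icc (0 : ℝ) 1, HasDerivWithinAt y (A (y u)) (Set.Icc 0 1) u := by
    intro x
    -- The global bound `K` on the speed keeps the solution in the ball of radius `K` for a unit of
    -- time, so one application covers all of `[0, 1]`.
    have h : IsPicardLindelof (fun _ => A) (tmin := 0) (tmax := 1) ⟨0, by simp⟩ x K 0 K K :=
      { lipschitzOnWith := fun _ _ => hl.lipschitzOnWith
        continuousOn := fun _ _ => continuousOn_const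
        norm_le := fun _ _ z _ => hb z
        mul_max_le := by simp }
    exact h.exists_eq_forall_mem_Icc_hasDerivWithinAt₀
  choose y hy0 hy using key
  exact ⟨fun x => y x 1, fun x => ⟨y x, hy0 x, rfl, hy x⟩⟩

end Flow

/-! ### Passage to the completion -/

section Completion

open Filter Topology

variable {V U W : Type*} [NormedAddCommGroup V] [NormedSpace ℝ V]
  [NormedAddCommGroup U] [NormedSpace ℝ U] [NormedAddCommGroup W] [NormedSpace ℝ W] {n : ℕ}

/-- The canonical morphism from the algebraic tensor algebra to the Banach algebra `T^n(V)`. -/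
def tensorCoe (q : TensorNorm V n) : TensorAlgebra ℝ V →ₐ[ℝ] TensorBanach q :=
  { (UniformSpace.Completion.coeRingHom : AlgTensor q →+* TensorBanach q) with
    commutes' := fun _ => rfl }

theorem norm_tensorCoe (q : TensorNorm V n) (a : TensorAlgebra ℝ V) :
    ‖tensorCoe q a‖ = q.toSeminorm a :=
  UniformSpace.Completion.norm_coe (E := AlgTensor q) a

variable {q : TensorNorm V n}

theorem tensorExp_eq_expTrunc (e : TensorBanach q) : tensorExp e = expTrunc n e := rfl

theorem continuous_expTrunc : Continuous (expTrunc n : TensorBanach q → TensorBanach q) := by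
  refine continuous_finsetSum _ fun k _ => ?_
  exact (continuous_const_smul _).comp (continuous_pow k)

theorem continuous_logTrunc : Continuous (logTrunc n : TensorBanach q → TensorBanach q) := by
  refine continuous_finsetSum _ fun k _ => ?_
  have h : Continuous fun a : TensorBanach q => (a - 1) ^ k :=
    (continuous_id.sub continuous_const).pow k
  exact (continuous_const_smul _).comp h

attribute [local instance] LieRing.ofAssociativeRing LieAlgebra.ofAssociativeAlgebra

/-- The images of Lie-like elements form a Lie subalgebra that contains `V`. -/
theorem lieElements_subset_closure : lieElements q ⊆ closure (tensorCoe q '' {a | IsLieLike a}) := by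
  let S : LieSubalgebra ℝ (TensorBanach q) :=
    { carrier := tensorCoe q '' {a | IsLieLike a}
      add_mem' := by
        rintro _ _ ⟨a, ha, rfl⟩ ⟨b, hb, rfl⟩
        exact ⟨a + b, IsLieLike.add ha hb, map_add _ _ _⟩
      zero_mem' := ⟨0, by simpa using (isLieLike_ι (0 : V)), map_zero _⟩
      smul_mem' := by
        rintro r _ ⟨a, ha, rfl⟩
        exact ⟨r • a, IsLieLike.smul r ha, map_smul _ _ _⟩
      lie_mem' := by
        rintro _ _ ⟨a, ha, rfl⟩ ⟨b, hb, rfl⟩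
        exact ⟨a * b - b * a, IsLieLike.commutator ha hb, by
          rw [map_sub, map_mul, map_mul]
          rfl⟩ }
  have h : LieSubalgebra.lieSpan ℝ (TensorBanach q) (Set.range (tensorIncl q)) ≤ S := by
    rw [LieSubalgebra.lieSpan_le]
    rintro _ ⟨v, rfl⟩
    exact ⟨TensorAlgebra.ι ℝ v, isLieLike_ι v, rfl⟩
  exact closure_mono h

theorem exists_seq_of_mem_lieElements {ℓ : TensorBanach q} (hℓ : ℓ ∈ lieElements q) :
    ∃ a : ℕ → TensorAlgebra ℝ V, (∀ m, IsLieLike (a m)) ∧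
      Tendsto (fun m => tensorCoe q (a m)) atTop (𝓝 ℓ) := by
  obtain ⟨w, hw, hlim⟩ := mem_closure_iff_seq_limit.1 (lieElements_subset_closure hℓ)
  choose a ha hwa using hw
  refine ⟨a, ha, ?_⟩
  simpa only [hwa] using hlim

/-- For Lie-like elements the power has degree above `n`, hence seminorm zero; the identity passes
to limits. -/
theorem pow_eq_zero_of_mem_lieElements {ℓ : TensorBanach q} (hℓ : ℓ ∈ lieElements q) :
    ℓ ^ (n + 1) = 0 := by
  obtain ⟨a, ha, hlim⟩ := exists_seq_of_mem_lieElements hℓ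
  have h0 : ∀ m, tensorCoe q (a m) ^ (n + 1) = 0 := by
    intro m
    rw [← map_pow, ← norm_eq_zero, norm_tensorCoe, q.eq_zero_iff]
    intro k hk
    rw [← tensorComponent_tensorProj, tensorProj_eq_zero_of_mem (Nat.lt_succ_of_le hk)
      (pow_mem_wordsOfLengthGE (ha m).1.algebraMapInv_eq_zero (n + 1)), map_zero]
  have h1 := hlim.pow (n + 1)
  simp only [h0] at h1
  exact (tendsto_nhds_unique h1 tendsto_const_nhds)

theorem inverse_expTrunc {ℓ : TensorBanach q} (hℓ : ℓ ∈ lieElements q) :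
    Ring.inverse (expTrunc n ℓ) = expTrunc n (-ℓ) := by
  have h0 := pow_eq_zero_of_mem_lieElements hℓ
  have h0' : (-ℓ) ^ (n + 1) = 0 := by rw [neg_pow, h0, mul_zero]
  have h1 := expTrunc_add_of_commute ((Commute.refl ℓ).neg_right) h0 h0' (by simp)
  have h2 := expTrunc_add_of_commute ((Commute.refl ℓ).neg_left) h0' h0 (by simp)
  rw [add_neg_cancel, expTrunc_zero] at h1
  rw [neg_add_cancel, expTrunc_zero] at h2
  exact Ring.inverse_unit (⟨expTrunc n ℓ, expTrunc n (-ℓ), h1.symm, h2.symm⟩ : (TensorBanach q)ˣ)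

/-- The limits of the products of two exponentials of Lie elements of the algebraic tensor
algebra. -/
def IsGroupLimit (e : TensorBanach q) : Prop :=
  ∃ a b : ℕ → TensorAlgebra ℝ V, (∀ m, IsLieLike (a m)) ∧ (∀ m, IsLieLike (b m)) ∧
    Tendsto (fun m => tensorCoe q (expTrunc n (a m) * expTrunc n (b m))) atTop (𝓝 e)

/-- The increment is `exp(-ℓ) exp(ℓ')`, approximated factor by factor. Keeping a product of two
exponentials avoids the Campbell–Baker–Hausdorff formula and the fact that `𝒢^n(V)` is a group. -/
theorem isGroupLimit_increment {X : ℝ → TensorBanach q} {s t : ℝ} (hs : X s ∈ groupElements q)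
    (ht : X t ∈ groupElements q) : IsGroupLimit (increment X t s) := by
  obtain ⟨ℓ, hℓ, hs⟩ := hs
  obtain ⟨ℓ', hℓ', ht⟩ := ht
  obtain ⟨a, ha, hlim⟩ := exists_seq_of_mem_lieElements hℓ
  obtain ⟨b, hb, hlim'⟩ := exists_seq_of_mem_lieElements hℓ'
  refine ⟨fun m => -a m, b, fun m => (ha m).neg, hb, ?_⟩
  rw [increment, ← hs, ← ht, tensorExp_eq_expTrunc, tensorExp_eq_expTrunc, inverse_expTrunc hℓ]
  simp only [map_mul, map_expTrunc, map_neg]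
  exact ((continuous_expTrunc.tendsto _).comp hlim.neg).mul
    ((continuous_expTrunc.tendsto _).comp hlim')

theorem increment_self {X : ℝ → TensorBanach q} {t : ℝ} (ht : X t ∈ groupElements q) :
    increment X t t = 1 := by
  obtain ⟨ℓ, hℓ, ht⟩ := ht
  have h0 := pow_eq_zero_of_mem_lieElements hℓ
  have h0' : (-ℓ) ^ (n + 1) = 0 := by rw [neg_pow, h0, mul_zero]
  have h2 := expTrunc_add_of_commute ((Commute.refl ℓ).neg_left) h0' h0 (by simp)
  rw [neg_add_cancel, expTrunc_zero] at h2
  rw [increment, ← ht, tensorExp_eq_expTrunc, inverse_expTrunc hℓ, h2]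

theorem piProj_one {i : ℕ} (hi : 1 ≤ i) (hin : i ≤ n) : piProj q i 1 = 0 := by
  have h := (piProj_coe q hin).2 (1 : TensorAlgebra ℝ V)
  rw [tensorProj_one, if_neg (by omega)] at h
  exact h

theorem tendsto_seminorm_tensorProj {x : ℕ → TensorAlgebra ℝ V} {e : TensorBanach q}
    (h : Tendsto (fun m => tensorCoe q (x m)) atTop (𝓝 e)) {i : ℕ} (hi : i ≤ n) :
    Tendsto (fun m => q.toSeminorm (tensorProj V i (x m))) atTop (𝓝 ‖piProj q i e‖) := by
  have h1 := (((piProj_coe q hi).1.norm.tendsto e).comp h)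
  refine h1.congr fun m => ?_
  rw [← norm_tensorCoe]
  exact congrArg norm ((piProj_coe q hi).2 (x m))

theorem tendsto_tensorOpMap [CompleteSpace W] (F : V →L[ℝ] SteinSpace n U U) (f : U → W)
    (hf : ContDiff ℝ n f) {x : ℕ → TensorAlgebra ℝ V} {e : TensorBanach q}
    (h : Tendsto (fun m => tensorCoe q (x m)) atTop (𝓝 e)) (y : U) :
    Tendsto (fun m => tensorOpMap F f hf (x m) y) atTop (𝓝 (tensorOp F e f hf y)) :=
  (((tensorOp_coe F f hf y).1.tendsto e).comp h).congr fun m => (tensorOp_coe F f hf y).2 (x m)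

/-- Approximation of the vector field of the logarithm of a group-like element. -/
theorem exists_bound_tensorOp_id [CompleteSpace U] (q : TensorNorm V n)
    (F : V →L[ℝ] SteinSpace n U U) : ∃ C : ℝ, 0 ≤ C ∧
      ∀ (L : ℕ → TensorAlgebra ℝ V) (e : TensorBanach q), (∀ m, tensorProj V 0 (L m) = 0) →
        Tendsto (fun m => tensorCoe q (L m)) atTop (𝓝 e) →
        (∀ x, ‖tensorOp F e id contDiff_id x‖ ≤ C * ‖e‖) ∧
        (∀ x y, ‖tensorOp F e id contDiff_id x - tensorOp F e id contDiff_id y‖ ≤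
          C * ‖e‖ * ‖x - y‖) ∧
        ∀ m x, ‖tensorOp F e id contDiff_id x - tensorOpMap F id contDiff_id (L m) x‖ ≤
          C * ‖e - tensorCoe q (L m)‖ := by
  obtain ⟨C, hC0, hC⟩ := exists_isSteinLip_tensorOpMap_id q F
  refine ⟨C, hC0, fun L e hL0 hlim => ?_⟩
  have hop := fun x => tendsto_tensorOpMap F id contDiff_id hlim x
  have hnorm : Tendsto (fun m => C * q.toSeminorm (L m)) atTop (𝓝 (C * ‖e‖)) := by
    simp only [← norm_tensorCoe]
    exact hlim.norm.const_mul C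
  refine ⟨fun x => ?_, fun x y => ?_, fun m x => ?_⟩
  · exact le_of_tendsto_of_tendsto' (hop x).norm hnorm fun m => (hC _ (hL0 m)).norm_le x
  · exact le_of_tendsto_of_tendsto' ((hop x).sub (hop y)).norm (hnorm.mul_const _)
      fun m => (hC _ (hL0 m)).norm_sub_le x y
  · refine le_of_tendsto_of_tendsto' ((hop x).sub_const _).norm
      ((hlim.sub_const (tensorCoe q (L m))).norm.const_mul C) fun k => ?_
    have h := (hC (L k - L m) (by rw [map_sub, hL0, hL0, sub_zero])).norm_le x
    rw [map_sub, Pi.sub_apply, ← norm_tensorCoe, map_sub] at h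
    exact h

/-- The flow is that of the limit field itself. Its solution is an approximate solution for the
algebraic approximations, with defect at most `C₁ ‖log e - log x_m‖`, so the algebraic estimate
passes to the limit. -/
theorem exists_flow_estimate [CompleteSpace U] [CompleteSpace W] (q : TensorNorm V n) (hn : 2 ≤ n)
    (F : V →L[ℝ] SteinSpace n U U) : ∃ C : ℝ, 0 ≤ C ∧ ∀ e : TensorBanach q, IsGroupLimit e →
      ∃ μ : U → U, IsTimeOneMap (tensorOp F (tensorLog e) id contDiff_id) μ ∧
        (∀ ν : U → U, IsTimeOneMap (tensorOp F (tensorLog e) id contDiff_id) ν → ν = μ) ∧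
        ∀ r ρ : ℝ, 0 ≤ r → 0 ≤ ρ → (∀ i, 1 ≤ i → i ≤ n → ‖piProj q i e‖ < r * ρ ^ i) →
          ∀ (f : U → W) (hf : ContDiff ℝ n f) (M : ℝ), IsSteinLip n M f → ∀ x,
            ‖f (μ x) - tensorOp F e f hf x‖ ≤ C * M * ((1 + r ^ n) * ρ ^ (n + 1)) := by
  obtain ⟨C, hC0, hC⟩ := exists_error_le (W := W) q hn F
  obtain ⟨C₁, hC₁0, hC₁⟩ := exists_bound_tensorOp_id q F
  refine ⟨C, hC0, fun e he => ?_⟩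
  obtain ⟨a, b, ha, hb, hlim⟩ := he
  set x := fun m => expTrunc n (a m) * expTrunc n (b m) with hx
  have hloglim : Tendsto (fun m => tensorCoe q (logTrunc n (x m))) atTop (𝓝 (tensorLog e)) := by
    simp only [map_logTrunc]
    exact (continuous_logTrunc.tendsto e).comp hlim
  obtain ⟨hA, hAl, hAm⟩ := hC₁ (fun m => logTrunc n (x m)) (tensorLog e)
    (fun m => tensorProj_zero_logTrunc (algebraMapInv_expTrunc_mul (ha m).1 (hb m).1)) hloglim
  have hKpos : 0 ≤ C₁ * ‖tensorLog e‖ := by positivity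
  have hLip : LipschitzWith ⟨C₁ * ‖tensorLog e‖, hKpos⟩
      (tensorOp F (tensorLog e) (id : U → U) contDiff_id) := by
    refine LipschitzWith.of_dist_le_mul fun y z => ?_
    rw [dist_eq_norm, dist_eq_norm]
    exact hAl y z
  obtain ⟨μ, hμ⟩ := exists_isTimeOneMap (K := ⟨C₁ * ‖tensorLog e‖, hKpos⟩) hA hLip
  refine ⟨μ, hμ, fun ν hν => IsTimeOneMap.unique hLip hμ hν, ?_⟩
  intro r ρ hr hρ hlt f hf M hM x₀
  obtain ⟨y, hy0, hy1, hy⟩ := hμ x₀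
  -- The strict inequalities assumed on `e` are inherited by the approximations for large `m`.
  have hev : ∀ᶠ m in atTop, ∀ i, 1 ≤ i → i ≤ n →
      q.toSeminorm (tensorProj V i (x m)) ≤ r * ρ ^ i := by
    have h1 : ∀ i ∈ Finset.Icc 1 n, ∀ᶠ m in atTop,
        q.toSeminorm (tensorProj V i (x m)) ≤ r * ρ ^ i := by
      intro i hi
      obtain ⟨hi1, hin⟩ := Finset.mem_Icc.1 hi
      exact ((tendsto_seminorm_tensorProj hlim hin).eventually_lt_const (hlt i hi1 hin)).mono
        fun m hm => hm.le
    filter_upwards [(Filter.eventually_all_finset _).2 h1] with m hm i hi1 hin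
    exact hm i (Finset.mem_Icc.2 ⟨hi1, hin⟩)
  have hbound : ∀ᶠ m in atTop, ‖f (μ x₀) - tensorOpMap F f hf (x m) x₀‖ ≤
      C * M * ((1 + r ^ n) * ρ ^ (n + 1) + C₁ * ‖tensorLog e - tensorCoe q (logTrunc n (x m))‖) := by
    filter_upwards [hev] with m hm
    have h := hC f hf M hM (a m) (b m) (ha m) (hb m) r ρ hr hρ hm y _ _ hy
      (fun u _ => hAm m (y u))
    rwa [hy0, hy1] at h
  have hlimr : Tendsto (fun m => C * M * ((1 + r ^ n) * ρ ^ (n + 1) +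
      C₁ * ‖tensorLog e - tensorCoe q (logTrunc n (x m))‖)) atTop
      (𝓝 (C * M * ((1 + r ^ n) * ρ ^ (n + 1) + C₁ * ‖tensorLog e - tensorLog e‖))) :=
    (((hloglim.const_sub _).norm.const_mul C₁).const_add _).const_mul _
  rw [sub_self, norm_zero, mul_zero, add_zero] at hlimr
  exact le_of_tendsto_of_tendsto ((tendsto_tensorOpMap F f hf hlim x₀).const_sub _).norm hlimr
    hbound

end Completion

/-! ### Rough paths -/

section RoughPath

open Filter Topology

variable {V : Type*} [NormedAddCommGroup V] [NormedSpace ℝ V] {n : ℕ} {q : TensorNorm V n}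

theorem roughNorm_nonneg (p T : ℝ) (X : ℝ → TensorBanach q) : 0 ≤ roughNorm p T X := by
  refine Real.sSup_nonneg fun r hr => ?_
  simp only [Set.mem_iUnion] at hr
  obtain ⟨i, _, s, t, _, _, _, rfl⟩ := hr
  positivity

/-- The case `s = t`, absent from the Hölder quotients, holds because the increment is then `1`,
whose components of positive degree vanish. -/
theorem IsWeakGeometricRoughPath.norm_piProj_le {p T : ℝ} {X : ℝ → TensorBanach q}
    (hX : IsWeakGeometricRoughPath p T X) {i : ℕ} (hi : 1 ≤ i) (hin : i ≤ n) {s t : ℝ}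
    (hs : 0 ≤ s) (hst : s ≤ t) (ht : t ≤ T) :
    ‖piProj q i (increment X t s)‖ ≤ roughNorm p T X * (|t - s| ^ (1 / p)) ^ i := by
  rcases hst.eq_or_lt with rfl | hst
  · rw [increment_self (hX.mem_group s ⟨hs, ht⟩), piProj_one hi hin, norm_zero]
    have := roughNorm_nonneg p T X
    positivity
  · have hbdd : BddAbove (⋃ i ∈ Finset.Icc 1 n, holderQuotients p T X i) := by
      have := (Set.Finite.bddAbove_biUnion (Finset.finite_toSet (Finset.Icc 1 n))
        (S := holderQuotients p T X)).2 hX.bddAbove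
      exact this
    have hmem : ‖piProj q i (increment X t s)‖ / |t - s| ^ ((i : ℝ) / p) ∈
        ⋃ i ∈ Finset.Icc 1 n, holderQuotients p T X i := by
      simp only [Set.mem_iUnion]
      exact ⟨i, Finset.mem_Icc.2 ⟨hi, hin⟩, s, t, hs, hst, ht, rfl⟩
    have hpos : 0 < |t - s| := abs_pos.2 (sub_ne_zero.2 hst.ne')
    have h := le_csSup hbdd hmem
    rw [div_le_iff₀ (Real.rpow_pos_of_pos hpos _)] at h
    rwa [← Real.rpow_mul_natCast hpos.le, one_div_mul_eq_div]

end RoughPath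

end

theorem mainTheorem2
    {U V : Type*} [NormedAddCommGroup U] [NormedSpace ℝ U] [CompleteSpace U]
    [NormedAddCommGroup V] [NormedSpace ℝ V] [CompleteSpace V]
    (p : ℝ) (hp : 2 ≤ p) (T : ℝ) (hT : 0 < T)
    (q : TensorNorm V ⌊p⌋₊) (F : V →L[ℝ] SteinSpace ⌊p⌋₊ U U) :
    ∃ c : ℝ, 0 < c ∧
      ∀ X : ℝ → TensorBanach q, IsWeakGeometricRoughPath p T X →
        ∀ s t : ℝ, 0 ≤ s → s ≤ t → t ≤ T →
          ∃ μ : U → U,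
            IsTimeOneMap (tensorOp F (tensorLog (increment X t s)) id contDiff_id) μ ∧
            (∀ ν : U → U,
              IsTimeOneMap (tensorOp F (tensorLog (increment X t s)) id contDiff_id) ν → ν = μ) ∧
            ∀ f : SteinSpace ⌊p⌋₊ U ℝ, ∀ x : U,
              |f (μ x) - tensorOp F (increment X t s) f f.contDiff x| ≤
                c * (1 + roughNorm p T X ^ ⌊p⌋₊) * ‖f‖ *
                  |t - s| ^ (((⌊p⌋₊ : ℝ) + 1) / p) := by
  -- The hypothesis `p ≥ 2` provides the degree two component that controls degree one.
  have hn : 2 ≤ ⌊p⌋₊ := Nat.le_floor (by exact_mod_cast hp)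
  obtain ⟨C, hC0, hC⟩ := exists_flow_estimate (W := ℝ) q hn F
  refine ⟨C + 1, by positivity, fun X hX s t hs hst ht => ?_⟩
  obtain ⟨μ, hμ, huniq, herr⟩ := hC (increment X t s) (isGroupLimit_increment
    (hX.mem_group s ⟨hs, hst.trans ht⟩) (hX.mem_group t ⟨hs.trans hst, ht⟩))
  refine ⟨μ, hμ, huniq, fun f x => ?_⟩
  set r := roughNorm p T X with hr
  set ρ := |t - s| ^ (1 / p) with hρ
  have hr0 : 0 ≤ r := roughNorm_nonneg p T X
  have hρ0 : 0 ≤ ρ := Real.rpow_nonneg (abs_nonneg _) _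
  have hpow : |t - s| ^ (((⌊p⌋₊ : ℝ) + 1) / p) = ρ ^ (⌊p⌋₊ + 1) := by
    rw [hρ, ← Real.rpow_mul_natCast (abs_nonneg _), one_div_mul_eq_div]
    push_cast
    rfl
  -- The rough path gives only weak inequalities. Enlarging `r` and `ρ` by `η` makes them strict,
  -- even if `r` or `ρ` is zero, and `η → 0` restores the constants.
  have hη : ∀ η > 0, |f (μ x) - tensorOp F (increment X t s) f f.contDiff x| ≤
      C * ‖f‖ * ((1 + (r + η) ^ ⌊p⌋₊) * (ρ + η) ^ (⌊p⌋₊ + 1)) := by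
    intro η hη
    refine herr (r + η) (ρ + η) (by positivity) (by positivity) (fun i hi hin => ?_) f.1 f.contDiff
      ‖f‖ (SteinSpace.isSteinLip_norm f) x
    refine (hX.norm_piProj_le hi hin hs hst ht).trans_lt ?_
    calc r * ρ ^ i ≤ r * (ρ + η) ^ i := by gcongr; linarith
      _ < (r + η) * (ρ + η) ^ i := mul_lt_mul_of_pos_right (by linarith) (by positivity)
  have hlim : Filter.Tendsto
      (fun η : ℝ => C * ‖f‖ * ((1 + (r + η) ^ ⌊p⌋₊) * (ρ + η) ^ (⌊p⌋₊ + 1)))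
      (nhdsWithin 0 (Set.Ioi 0))
      (nhds (C * ‖f‖ * ((1 + (r + 0) ^ ⌊p⌋₊) * (ρ + 0) ^ (⌊p⌋₊ + 1)))) := by
    refine Filter.Tendsto.mono_left (Continuous.tendsto ?_ 0) nhdsWithin_le_nhds
    fun_prop
  have h := ge_of_tendsto hlim (eventually_nhdsWithin_of_forall fun η hη' => hη η hη')
  rw [add_zero, add_zero] at h
  rw [hpow]
  refine h.trans ?_
  calc C * ‖f‖ * ((1 + r ^ ⌊p⌋₊) * ρ ^ (⌊p⌋₊ + 1))
      = C * ((1 + r ^ ⌊p⌋₊) * ‖f‖ * ρ ^ (⌊p⌋₊ + 1)) := by ring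
    _ ≤ (C + 1) * ((1 + r ^ ⌊p⌋₊) * ‖f‖ * ρ ^ (⌊p⌋₊ + 1)) :=
        mul_le_mul_of_nonneg_right (by linarith) (by positivity)
    _ = _ := by ring
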